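/- **Conventions.** Let $n\ge 1$, let $\lambda=(\lambda_1\ge\dots\ge\lambda_n\ge 0)$ be a partition with at most $n$ rows, and let $X_k=E_{k,k+1}$, $Y_k=E_{k+1,k}$, $H_k=E_{k,k}-E_{k+1,k+1}$ ($1\le k\le n-1$) be the Chevalley generators of $\mathfrak{sl}_n(\mathbb C)$. The *Gelfand–Tsetlin lattice* $GT(\lambda)$ is the edge-coloured ranked poset whose vertices are the semistandard Young tableaux of shape $\lambda$ with entries in $\{1,\dots,n\}$, with an edge (covering relation) $S\stackrel{k}{\to}R$ of colour $k$ whenever $R$ is obtained from $S$ by changing a single entry $k+1$ into $k$. The edge is said to lie in the row of the changed entry, and rows containing such a *decrementable* $k+1$ are called decrementable. For a finite edge-coloured ranked poset $P$, each edge having one colour, put $m_i(s)=2\rho_i(s)-l_i(s)$, where $l_i(s)$ is the rank of the $i$-component of $s$ (the connected component of $s$ in the graph of edges of colour $i$) and $\rho_i(s)$ is the rank of $s$ in it. Give the edges $s\to t$ complex labels $c_{t,s},d_{s,t}$. The *edge product* is $\pi_{s,t}=c_{t,s}d_{s,t}$. The *crossing relations* are $$\sum_{r:\,r\stackrel{i}{\to}s}\pi_{r,s}-\sum_{t:\,s\stackrel{i}{\to}t}\pi_{s,t}=m_i(s)\quad\text{for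 all } s,i,$$ and the *diamond relations* are $$\sum_{u:\,s\stackrel{j}{\to}u,\;t\stackrel{i}{\to}u}c_{u,s}d_{t,u}=\sum_{r:\,r\stackrel{i}{\to}s,\;r\stackrel{j}{\to}t}d_{r,s}c_{t,r}\quad\text{for all } s\ne t \text{ of equal rank and all } i,j.$$ A basis $\{v_s\}_{s\in P}$ of an $\mathfrak{sl}_n$-module $V$ has $P$ as its *supporting graph* if there are labels, not both $0$ on any edge, with $$X_iv_s=\sum_{t:\,s\stackrel{i}{\to}t}c_{t,s}v_t,\qquad Y_iv_t=\sum_{s:\,s\stackrel{i}{\to}t}d_{s,t}v_s,\qquad H_iv_s=m_i(s)v_s .$$ The supporting graph $P$ is *solitary* if, given a basis of $V$ with supporting graph $P$, the bases of $V$ with supporting graph $P$ are exactly those obtained from it by rescaling the basis vectors. It is *edge-minimal* if no proper subgraph of $P$ is the supporting graph of a basis of $V$. **Algorithm** (input: the vertex weights $m_k(S)$ of $GT(\lambda)$; output: a rational number for each edge). Fix any list of all tableaux, without repetition, in which each tableau $S$ precedes every $R$ with an edge $S\to R$. For $k=1,\dots,n-1$ in this order, go through all tableaux $S$ in the order of the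 list, and determine the edge products of the edges of colour $k$ starting at $S$ as follows. 1. For each decrementable row $p$ that is not the lowest one, let $p'$ be the next decrementable row and let $i<k$ be the entry just above the leftmost $k+1$ in row $p'$ of $S$. Let $U$ be obtained from $S$ by changing the rightmost $i$ in row $p'-1$ into $i+1$, and let $R$, $T$ be obtained from $S$, $U$ by changing the leftmost $k+1$ in row $p$ into $k$. Set $\pi_{S,R}=\pi_{U,S}\,\pi_{U,T}/\pi_{T,R}$. 2. Determine the edge product for the lowest decrementable row, if there is one, by the crossing relation for $S$ and colour $k$. For $k=1$ at most the first row is decrementable, so only crossing relations are used, along the chains that form the $1$-components. **Theorem.** (a) Lists as required exist. For each such list the algorithm never meets an undetermined edge product or a zero divisor, and it ends with a nonzero rational number assigned to every edge of $GT(\lambda)$. For all complex labels $c,d$ on $GT(\lambda)$ that satisfy the crossing and diamond relations, the edge product of every edge equals the number assigned to it. (b) Let $V$ be the finite-dimensional irreducible $\mathfrak{sl}_n$-module with highest weight $\lambda$. Then $GT(\lambda)$ is the supporting graph of a basis of $V$, and it is solitary and edge-minimal. -/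

import Mathlib

namespace GelfandTsetlin

/-! ### Edge-colored ranked posets -/

/-- An edge-colored ranked poset on the vertex set `P` with colors in `I`, identified with its
Hasse diagram: `Edge i s t` says that `t` covers `s` and that this edge `s → t` has color `i`. Since
every edge raises the rank by one, the edges are precisely the covering relations of the partial
order that they generate. Every edge has exactly one color. -/
structure ColoredPoset (I P : Type*) where
  Edge : I → P → P → Prop
  rank : P → ℤ
  rank_edge : ∀ {i s t}, Edge i s t → rank t = rank s + 1
  color_unique : ∀ {i j s t}, Edge i s t → Edge j s t → i = j

namespace ColoredPoset

variable {I P : Type*} (G : ColoredPoset I P)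

/-- The vertex set of the `i`-component of `s`, that is of the connected component of `s` in the
subgraph formed by the edges of color `i`. -/
def component (i : I) (s : P) : Set P := {t | Relation.EqvGen (G.Edge i) s t}

/-- The rank of the vertex `s` within its `i`-component. -/
noncomputable def rho (i : I) (s : P) : ℤ := G.rank s - sInf (G.rank '' G.component i s)

/-- The rank (length) of the `i`-component of `s`. -/
noncomputable def len (i : I) (s : P) : ℤ :=
  sSup (G.rank '' G.component i s) - sInf (G.rank '' G.component i s)

/-- The vertex weight `m_i(s) = 2 ρ_i(s) - l_i(s)`. -/
noncomputable def m (i : I) (s : P) : ℤ := 2 * G.rho i s - G.len i s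

variable [Fintype P]

open Classical in
/-- The crossing condition for the edge labels `c t s` and `d s t` of the edges `s → t`; the product
`c t s * d s t` is the edge product of `s → t`. -/
def Crossing (c d : P → P → ℂ) : Prop :=
  ∀ (i : I) (s : P),
    (∑ r with G.Edge i r s, c s r * d r s) - (∑ t with G.Edge i s t, c t s * d s t) = (G.m i s : ℂ)

open Classical in
/-- The diamond condition for the edge labels `c t s` and `d s t` of the edges `s → t`. -/
def Diamond (c d : P → P → ℂ) : Prop :=
  ∀ (i j : I) (s t : P), s ≠ t → G.rank s = G.rank t →
    (∑ u with G.Edge j s u ∧ G.Edge i t u, c u s * d t u) =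
      ∑ r with G.Edge i r s ∧ G.Edge j r t, d r s * c t r

end ColoredPoset

/-! ### Supporting graphs for representations of the special linear Lie algebra -/

/-- The Lie algebra `sl_{r+1}` over the complex numbers. -/
abbrev SL (r : ℕ) := LieAlgebra.SpecialLinear.sl (Fin (r + 1)) ℂ

/-- The Chevalley generator `X_k = E_{k,k+1}`. -/
noncomputable def X {r : ℕ} (k : Fin r) : SL r :=
  LieAlgebra.SpecialLinear.single k.castSucc k.succ (Fin.castSucc_lt_succ (i := k)).ne 1

/-- The Chevalley generator `Y_k = E_{k+1,k}`. -/
noncomputable def Y {r : ℕ} (k : Fin r) : SL r :=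
  LieAlgebra.SpecialLinear.single k.succ k.castSucc (Fin.castSucc_lt_succ (i := k)).ne' 1

/-- The Chevalley generator `H_k = E_{k,k} - E_{k+1,k+1}`. -/
noncomputable def H {r : ℕ} (k : Fin r) : SL r :=
  LieAlgebra.SpecialLinear.singleSubSingle k.castSucc k.succ 1

section Representations

variable {r : ℕ} {P : Type*} [Fintype P]
variable {V : Type*} [AddCommGroup V] [Module ℂ V] [LieRingModule (SL r) V]

open Classical in
/-- The edge-colored poset `G` together with the edge labels `c`, `d` is the representation diagram
of the weight basis `b` of `V`. -/
def IsRepresentationDiagram (G : ColoredPoset (Fin r) P) (c d : P → P → ℂ)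
    (b : Module.Basis P ℂ V) : Prop :=
  (∀ k s t, G.Edge k s t → c t s ≠ 0 ∨ d s t ≠ 0) ∧
  (∀ k s, ⁅X k, b s⁆ = ∑ t with G.Edge k s t, c t s • b t) ∧
  (∀ k t, ⁅Y k, b t⁆ = ∑ s with G.Edge k s t, d s t • b s) ∧
  (∀ k s, ⁅H k, b s⁆ = (G.m k s : ℂ) • b s)

/-- `G` is the supporting graph for the weight basis `b` of `V`. -/
def IsSupportingGraph (G : ColoredPoset (Fin r) P) (b : Module.Basis P ℂ V) : Prop :=
  ∃ c d : P → P → ℂ, IsRepresentationDiagram G c d b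

/-- Two bases are diagonally equivalent if their transition matrix is diagonal. -/
def DiagonallyEquivalent (b b' : Module.Basis P ℂ V) : Prop :=
  ∃ a : P → ℂ, ∀ s, b' s = a s • b s

/-- For every weight basis of `V` with supporting graph `G`, the bases with the same supporting
graph are exactly the diagonally equivalent ones. -/
def IsSolitary (G : ColoredPoset (Fin r) P) (V : Type*) [AddCommGroup V] [Module ℂ V]
    [LieRingModule (SL r) V] : Prop :=
  ∀ b : Module.Basis P ℂ V, IsSupportingGraph G b →
    ∀ b' : Module.Basis P ℂ V, IsSupportingGraph G b' ↔ DiagonallyEquivalent b b'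

open Classical in
/-- No proper subgraph of `G` is the supporting graph for a weight basis of `V`. A subgraph consists
of a set `Q` of vertices of `G` and of a set of edges of `G` between vertices in `Q`, which keep
their direction and color. -/
def IsEdgeMinimal (G : ColoredPoset (Fin r) P) (V : Type*) [AddCommGroup V] [Module ℂ V]
    [LieRingModule (SL r) V] : Prop :=
  ∀ (Q : Set P) (G' : ColoredPoset (Fin r) Q),
    (∀ k (s t : Q), G'.Edge k s t → G.Edge k s t) →
    (∃ b : Module.Basis Q ℂ V, IsSupportingGraph G' b) →
      Q = Set.univ ∧ ∀ k (s t : Q), G.Edge k s t → G'.Edge k s t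

end Representations

/-! ### The Gelfand–Tsetlin lattice -/

/-- Semistandard Young tableaux of shape `μ` with `r + 1` possible entries `0, …, r`. Rows, columns,
entries and colors are numbered from `0`. -/
def Tableau (r : ℕ) (μ : YoungDiagram) : Type :=
  {T : SemistandardYoungTableau μ // ∀ i j, T i j ≤ r}

namespace Tableau

variable {r : ℕ} {μ : YoungDiagram}

instance : CoeFun (Tableau r μ) (fun _ => ℕ → ℕ → ℕ) := ⟨fun T => T.1⟩

theorem ext' {S T : Tableau r μ} (h : ∀ i j, S i j = T i j) : S = T :=
  Subtype.ext (SemistandardYoungTableau.ext h)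

instance : Finite (Tableau r μ) := by
  refine Finite.of_injective (β := μ.cells → Fin (r + 1))
    (fun T x => ⟨T x.1.1 x.1.2, Nat.lt_succ_of_le (T.2 _ _)⟩) ?_
  intro S T h
  apply ext'
  intro i j
  by_cases hx : (i, j) ∈ μ
  · have := congrFun h ⟨(i, j), (YoungDiagram.mem_cells _).2 hx⟩
    simpa using this
  · exact (S.1.zeros hx).trans (T.1.zeros hx).symm

noncomputable instance : Fintype (Tableau r μ) := Fintype.ofFinite _

/-- The tableau `R` is obtained from `S` by changing a single entry `k + 1`, which lies in row `p`,
into `k` (since `R` is semistandard, this is necessarily the leftmost `k + 1` in row `p` of `S`).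
Equivalently, `S` is obtained from `R` by changing the rightmost entry `k` in row `p` of `R` into
`k + 1`. -/
def Decrement (k p : ℕ) (S R : Tableau r μ) : Prop :=
  ∃ j, (p, j) ∈ μ ∧ S p j = k + 1 ∧ R p j = k ∧ ∀ x y, (x, y) ≠ (p, j) → R x y = S x y

end Tableau

/-- The Gelfand–Tsetlin lattice of shape `μ` for `sl_{r+1}`: there is an edge `S → T` of color `k`
whenever `T` is obtained from `S` by changing a single entry `k + 1` into `k`. -/
def GT (r : ℕ) (μ : YoungDiagram) : ColoredPoset (Fin r) (Tableau r μ) where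
  Edge k S T := ∃ p, Tableau.Decrement k p S T
  rank T := -∑ x ∈ μ.cells, (T x.1 x.2 : ℤ)
  rank_edge := by
    rintro k S T ⟨p, j, hm, hS, hT, h⟩
    have hm' : (p, j) ∈ μ.cells := (YoungDiagram.mem_cells _).2 hm
    rw [← Finset.add_sum_erase _ _ hm', ← Finset.add_sum_erase _ _ hm']
    have : ∑ x ∈ μ.cells.erase (p, j), (T x.1 x.2 : ℤ) =
        ∑ x ∈ μ.cells.erase (p, j), (S x.1 x.2 : ℤ) :=
      Finset.sum_congr rfl fun x hx => by rw [h x.1 x.2 (Finset.ne_of_mem_erase hx)]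
    simp only [this, hS, hT]
    push_cast
    ring
  color_unique := by
    rintro k k' S T ⟨p, j, _, hS, hT, h⟩ ⟨p', j', _, hS', hT', h'⟩
    by_cases e : (p, j) = (p', j')
    · obtain ⟨rfl, rfl⟩ := Prod.mk.inj e
      exact Fin.ext (hT.symm.trans hT')
    · have := h' p j e
      omega

/-! ### The algorithm

It fills in a table of edge products, whose entries are the rational number found for an edge, or
`none` as long as the edge product is not known. -/

/-- `σ k S p` is the edge product, if already known, of the edge of color `k` from `S` to the tableau
obtained from `S` by decrementing a `k + 1` in row `p`. -/
abbrev Table (r : ℕ) (μ : YoungDiagram) := ℕ → Tableau r μ → ℕ → Option ℚ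

namespace Algorithm

open Tableau

variable {r : ℕ} {μ : YoungDiagram}

open Classical in
/-- Change the leftmost `k + 1` in row `p` of `S` into `k`, if this gives a tableau. -/
noncomputable def dec (k p : ℕ) (S : Tableau r μ) : Option (Tableau r μ) :=
  if h : ∃ R, Decrement k p S R then some h.choose else none

open Classical in
/-- Change the rightmost `k` in row `p` of `S` into `k + 1`, if this gives a tableau. -/
noncomputable def inc (k p : ℕ) (S : Tableau r μ) : Option (Tableau r μ) :=
  if h : ∃ U, Decrement k p U S then some h.choose else none

/-- The rows of `S` that contain a decrementable copy of `k + 1`. -/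
def decRows (k : ℕ) (S : Tableau r μ) : Set ℕ := {p | ∃ R, Decrement k p S R}

/-- The column of the leftmost `k + 1` in row `p` of `S`. -/
noncomputable def leftCol (k p : ℕ) (S : Tableau r μ) : ℕ := sInf {j | S p j = k + 1}

open Classical in
/-- The edge product forced by a diamond relation for the edge of color `k` from `S` in the
decrementable row `p`, if `p` is not the lowest such row. Let `p'` be the next decrementable row, and
let `i` be the entry immediately above the leftmost `k + 1` in row `p'`. Increment the rightmost `i`
in row `p' - 1` of `S` to get `U`, and decrement the leftmost `k + 1` in row `p` of `S` and of `U` to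
get `R` and `T`. Then the edge product of `S → R` is the product of those of `U → S` and of `U → T`,
divided by that of `T → R`. This succeeds only if the three edge products are known, the last one
being nonzero. -/
noncomputable def diamondStep (σ : Table r μ) (k : ℕ) (S : Tableau r μ) (p : ℕ) : Option ℚ :=
  let p' := sInf {q | q ∈ decRows k S ∧ p < q}
  let i := S (p' - 1) (leftCol k p' S)
  (inc i (p' - 1) S).bind fun U =>
  (dec k p U).bind fun T =>
  (σ i U (p' - 1)).bind fun πUS =>
  (σ k U p).bind fun πUT =>
  (σ i T (p' - 1)).bind fun πTR =>
  if πTR = 0 then none else some (πUS * πUT / πTR)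

open Classical in
/-- The edge product forced by the crossing relation for the vertex `S` and the color `k` for the edge
of color `k` from `S` in the decrementable row `p`. The edges of color `k` ending at `S` start at the
tableaux obtained from `S` by incrementing a `k`. This succeeds only if the edge products of all the
other edges of color `k` at `S` are known. Rows are numbered by `0, …, r`, as a tableau has at most
`r + 1` rows. -/
noncomputable def crossingStep (m : Fin r → Tableau r μ → ℤ) (σ : Table r μ) (k : Fin r)
    (S : Tableau r μ) (p : ℕ) : Option ℚ :=
  let incoming : ℕ → Option ℚ := fun q => (inc k q S).elim (some 0) fun Q => σ k Q q
  let outgoing : ℕ → Option ℚ := fun q => if q ∈ decRows k S ∧ q ≠ p then σ k S q else some 0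
  if ∀ q ∈ Finset.range (r + 1), (incoming q).isSome ∧ (outgoing q).isSome then
    some ((∑ q ∈ Finset.range (r + 1), (incoming q).getD 0)
      - (∑ q ∈ Finset.range (r + 1), (outgoing q).getD 0) - m k S)
  else none

open Classical in
/-- Determine the edge products of the edges of color `k` from `S`: first all but the one in the
lowest decrementable row by diamond relations, then this last one by the crossing relation. (For the
color `0` only the top row can be decrementable, so only the crossing relation is used.) -/
noncomputable def processVertex (m : Fin r → Tableau r μ → ℤ) (k : Fin r) (σ : Table r μ)
    (S : Tableau r μ) : Table r μ :=
  let σ₁ : Table r μ := fun k' A p =>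
    if k' = k ∧ A = S ∧ p ∈ decRows k S ∧ ∃ q ∈ decRows k S, p < q then diamondStep σ k S p
    else σ k' A p
  fun k' A p =>
    if k' = k ∧ A = S ∧ p ∈ decRows k S ∧ ¬ ∃ q ∈ decRows k S, p < q then crossingStep m σ₁ k S p
    else σ₁ k' A p

/-- Treat the vertices one after the other, in the order of the list `L`. -/
noncomputable def processColor (m : Fin r → Tableau r μ → ℤ) (L : List (Tableau r μ))
    (σ : Table r μ) (k : Fin r) : Table r μ :=
  L.foldl (processVertex m k) σ

/-- The algorithm: starting from the empty table and the vertex weights `m`, treat the colors one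
after the other, in increasing order. -/
noncomputable def run (m : Fin r → Tableau r μ → ℤ) (L : List (Tableau r μ)) : Table r μ :=
  (List.finRange r).foldl (processColor m L) fun _ _ _ => none

/-- `L` lists all the vertices of the Gelfand–Tsetlin lattice in an admissible order: every tableau
is preceded by those from which it can be reached by decrementing entries. -/
def IsAdmissibleOrder (L : List (Tableau r μ)) : Prop :=
  L.Nodup ∧ (∀ S, S ∈ L) ∧ L.Pairwise fun A B => ∀ k, ¬ (GT r μ).Edge k B A

end Algorithm

end GelfandTsetlin

/-!
The counts `Tableau.cnt`, of the entries smaller than `k` in row `p`, turn tableaux into interlacing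
patterns in which an edge of the lattice raises one number by one. In these terms the lattice is
distributive: two edges with a common start or a common end complete to a diamond (`exists_diamond_below`,
`exists_diamond_above`), in a unique way (`diamond_labels`), and the weight `m_k` is a second
difference of row sums of the pattern (`m_eq`).

*A solution.* The Gelfand–Tsetlin formula `Tableau.edgeProduct` assigns a positive rational number to
every edge. The edge products of one color at a vertex are, up to sign, the residues of a rational
function `∏ (z - c) ∏ (z - d) / (∏ (z - a) ∏ (z - b))`, and the sum of its residues (`sum_residue`)
gives the crossing relations (`sum_residue_sub_sum_edgeProduct`). Around a diamond the products of the
numbers on the two upper and on the two lower edges agree (`edgeProduct_diamond`); hence the labels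
`√edgeProduct`, the same in both directions, satisfy the diamond relations as well.

*Uniqueness and the algorithm.* By induction on the color and then on the rank, the edge products of
any solution agree with those of the Gelfand–Tsetlin solution (`mul_eq_edgeProduct`): if a decrementable
row is not the lowest one, then the diamond of `exists_diamond` has two edges of a smaller color and one
edge that starts at a smaller rank, and the lowest row follows from the crossing relation. The algorithm
runs through the same induction (`Algorithm.known_run`); positivity excludes zero divisors.

*Realisation.* Crossing and diamond relations say that the operators `X_k`, `Y_k` on the space `W` of
functions on the tableaux have the commutators required by `sl_n` (`ColoredPoset.commutator_iff`). The
Serre relations are avoided: the subspace of `V × W` generated by the operators `Y_k` from the pair of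
highest weight vectors is stable under all generators (`cyclic_stable`), and is the graph of an
isomorphism since `V` is irreducible and `W` has no proper nonzero subspace stable under the operators
`X_k` and `Y_k` (`exists_equiv`). The latter holds since any vector killed by all `X_k` is a multiple of
the highest weight vector (`eq_zero_of_opX_eq_zero`) and `Y_k` is the transpose of `X_k`.

*Solitary and edge-minimal.* For two bases supported by the lattice, the quotients of their labels are
multiplicative around diamonds, since the edge products agree. They are thus a coboundary
(`exists_potential`), and after rescaling Schur's lemma identifies the bases (`isSolitary`). A subgraph
supporting a basis has all vertices, by dimension. Its own vertex weights agree with those of the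
lattice: the differences are constant by Schur's lemma, and both have sum zero because commutators have
trace zero. So its labels, continued by zero, solve the relations of the lattice, and uniqueness shows
that no edge is missing (`isEdgeMinimal`).
-/

/-! ### Tableaux as Gelfand–Tsetlin patterns -/

namespace GelfandTsetlin

namespace Tableau

variable {r : ℕ} {μ : YoungDiagram}

/-- `cnt S k p` is the number of entries smaller than `k` in row `p` of `S`. For `1 ≤ k ≤ r + 1` and
`p < k` these numbers form the Gelfand–Tsetlin pattern of `S`; the pattern is continued to all
`k` and `p`, so that all its rows can be treated alike. -/
def cnt (S : Tableau r μ) (k p : ℕ) : ℕ := ((Finset.range (μ.rowLen p)).filter (S p · < k)).card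

theorem lt_cnt_iff (S : Tableau r μ) {k p j : ℕ} :
    j < S.cnt k p ↔ j < μ.rowLen p ∧ S p j < k := by
  have hs : (Finset.range (μ.rowLen p)).filter (S p · < k) = Finset.range (S.cnt k p) := by
    refine Finset.eq_of_subset_of_card_le (fun j hj => ?_) (by simp [cnt])
    have h : Finset.range (j + 1) ⊆ (Finset.range (μ.rowLen p)).filter (S p · < k) := by
      intro i hi
      simp only [Finset.mem_filter, Finset.mem_range] at hi hj ⊢
      refine ⟨by omega, lt_of_le_of_lt ?_ hj.2⟩
      exact S.1.row_weak_of_le (by omega) (YoungDiagram.mem_iff_lt_rowLen.2 hj.1)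
    have := Finset.card_le_card h
    simp only [Finset.card_range] at this
    simpa [cnt] using this
  have := Finset.ext_iff.1 hs j
  simpa using this.symm

theorem cnt_le_rowLen (S : Tableau r μ) (k p : ℕ) : S.cnt k p ≤ μ.rowLen p := by
  by_contra h
  have := (S.lt_cnt_iff (k := k) (p := p)).1 (not_le.1 h)
  omega

theorem cnt_zero (S : Tableau r μ) (p : ℕ) : S.cnt 0 p = 0 := by
  simp [cnt]

theorem cnt_eq_rowLen (S : Tableau r μ) {k : ℕ} (hk : r + 1 ≤ k) (p : ℕ) :
    S.cnt k p = μ.rowLen p := by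
  refine le_antisymm (S.cnt_le_rowLen k p) ?_
  by_contra h
  exact lt_irrefl _ (S.lt_cnt_iff.2 ⟨not_le.1 h, lt_of_le_of_lt (S.2 _ _) hk⟩)

theorem cnt_le_succ (S : Tableau r μ) (k p : ℕ) : S.cnt k p ≤ S.cnt (k + 1) p := by
  by_contra h
  have h1 := S.lt_cnt_iff.1 (not_le.1 h)
  have := S.lt_cnt_iff.2 ⟨h1.1, Nat.lt_succ_of_lt h1.2⟩
  exact lt_irrefl _ this

theorem cnt_mono (S : Tableau r μ) (p : ℕ) : Monotone (S.cnt · p) :=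
  monotone_nat_of_le_succ fun k => S.cnt_le_succ k p

theorem cnt_succ_succ_le (S : Tableau r μ) (k p : ℕ) : S.cnt (k + 1) (p + 1) ≤ S.cnt k p := by
  by_contra h
  have h1 := S.lt_cnt_iff.1 (not_le.1 h)
  have h2 := S.1.col_strict (show p < p + 1 by omega) (YoungDiagram.mem_iff_lt_rowLen.2 h1.1)
  have h3 := μ.rowLen_anti p (p + 1) p.le_succ
  refine lt_irrefl (S.cnt k p) (S.lt_cnt_iff.2 ⟨lt_of_lt_of_le h1.1 h3, ?_⟩)
  have := h1.2
  omega

theorem cnt_antitone (S : Tableau r μ) (k : ℕ) : Antitone (S.cnt k) :=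
  antitone_nat_of_succ_le fun p => (S.cnt_le_succ k (p + 1)).trans (S.cnt_succ_succ_le k p)

theorem cnt_eq_zero (S : Tableau r μ) {k p : ℕ} (h : k ≤ p) : S.cnt k p = 0 := by
  induction k generalizing p with
  | zero => exact S.cnt_zero p
  | succ k ih =>
    obtain ⟨p, rfl⟩ : ∃ q, p = q + 1 := ⟨p - 1, by omega⟩
    have := S.cnt_succ_succ_le k p
    have := ih (p := p) (by omega)
    omega

theorem entry_lt_iff (S : Tableau r μ) {k p j : ℕ} (hj : j < μ.rowLen p) :
    S p j < k ↔ j < S.cnt k p := by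
  simp [S.lt_cnt_iff, hj]

theorem ext_cnt {S T : Tableau r μ} (h : ∀ k p, S.cnt k p = T.cnt k p) : S = T := by
  apply ext'
  intro p j
  by_cases hj : j < μ.rowLen p
  · apply le_antisymm
    · rw [← Nat.lt_succ_iff, S.entry_lt_iff hj, h, ← T.entry_lt_iff hj]
      exact Nat.lt_succ_self _
    · rw [← Nat.lt_succ_iff, T.entry_lt_iff hj, ← h, ← S.entry_lt_iff hj]
      exact Nat.lt_succ_self _
  · have hx : (p, j) ∉ μ := by rwa [YoungDiagram.mem_iff_lt_rowLen]
    exact (S.1.zeros hx).trans (T.1.zeros hx).symm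

/-- Decrementing a `k + 1` in row `p` adds one to the entry `(k + 1, p)` of the pattern. -/
theorem decrement_iff {k p : ℕ} {S R : Tableau r μ} :
    Decrement k p S R ↔
      ∀ l q, R.cnt l q = S.cnt l q + if l = k + 1 ∧ q = p then 1 else 0 := by
  constructor
  · rintro ⟨j, hm, hS, hR, h⟩ l q
    rw [YoungDiagram.mem_iff_lt_rowLen] at hm
    by_cases hq : q = p
    · subst hq
      have key : ∀ j', j' ≠ j → (j' < R.cnt l q ↔ j' < S.cnt l q) := fun j' hj' => by
        rw [R.lt_cnt_iff, S.lt_cnt_iff, h q j' (by simpa using hj')]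
      have hjS : j < S.cnt l q ↔ k + 1 < l := by rw [S.lt_cnt_iff, hS]; simp [hm]
      have hjR : j < R.cnt l q ↔ k < l := by rw [R.lt_cnt_iff, hR]; simp [hm]
      have k1 := key (S.cnt l q)
      have k2 := key (R.cnt l q)
      have k3 := key (j + 1) (by omega)
      split_ifs with hl <;> omega
    · have : ∀ j, j < R.cnt l q ↔ j < S.cnt l q := fun j' => by
        rw [R.lt_cnt_iff, S.lt_cnt_iff, h q j' (by simp [hq])]
      have h1 := this (S.cnt l q)
      have h2 := this (R.cnt l q)
      simp only [hq, and_false, if_false]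
      omega
  · intro h
    have h0 : R.cnt (k + 1) p = S.cnt (k + 1) p + 1 := by simpa using h (k + 1) p
    have h1 : R.cnt k p = S.cnt k p := by simpa using h k p
    have h2 : R.cnt (k + 2) p = S.cnt (k + 2) p := by simpa using h (k + 2) p
    have hj : S.cnt (k + 1) p < μ.rowLen p := by
      have := R.cnt_le_rowLen (k + 1) p
      omega
    have e1 := R.entry_lt_iff (k := k + 1) hj
    have e2 := S.entry_lt_iff (k := k + 1) hj
    have e3 := R.entry_lt_iff (k := k) hj
    have e4 := S.entry_lt_iff (k := k) hj
    have e5 := R.entry_lt_iff (k := k + 2) hj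
    have e6 := S.entry_lt_iff (k := k + 2) hj
    have m1 := S.cnt_le_succ k p
    have m2 := R.cnt_le_succ (k + 1) p
    refine ⟨S.cnt (k + 1) p, YoungDiagram.mem_iff_lt_rowLen.2 hj, by omega, by omega, ?_⟩
    intro x y hxy
    by_cases hy : y < μ.rowLen x
    · have key : ∀ l, R x y < l ↔ S x y < l := by
        intro l
        rw [R.entry_lt_iff hy, S.entry_lt_iff hy, h l x]
        split_ifs with hl
        · obtain ⟨rfl, rfl⟩ := hl
          have : y ≠ S.cnt (k + 1) x := fun hh => hxy (by rw [hh])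
          omega
        · rfl
      have h1 := key (R x y)
      have h2 := key (S x y)
      omega
    · have hx : (x, y) ∉ μ := by rwa [YoungDiagram.mem_iff_lt_rowLen]
      exact (R.1.zeros hx).trans (S.1.zeros hx).symm

/-- Every interlacing pattern with the prescribed first and last levels is the pattern of a
tableau. -/
theorem exists_cnt_eq (x : ℕ → ℕ → ℕ) (h0 : ∀ p, x 0 p = 0)
    (htop : ∀ k p, r + 1 ≤ k → x k p = μ.rowLen p) (hmono : ∀ k p, x k p ≤ x (k + 1) p)
    (hinter : ∀ k p, x (k + 1) (p + 1) ≤ x k p) :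
    ∃ S : Tableau r μ, ∀ k p, S.cnt k p = x k p := by
  classical
  let E : ℕ → ℕ → ℕ := fun p j =>
    if j < μ.rowLen p then ((Finset.range (r + 1)).filter (fun l => x (l + 1) p ≤ j)).card else 0
  have hm : ∀ p, Monotone (x · p) := fun p => monotone_nat_of_le_succ fun k => hmono k p
  have hE : ∀ {p j k}, j < μ.rowLen p → (E p j < k ↔ j < x k p) := by
    intro p j k hj
    have hset : (Finset.range (r + 1)).filter (fun l => x (l + 1) p ≤ j) = Finset.range (E p j) := by
      refine Finset.eq_of_subset_of_card_le (fun l hl => ?_) (by simp [E, hj])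
      have h : Finset.range (l + 1) ⊆ (Finset.range (r + 1)).filter (fun l => x (l + 1) p ≤ j) := by
        intro i hi
        simp only [Finset.mem_filter, Finset.mem_range] at hi hl ⊢
        exact ⟨by omega, (hm p (show i + 1 ≤ l + 1 by omega)).trans hl.2⟩
      have := Finset.card_le_card h
      simp only [Finset.card_range] at this
      simpa [E, hj] using this
    have key : ∀ l, l < E p j ↔ l < r + 1 ∧ x (l + 1) p ≤ j := fun l => by
      have := Finset.ext_iff.1 hset l
      simpa using this.symm
    rcases k with _ | k
    · simp [h0]
    · rw [Nat.lt_succ_iff, ← not_lt, key]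
      by_cases hk : k < r + 1
      · simp [hk]
      · simp only [hk, false_and, not_false_iff, true_iff]
        rw [htop _ _ (by omega)]
        exact hj
  obtain ⟨S, hS⟩ : ∃ S : Tableau r μ, ∀ p j, S p j = E p j := by
    refine ⟨⟨⟨E, ?_, ?_, ?_⟩, ?_⟩, fun _ _ => rfl⟩
    · intro p j1 j2 hj hc
      rw [YoungDiagram.mem_iff_lt_rowLen] at hc
      rw [← Nat.lt_succ_iff, hE (hj.trans hc)]
      exact hj.trans ((hE hc).1 (Nat.lt_succ_self _))
    · have step : ∀ p j, (p + 1, j) ∈ μ → E p j < E (p + 1) j := by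
        intro p j hc
        rw [YoungDiagram.mem_iff_lt_rowLen] at hc
        have := μ.rowLen_anti p (p + 1) p.le_succ
        rw [hE (by omega)]
        exact lt_of_lt_of_le ((hE hc).1 (Nat.lt_succ_self _)) (hinter _ _)
      intro p1 p2 j hp hc
      induction p2, hp using Nat.le_induction with
      | base => exact step _ _ hc
      | succ p2 hp ih => exact (ih (μ.up_left_mem p2.le_succ le_rfl hc)).trans (step _ _ hc)
    · intro p j hc
      rw [YoungDiagram.mem_iff_lt_rowLen] at hc
      simp [E, hc]
    · intro p j
      change E p j ≤ r
      by_cases hj : j < μ.rowLen p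
      · rw [← Nat.lt_succ_iff, hE hj, htop _ _ le_rfl]
        exact hj
      · simp [E, hj]
  refine ⟨S, ?_⟩
  intro k p
  have key : ∀ j, j < S.cnt k p ↔ j < x k p := by
    intro j
    rw [S.lt_cnt_iff, hS]
    refine ⟨fun h => (hE h.1).1 h.2, fun h => ?_⟩
    have hj : j < μ.rowLen p := by
      rcases le_total k (r + 1) with hk | hk
      · rw [← htop (r + 1) p le_rfl]
        exact lt_of_lt_of_le h (hm p hk)
      · rwa [← htop k p hk]
    exact ⟨hj, (hE hj).2 h⟩
  exact le_antisymm (not_lt.1 fun h => lt_irrefl _ ((key _).1 h))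
    (not_lt.1 fun h => lt_irrefl _ ((key _).2 h))

/-- The entry at level `k + 1` in row `p` of the pattern of `S` can be raised by one. -/
def Raisable (S : Tableau r μ) (k p : ℕ) : Prop :=
  S.cnt (k + 1) p < S.cnt (k + 2) p ∧ ∀ q, p = q + 1 → S.cnt (k + 1) p < S.cnt k q

/-- The entry at level `k + 1` in row `p` of the pattern of `S` can be lowered by one. -/
def Lowerable (S : Tableau r μ) (k p : ℕ) : Prop :=
  S.cnt k p < S.cnt (k + 1) p ∧ S.cnt (k + 2) (p + 1) < S.cnt (k + 1) p

theorem exists_decrement_iff {k p : ℕ} {S : Tableau r μ} (hk : k < r) :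
    (∃ R, Decrement k p S R) ↔ S.Raisable k p := by
  constructor
  · rintro ⟨R, h⟩
    rw [decrement_iff] at h
    have h0 := h (k + 1) p
    have h2 := h (k + 2) p
    have m2 : R.cnt (k + 1) p ≤ R.cnt (k + 2) p := R.cnt_le_succ (k + 1) p
    simp at h0 h2
    refine ⟨by omega, ?_⟩
    rintro q rfl
    have h1 := h k q
    simp at h1
    have := R.cnt_succ_succ_le k q
    omega
  · rintro ⟨h1, h2⟩
    have hS1 := S.cnt_le_succ
    have hS2 := S.cnt_succ_succ_le
    obtain ⟨R, hR⟩ := exists_cnt_eq (r := r) (μ := μ)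
      (fun l q => S.cnt l q + if l = k + 1 ∧ q = p then 1 else 0)
      (fun q => by simp [S.cnt_zero])
      (fun l q hl => by simp [S.cnt_eq_rowLen hl, show l ≠ k + 1 by omega])
      (fun l q => by
        have := hS1 l q
        by_cases hc : l = k + 1 ∧ q = p
        · obtain ⟨rfl, rfl⟩ := hc
          simpa using h1
        · simp only [hc, if_false]
          split_ifs <;> omega)
      (fun l q => by
        have := hS2 l q
        by_cases hc : l + 1 = k + 1 ∧ q + 1 = p
        · have := h2 q hc.2.symm
          obtain ⟨h, rfl⟩ := hc
          obtain rfl : l = k := by omega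
          simpa using this
        · simp only [hc, if_false]
          split_ifs <;> omega)
    exact ⟨R, decrement_iff.2 hR⟩

theorem exists_increment_iff {k p : ℕ} {S : Tableau r μ} (hk : k < r) :
    (∃ U, Decrement k p U S) ↔ S.Lowerable k p := by
  constructor
  · rintro ⟨R, h⟩
    rw [decrement_iff] at h
    have h0 := h (k + 1) p
    have h1 := h k p
    have h2 := h (k + 2) (p + 1)
    have m1 := R.cnt_le_succ k p
    have m2 : R.cnt (k + 2) (p + 1) ≤ R.cnt (k + 1) p := R.cnt_succ_succ_le (k + 1) p
    simp at h0 h1 h2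
    exact ⟨by omega, by omega⟩
  · rintro ⟨h1, h2⟩
    have hS1 := S.cnt_le_succ
    have hS2 := S.cnt_succ_succ_le
    obtain ⟨R, hR⟩ := exists_cnt_eq (r := r) (μ := μ)
      (fun l q => S.cnt l q - if l = k + 1 ∧ q = p then 1 else 0)
      (fun q => by simp [S.cnt_zero])
      (fun l q hl => by simp [S.cnt_eq_rowLen hl, show l ≠ k + 1 by omega])
      (fun l q => by
        have := hS1 l q
        by_cases hc : l + 1 = k + 1 ∧ q = p
        · obtain ⟨h, rfl⟩ := hc
          obtain rfl : l = k := by omega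
          simp
          omega
        · simp only [hc, if_false]
          split_ifs <;> omega)
      (fun l q => by
        have := hS2 l q
        by_cases hc : l = k + 1 ∧ q = p
        · obtain ⟨rfl, rfl⟩ := hc
          have h3 : S.cnt (k + 1 + 1) (q + 1) < S.cnt (k + 1) q := h2
          rw [if_neg (by omega), if_pos ⟨rfl, rfl⟩]
          omega
        · simp only [hc, if_false]
          split_ifs <;> omega)
    refine ⟨R, decrement_iff.2 fun l q => ?_⟩
    rw [hR]
    split_ifs with hc
    · obtain ⟨rfl, rfl⟩ := hc
      omega
    · omega

theorem Decrement.lt {k p : ℕ} {S R : Tableau r μ} (h : Decrement k p S R) : k < r := by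
  obtain ⟨j, -, hS, -⟩ := h
  have := S.2 p j
  omega

theorem Decrement.row_le {k p : ℕ} {S R : Tableau r μ} (h : Decrement k p S R) : p ≤ k := by
  by_contra hp
  have h1 := decrement_iff.1 h (k + 1) p
  simp [R.cnt_eq_zero (show k + 1 ≤ p by omega)] at h1

theorem Decrement.right_unique {k p : ℕ} {S R R' : Tableau r μ} (h : Decrement k p S R)
    (h' : Decrement k p S R') : R = R' :=
  ext_cnt fun l q => by rw [decrement_iff.1 h, decrement_iff.1 h']

theorem Decrement.left_unique {k p : ℕ} {S S' R : Tableau r μ} (h : Decrement k p S R)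
    (h' : Decrement k p S' R) : S = S' :=
  ext_cnt fun l q => by
    have h1 := decrement_iff.1 h l q
    have h2 := decrement_iff.1 h' l q
    omega

theorem Decrement.label_unique {k p k' p' : ℕ} {S R : Tableau r μ} (h : Decrement k p S R)
    (h' : Decrement k' p' S R) : k = k' ∧ p = p' := by
  have h1 := decrement_iff.1 h (k + 1) p
  have h2 := decrement_iff.1 h' (k + 1) p
  by_contra hc
  rw [if_pos ⟨rfl, rfl⟩] at h1
  rw [if_neg (by omega)] at h2
  omega

/-- Two different edges starting at the same vertex complete to a diamond. -/
theorem exists_diamond_below {i p j q : ℕ} {A S T : Tableau r μ} (hS : Decrement i p A S)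
    (hT : Decrement j q A T) (hne : S ≠ T) :
    ∃ U, Decrement j q S U ∧ Decrement i p T U := by
  have hi := hS.lt
  have hj := hT.lt
  have hne' : ¬ (i = j ∧ p = q) := by
    rintro ⟨rfl, rfl⟩
    exact hne (hS.right_unique hT)
  have hS' := decrement_iff.1 hS
  have hT' := decrement_iff.1 hT
  obtain ⟨U, hU⟩ := exists_cnt_eq (r := r) (μ := μ) (fun l q => max (S.cnt l q) (T.cnt l q))
    (fun q => by simp [cnt_zero])
    (fun l q hl => by simp [cnt_eq_rowLen _ hl])
    (fun l q => max_le_max (S.cnt_le_succ l q) (T.cnt_le_succ l q))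
    (fun l q => max_le_max (S.cnt_succ_succ_le l q) (T.cnt_succ_succ_le l q))
  refine ⟨U, decrement_iff.2 fun l s => ?_, decrement_iff.2 fun l s => ?_⟩
  all_goals
    have h1 := hS' l s
    have h2 := hT' l s
    rw [hU]
    split_ifs at h1 h2 ⊢ <;> omega

/-- Two different edges ending at the same vertex complete to a diamond. -/
theorem exists_diamond_above {i p j q : ℕ} {U S T : Tableau r μ} (hS : Decrement j q S U)
    (hT : Decrement i p T U) (hne : S ≠ T) :
    ∃ A, Decrement i p A S ∧ Decrement j q A T := by
  have hne' : ¬ (i = j ∧ p = q) := by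
    rintro ⟨rfl, rfl⟩
    exact hne (hS.left_unique hT)
  have hS' := decrement_iff.1 hS
  have hT' := decrement_iff.1 hT
  obtain ⟨A, hA⟩ := exists_cnt_eq (r := r) (μ := μ) (fun l q => min (S.cnt l q) (T.cnt l q))
    (fun q => by simp [cnt_zero])
    (fun l q hl => by simp [cnt_eq_rowLen _ hl])
    (fun l q => min_le_min (S.cnt_le_succ l q) (T.cnt_le_succ l q))
    (fun l q => min_le_min (S.cnt_succ_succ_le l q) (T.cnt_succ_succ_le l q))
  refine ⟨A, decrement_iff.2 fun l s => ?_, decrement_iff.2 fun l s => ?_⟩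
  all_goals
    have h1 := hS' l s
    have h2 := hT' l s
    rw [hA]
    split_ifs at h1 h2 ⊢ <;> omega

/-- In a diamond, the two edges leading down from `S` and `T` sit in the positions of the two edges
leading up to them. -/
theorem diamond_labels {i j p q p' q' : ℕ} {S T U A : Tableau r μ} (hne : S ≠ T)
    (h1 : Decrement j q S U) (h2 : Decrement i p T U) (h3 : Decrement i p' A S)
    (h4 : Decrement j q' A T) : p = p' ∧ q = q' := by
  have hpq : ¬ (i = j ∧ p = q) := by
    rintro ⟨rfl, rfl⟩
    exact hne (h1.left_unique h2)
  have e : ∀ l s, (if l = i + 1 ∧ s = p then 1 else 0) + (if l = j + 1 ∧ s = q' then 1 else 0) =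
      (if l = j + 1 ∧ s = q then 1 else 0) + (if l = i + 1 ∧ s = p' then 1 else 0) := by
    intro l s
    have e1 := decrement_iff.1 h1 l s
    have e2 := decrement_iff.1 h2 l s
    have e3 := decrement_iff.1 h3 l s
    have e4 := decrement_iff.1 h4 l s
    omega
  have f1 := e (i + 1) p
  have f2 := e (j + 1) q
  simp only [true_and, if_true, Nat.add_right_cancel_iff] at f1 f2
  constructor
  · by_contra hc
    rw [if_neg hc] at f1
    split_ifs at f1 with h <;> omega
  · by_contra hc
    rw [if_neg hc] at f2
    split_ifs at f2 with h <;> omega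

end Tableau

end GelfandTsetlin

/-! ### A residue identity -/

namespace GelfandTsetlin

open Polynomial in
/-- The sum of the residues of `∏ (z - c) / ∏ (z - a)`, for a numerator and a denominator of the same
degree and distinct poles `a`, is the coefficient of `1 / z` at infinity. -/
theorem sum_residue_simple (Z : Finset ℚ) (N : Multiset ℚ) (hcard : Multiset.card N = Z.card) :
    ∑ z ∈ Z, (N.map (z - ·)).prod / ∏ w ∈ Z.erase z, (z - w) = ∑ z ∈ Z, z - N.sum := by
  rcases Nat.eq_zero_or_pos Z.card with h0 | hpos
  · have hN := hcard.trans h0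
    rw [Multiset.card_eq_zero] at hN
    rw [Finset.card_eq_zero] at h0
    simp [h0, hN]
  set F : ℚ[X] := (N.map (Polynomial.X - C ·)).prod with hF
  have hFm : F.Monic := monic_multisetProd_X_sub_C N
  have hFd : F.degree = Z.card := by
    rw [degree_eq_natDegree hFm.ne_zero, natDegree_multiset_prod_X_sub_C_eq_card, hcard]
  have hlt : (F - Lagrange.nodal Z id).degree < Z.card := by
    rw [← hFd]
    refine degree_sub_lt_left ?_ hFm.ne_zero ?_
    · rw [hFd, Lagrange.degree_nodal]
    · rw [hFm.leadingCoeff, (Lagrange.nodal_monic (s := Z) (v := id)).leadingCoeff]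
  have key := Lagrange.coeff_eq_sum (s := Z) (v := id) Function.injective_id.injOn hlt
  have c1 : F.coeff (Z.card - 1) = -N.sum := by
    rw [← hcard]
    exact multiset_prod_X_sub_C_coeff_card_pred N (by omega)
  have c2 : (Lagrange.nodal Z id : ℚ[X]).coeff (Z.card - 1) = -∑ z ∈ Z, z := by
    rw [Lagrange.nodal_eq]
    exact prod_X_sub_C_coeff_card_pred Z id hpos
  rw [coeff_sub, c1, c2] at key
  rw [show ∑ z ∈ Z, z - N.sum = -N.sum - -∑ z ∈ Z, z by ring, key]
  refine Finset.sum_congr rfl fun z hz => ?_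
  have h1 : eval z (Lagrange.nodal Z id) = 0 := Lagrange.eval_nodal_at_node (v := id) hz
  have h2 : eval z F = (N.map (z - ·)).prod := by
    rw [hF, eval_multiset_prod, Multiset.map_map]
    simp
  simp only [id, eval_sub, h1, h2, sub_zero]

/-- The residue at a pole outside `I` does not change when the factors at the points of `I` are
cancelled from numerator and denominator. -/
theorem residue_cancel {A B C D : Finset ℚ} (hC : A ∩ B ⊆ C) (hD : A ∩ B ⊆ D) {a : ℚ}
    (ha : a ∈ A \ B) :
    (∏ c ∈ C, (a - c)) * (∏ d ∈ D, (a - d)) / ((∏ w ∈ A.erase a, (a - w)) * ∏ w ∈ B, (a - w)) =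
      (((C \ (A ∩ B)).val + (D \ (A ∩ B)).val).map (a - ·)).prod /
        ∏ w ∈ ((A \ B) ∪ (B \ A)).erase a, (a - w) := by
  rw [Finset.mem_sdiff] at ha
  have hI : ∏ w ∈ A ∩ B, (a - w) ≠ 0 := by
    refine Finset.prod_ne_zero_iff.2 fun w hw => sub_ne_zero.2 ?_
    rintro rfl
    exact ha.2 (Finset.mem_inter.1 hw).2
  have h1 : ∏ w ∈ A.erase a, (a - w) = (∏ w ∈ (A \ B).erase a, (a - w)) * ∏ w ∈ A ∩ B, (a - w) := by
    rw [← Finset.prod_union]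
    · refine Finset.prod_congr ?_ fun _ _ => rfl
      ext w
      simp only [Finset.mem_erase, Finset.mem_union, Finset.mem_sdiff, Finset.mem_inter]
      have : w ∈ B → w ≠ a := fun h h' => ha.2 (h' ▸ h)
      tauto
    · rw [Finset.disjoint_left]
      intro w hw
      simp only [Finset.mem_erase, Finset.mem_sdiff, Finset.mem_inter] at hw ⊢
      tauto
  have h2 : ∏ w ∈ B, (a - w) = (∏ w ∈ B \ A, (a - w)) * ∏ w ∈ A ∩ B, (a - w) := by
    rw [Finset.inter_comm, ← Finset.prod_union]
    · exact Finset.prod_congr (by rw [Finset.sdiff_union_inter]) fun _ _ => rfl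
    · exact Finset.disjoint_sdiff_inter _ _
  have h3 : ∏ w ∈ ((A \ B) ∪ (B \ A)).erase a, (a - w) =
      (∏ w ∈ (A \ B).erase a, (a - w)) * ∏ w ∈ B \ A, (a - w) := by
    rw [← Finset.prod_union]
    · refine Finset.prod_congr ?_ fun _ _ => rfl
      ext w
      simp only [Finset.mem_erase, Finset.mem_union, Finset.mem_sdiff]
      have : w ∈ B → w ≠ a := fun h h' => ha.2 (h' ▸ h)
      tauto
    · rw [Finset.disjoint_left]
      intro w hw
      simp only [Finset.mem_erase, Finset.mem_sdiff] at hw ⊢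
      tauto
  have h4 : (((C \ (A ∩ B)).val + (D \ (A ∩ B)).val).map (a - ·)).prod =
      (∏ c ∈ C \ (A ∩ B), (a - c)) * ∏ d ∈ D \ (A ∩ B), (a - d) := by
    rw [Multiset.map_add, Multiset.prod_add]
    rfl
  rw [h1, h2, h3, h4, ← Finset.prod_sdiff hC, ← Finset.prod_sdiff hD]
  rw [show ∀ x y i z w : ℚ, (x * i) * (y * i) / (z * i * (w * i)) = (x * y * (i * i)) /
    (z * w * (i * i)) from fun x y i z w => by ring_nf]
  rw [mul_div_mul_right _ _ (mul_ne_zero hI hI)]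

/-- The sum of the residues of `∏ (z - c) ∏ (z - d) / (∏ (z - a) ∏ (z - b))`, when every possible
double pole is cancelled by a double zero. -/
theorem sum_residue (A B C D : Finset ℚ) (hcard : C.card + D.card = A.card + B.card)
    (hC : A ∩ B ⊆ C) (hD : A ∩ B ⊆ D) :
    ∑ a ∈ A \ B, (∏ c ∈ C, (a - c)) * (∏ d ∈ D, (a - d)) /
        ((∏ w ∈ A.erase a, (a - w)) * ∏ w ∈ B, (a - w)) +
      ∑ b ∈ B \ A, (∏ c ∈ C, (b - c)) * (∏ d ∈ D, (b - d)) /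
        ((∏ w ∈ B.erase b, (b - w)) * ∏ w ∈ A, (b - w)) =
      ∑ a ∈ A, a + ∑ b ∈ B, b - ∑ c ∈ C, c - ∑ d ∈ D, d := by
  have hdisj : Disjoint (A \ B) (B \ A) := disjoint_sdiff_sdiff
  have e1 := fun a (ha : a ∈ A \ B) => residue_cancel hC hD ha
  have e2 : ∀ b ∈ B \ A, (∏ c ∈ C, (b - c)) * (∏ d ∈ D, (b - d)) /
        ((∏ w ∈ B.erase b, (b - w)) * ∏ w ∈ A, (b - w)) =
      (((C \ (A ∩ B)).val + (D \ (A ∩ B)).val).map (b - ·)).prod /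
        ∏ w ∈ ((A \ B) ∪ (B \ A)).erase b, (b - w) := by
    intro b hb
    have := residue_cancel (A := B) (B := A) (Finset.inter_comm A B ▸ hC)
      (Finset.inter_comm A B ▸ hD) hb
    rw [this, Finset.inter_comm, Finset.union_comm]
  rw [Finset.sum_congr rfl e1, Finset.sum_congr rfl e2, ← Finset.sum_union hdisj,
    sum_residue_simple]
  · rw [Finset.sum_union hdisj, Multiset.sum_add]
    have f1 : ∀ {E : Finset ℚ}, A ∩ B ⊆ E →
        (E \ (A ∩ B)).val.sum = ∑ c ∈ E, c - ∑ c ∈ A ∩ B, c := by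
      intro E hE
      rw [← Finset.sum_sdiff hE, add_sub_cancel_right, Finset.sum, Multiset.map_id']
    have f2 : ∑ a ∈ A \ B, a = ∑ a ∈ A, a - ∑ c ∈ A ∩ B, c := by
      rw [← Finset.sum_sdiff (Finset.inter_subset_left : A ∩ B ⊆ A), Finset.sdiff_inter_self_left,
        add_sub_cancel_right]
    have f3 : ∑ a ∈ B \ A, a = ∑ a ∈ B, a - ∑ c ∈ A ∩ B, c := by
      rw [← Finset.sum_sdiff (Finset.inter_subset_right : A ∩ B ⊆ B),
        Finset.sdiff_inter_self_right, add_sub_cancel_right]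
    rw [f1 hC, f1 hD, f2, f3]
    ring
  · rw [Multiset.card_add, Finset.card_val, Finset.card_val, Finset.card_union_of_disjoint hdisj,
      Finset.card_sdiff_of_subset hC, Finset.card_sdiff_of_subset hD]
    have g1 := Finset.card_sdiff_add_card_inter A B
    have g2 := Finset.card_sdiff_add_card_inter B A
    rw [Finset.inter_comm] at g2
    have g3 := Finset.card_le_card hC
    have g4 := Finset.card_le_card hD
    omega

end GelfandTsetlin

/-! ### The Gelfand–Tsetlin edge products -/

namespace GelfandTsetlin

namespace Tableau

variable {r : ℕ} {μ : YoungDiagram}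

/-- The shifted entry of the pattern of `S` at level `k` in row `p`. The shifted entries of a level are
strictly decreasing in `p`. -/
def node (S : Tableau r μ) (k p : ℕ) : ℚ := S.cnt k p - p

/-- The Gelfand–Tsetlin expression for the edge products of color `k` in row `p`, as a function of the
shifted entry `z` of the pattern that the edge raises. All levels of the pattern are taken with
`r + 1` rows; the factors of the rows added in this way cancel. -/
noncomputable def residue (S : Tableau r μ) (k p : ℕ) (z : ℚ) : ℚ :=
  -((∏ q ∈ Finset.range (r + 1), (z - S.node (k + 2) q)) *
      ∏ q ∈ Finset.range (r + 1), (z - S.node k q + 1)) /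
    ∏ q ∈ (Finset.range (r + 1)).erase p, ((z - S.node (k + 1) q) * (z - S.node (k + 1) q + 1))

/-- The Gelfand–Tsetlin edge product of the edge of color `k` from `S` in row `p`. -/
noncomputable def edgeProduct (S : Tableau r μ) (k p : ℕ) : ℚ := S.residue k p (S.node (k + 1) p)

theorem node_strictAnti (S : Tableau r μ) (k : ℕ) : StrictAnti (S.node k) := by
  intro p q h
  have h1 : (S.cnt k q : ℚ) ≤ S.cnt k p := by exact_mod_cast S.cnt_antitone k h.le
  have h2 : (p : ℚ) < q := by exact_mod_cast h
  simp only [node]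
  linarith

theorem Raisable.cnt_lt {S : Tableau r μ} {k p q : ℕ} (h : S.Raisable k p) (hq : q < p) :
    S.cnt (k + 1) p < S.cnt k q ∧ S.cnt (k + 1) p < S.cnt (k + 1) q ∧
      S.cnt (k + 1) p < S.cnt (k + 2) q := by
  obtain ⟨t, rfl⟩ : ∃ t, p = t + 1 := ⟨p - 1, by omega⟩
  have h1 := h.2 t rfl
  have h2 := S.cnt_antitone k (show q ≤ t by omega)
  have h3 := S.cnt_le_succ k q
  have h4 : S.cnt (k + 1) q ≤ S.cnt (k + 2) q := S.cnt_le_succ (k + 1) q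
  omega

theorem edgeProduct_pos {S : Tableau r μ} {k p : ℕ} (h : S.Raisable k p) (hp : p < r + 1) :
    0 < S.edgeProduct k p := by
  have hlt : ∀ {a b c d : ℕ}, a + d < b + c → ((a : ℚ) - c) - (b - d) < 0 := by
    intro a b c d hh
    have : (a : ℚ) + d < b + c := by exact_mod_cast hh
    linarith
  have hle : ∀ {a b c d : ℕ}, a + d + 2 ≤ b + c → ((a : ℚ) - c) - (b - d) + 1 < 0 := by
    intro a b c d hh
    have : (a : ℚ) + d + 2 ≤ b + c := by exact_mod_cast hh
    linarith
  have hgt : ∀ {a b c d : ℕ}, b + c < a + d → 0 < ((a : ℚ) - c) - (b - d) := by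
    intro a b c d hh
    have : (b : ℚ) + c < a + d := by exact_mod_cast hh
    linarith
  have hp' : p ∈ Finset.range (r + 1) := Finset.mem_range.2 hp
  have below : ∀ q, p < q → S.cnt (k + 2) q ≤ S.cnt (k + 1) p ∧ S.cnt (k + 1) q ≤ S.cnt (k + 1) p ∧
      S.cnt k q ≤ S.cnt (k + 1) p := fun q hq => by
    have h1 : S.cnt (k + 2) (p + 1) ≤ S.cnt (k + 1) p := S.cnt_succ_succ_le (k + 1) p
    have h2 := S.cnt_antitone (k + 2) (show p + 1 ≤ q from hq)
    have h3 := S.cnt_antitone (k + 1) hq.le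
    have h4 := S.cnt_le_succ k q
    omega
  rw [edgeProduct, residue, ← Finset.prod_mul_distrib, ← Finset.mul_prod_erase _ _ hp',
    ← neg_mul]
  have h1 := h.1
  have h2 := S.cnt_le_succ k p
  refine div_pos (mul_pos ?_ (Finset.prod_pos fun q hq => ?_)) (Finset.prod_pos fun q hq => ?_)
  · rw [neg_pos]
    refine mul_neg_of_neg_of_pos (hlt (by omega)) ?_
    have := hgt (a := S.cnt (k + 1) p + 1) (b := S.cnt k p) (c := p) (d := p) (by omega)
    push_cast at this
    simp only [node]
    linarith
  · rcases lt_or_gt_of_ne (Finset.ne_of_mem_erase hq) with hqp | hqp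
    · have := h.cnt_lt hqp
      exact mul_pos_of_neg_of_neg (hlt (by omega)) (hle (by omega))
    · have := below q hqp
      refine mul_pos (hgt (by omega)) ?_
      exact add_pos (hgt (by omega)) one_pos
  · rcases lt_or_gt_of_ne (Finset.ne_of_mem_erase hq) with hqp | hqp
    · have := h.cnt_lt hqp
      exact mul_pos_of_neg_of_neg (hlt (by omega)) (hle (by omega))
    · have := below q hqp
      refine mul_pos (hgt (by omega)) ?_
      exact add_pos (hgt (by omega)) one_pos

theorem edgeProduct_eq_zero {S : Tableau r μ} {k p : ℕ} (h : ¬ S.Raisable k p) (hp : p < r + 1) :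
    S.edgeProduct k p = 0 := by
  have h1 : S.cnt (k + 1) p ≤ S.cnt (k + 2) p := S.cnt_le_succ (k + 1) p
  rw [edgeProduct, residue]
  by_cases h2 : S.cnt (k + 1) p = S.cnt (k + 2) p
  · rw [Finset.prod_eq_zero (Finset.mem_range.2 hp)]
    · simp
    · simp [node, h2]
  · obtain ⟨q, rfl, hq⟩ : ∃ q, p = q + 1 ∧ S.cnt k q ≤ S.cnt (k + 1) p := by
      by_contra hc
      push Not at hc
      exact h ⟨by omega, hc⟩
    have h3 := S.cnt_succ_succ_le k q
    rw [Finset.prod_eq_zero (i := q) (f := fun q' => _ - S.node k q' + 1)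
      (Finset.mem_range.2 (by omega))]
    · simp
    · simp only [node, show S.cnt (k + 1) (q + 1) = S.cnt k q by omega]
      push_cast
      ring

theorem residue_eq_zero {S : Tableau r μ} {k p : ℕ} (h : ¬ S.Lowerable k p) (hp : p < r + 1)
    (hk : k < r) : S.residue k p (S.node (k + 1) p - 1) = 0 := by
  have h1 : S.cnt k p ≤ S.cnt (k + 1) p := S.cnt_le_succ k p
  rw [residue]
  by_cases h2 : S.cnt k p = S.cnt (k + 1) p
  · rw [Finset.prod_eq_zero (i := p) (f := fun q' => _ - S.node k q' + 1) (Finset.mem_range.2 hp)]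
    · simp
    · simp [node, h2]
  · have h3 : S.cnt (k + 2) (p + 1) ≤ S.cnt (k + 1) p := S.cnt_succ_succ_le (k + 1) p
    have h4 : S.cnt (k + 1) p ≤ S.cnt (k + 2) (p + 1) := by
      by_contra hc
      exact h ⟨by omega, by omega⟩
    have h5 : p + 1 < r + 1 := by
      by_contra hc
      have := S.cnt_eq_zero (k := k + 1) (p := p) (by omega)
      omega
    rw [Finset.prod_eq_zero (i := p + 1) (Finset.mem_range.2 h5)]
    · simp
    · simp only [node, show S.cnt (k + 2) (p + 1) = S.cnt (k + 1) p by omega]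
      push_cast
      ring

theorem node_of_decrement {k p : ℕ} {S R : Tableau r μ} (h : Decrement k p S R) (l q : ℕ) :
    R.node l q = S.node l q + if l = k + 1 ∧ q = p then 1 else 0 := by
  rw [node, node, decrement_iff.1 h l q]
  split_ifs <;> push_cast <;> ring

theorem node_of_ne {k p : ℕ} {S R : Tableau r μ} (h : Decrement k p S R) {l q : ℕ}
    (hne : ¬ (l = k + 1 ∧ q = p)) : R.node l q = S.node l q := by
  rw [node_of_decrement h, if_neg hne, add_zero]

theorem node_self {k p : ℕ} {S R : Tableau r μ} (h : Decrement k p S R) :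
    R.node (k + 1) p = S.node (k + 1) p + 1 := by
  rw [node_of_decrement h, if_pos ⟨rfl, rfl⟩]

theorem edgeProduct_of_decrement {k p : ℕ} {U S : Tableau r μ} (h : Decrement k p U S) :
    U.edgeProduct k p = S.residue k p (S.node (k + 1) p - 1) := by
  have h2 : ∀ q, S.node (k + 2) q = U.node (k + 2) q := fun q => node_of_ne h (by omega)
  have h0 : ∀ q, S.node k q = U.node k q := fun q => node_of_ne h (by omega)
  rw [edgeProduct, residue, residue, node_self h, add_sub_cancel_right]
  simp only [h0, h2]
  congr 1
  refine Finset.prod_congr rfl fun q hq => ?_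
  rw [node_of_ne h fun hc => Finset.ne_of_mem_erase hq hc.2]

/-- The crossing relation for the Gelfand–Tsetlin edge products, row by row. -/
theorem sum_residue_sub_sum_edgeProduct (S : Tableau r μ) {k : ℕ} (hk : k < r) :
    ∑ p ∈ Finset.range (r + 1), S.residue k p (S.node (k + 1) p - 1) -
      ∑ p ∈ Finset.range (r + 1), S.edgeProduct k p =
    2 * ∑ p ∈ Finset.range (r + 1), (S.cnt (k + 1) p : ℚ) -
      ∑ p ∈ Finset.range (r + 1), (S.cnt k p : ℚ) -
      ∑ p ∈ Finset.range (r + 1), (S.cnt (k + 2) p : ℚ) := by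
  classical
  set M := Finset.range (r + 1) with hM
  set a : ℕ → ℚ := S.node (k + 1) with ha
  have ia : Function.Injective a := (S.node_strictAnti (k + 1)).injective
  have ib : Function.Injective fun q => a q - 1 := fun x y h => ia (sub_left_injective h)
  have ic : Function.Injective (S.node (k + 2)) := (S.node_strictAnti (k + 2)).injective
  have id' : Function.Injective fun q => S.node k q - 1 := fun x y h =>
    (S.node_strictAnti k).injective (sub_left_injective h)
  set A := M.image a with hA
  set B := M.image fun q => a q - 1 with hB
  set C := M.image (S.node (k + 2)) with hC
  set D := M.image fun q => S.node k q - 1 with hD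
  -- a pole shared by `A` and `B` comes from two adjacent equal entries of the pattern
  have coll : ∀ p q, a p = a q - 1 → p = q + 1 ∧ S.cnt (k + 1) p = S.cnt (k + 1) q := by
    intro p q h
    have h1 : (S.cnt (k + 1) p : ℚ) + q + 1 = S.cnt (k + 1) q + p := by
      simp only [ha, node] at h
      linarith
    have h2 : S.cnt (k + 1) p + q + 1 = S.cnt (k + 1) q + p := by exact_mod_cast h1
    rcases lt_trichotomy p q with hpq | rfl | hpq
    · have := S.cnt_antitone (k + 1) hpq.le
      omega
    · omega
    · have := S.cnt_antitone (k + 1) hpq.le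
      omega
  have collM : ∀ w ∈ A ∩ B, ∃ q, q + 1 ∈ M ∧ w = a (q + 1) ∧
      S.cnt (k + 1) (q + 1) = S.cnt (k + 1) q := by
    intro w hw
    obtain ⟨h1, h2⟩ := Finset.mem_inter.1 hw
    obtain ⟨p, hp, rfl⟩ := Finset.mem_image.1 h1
    obtain ⟨q, hq, hq'⟩ := Finset.mem_image.1 h2
    obtain ⟨rfl, h3⟩ := coll p q hq'.symm
    exact ⟨q, hp, rfl, h3⟩
  have hIC : A ∩ B ⊆ C := by
    intro w hw
    obtain ⟨q, hq, rfl, he⟩ := collM w hw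
    refine Finset.mem_image.2 ⟨q + 1, hq, ?_⟩
    have h1 : S.cnt (k + 1) (q + 1) ≤ S.cnt (k + 2) (q + 1) := S.cnt_le_succ (k + 1) (q + 1)
    have h2 : S.cnt (k + 2) (q + 1) ≤ S.cnt (k + 1) q := S.cnt_succ_succ_le (k + 1) q
    simp only [ha, node, show S.cnt (k + 2) (q + 1) = S.cnt (k + 1) (q + 1) by omega]
  have hID : A ∩ B ⊆ D := by
    intro w hw
    obtain ⟨q, hq, rfl, he⟩ := collM w hw
    refine Finset.mem_image.2 ⟨q, by simp only [hM, Finset.mem_range] at hq ⊢; omega, ?_⟩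
    have h1 := S.cnt_le_succ k q
    have h2 := S.cnt_succ_succ_le k q
    simp only [ha, node, show S.cnt (k + 1) (q + 1) = S.cnt k q by omega]
    push_cast
    ring
  have key := sum_residue A B C D
    (by simp [hA, hB, hC, hD, Finset.card_image_of_injective, ia, ib, ic, id']) hIC hID
  have num : ∀ z : ℚ, (∏ c ∈ C, (z - c)) * (∏ d ∈ D, (z - d)) =
      (∏ q ∈ M, (z - S.node (k + 2) q)) * ∏ q ∈ M, (z - S.node k q + 1) := by
    intro z
    rw [hC, hD, Finset.prod_image ic.injOn, Finset.prod_image id'.injOn]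
    congr 1
    exact Finset.prod_congr rfl fun q _ => by ring
  have eraseA : ∀ p, A.erase (a p) = (M.erase p).image a := fun p => by
    rw [hA, Finset.image_erase ia]
  have eraseB : ∀ p, B.erase (a p - 1) = (M.erase p).image fun q => a q - 1 := fun p => by
    rw [hB, Finset.image_erase ib]
  have resA : ∀ p ∈ M, (∏ c ∈ C, (a p - c)) * (∏ d ∈ D, (a p - d)) /
      ((∏ w ∈ A.erase (a p), (a p - w)) * ∏ w ∈ B, (a p - w)) = -S.edgeProduct k p := by
    intro p hp
    rw [num, eraseA, Finset.prod_image ia.injOn, hB, Finset.prod_image ib.injOn,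
      ← Finset.mul_prod_erase M (fun q => a p - (a q - 1)) hp, edgeProduct, residue, neg_div,
      neg_neg, Finset.prod_mul_distrib, show a p - (a p - 1) = 1 by ring, one_mul]
    congr 2
    exact Finset.prod_congr rfl fun q _ => by ring
  have resB : ∀ p ∈ M, (∏ c ∈ C, (a p - 1 - c)) * (∏ d ∈ D, (a p - 1 - d)) /
      ((∏ w ∈ B.erase (a p - 1), (a p - 1 - w)) * ∏ w ∈ A, (a p - 1 - w)) =
        S.residue k p (a p - 1) := by
    intro p hp
    rw [num, eraseB, Finset.prod_image ib.injOn, hA, Finset.prod_image ia.injOn,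
      ← Finset.mul_prod_erase M (fun q => a p - 1 - a q) hp, residue, neg_div,
      Finset.prod_mul_distrib, show a p - 1 - a p = -1 by ring, neg_one_mul, mul_neg, div_neg,
      mul_comm (∏ q ∈ M.erase p, (a p - 1 - (a q - 1)))]
    congr 3
    exact Finset.prod_congr rfl fun q _ => by ring
  have setA : A \ B = (M.filter fun p => a p ∉ B).image a := by
    ext w
    simp only [hA, Finset.mem_sdiff, Finset.mem_image, Finset.mem_filter]
    constructor
    · rintro ⟨⟨p, hp, rfl⟩, h⟩
      exact ⟨p, ⟨hp, h⟩, rfl⟩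
    · rintro ⟨p, ⟨hp, h⟩, rfl⟩
      exact ⟨⟨p, hp, rfl⟩, h⟩
  have setB : B \ A = (M.filter fun p => a p - 1 ∉ A).image fun p => a p - 1 := by
    ext w
    simp only [hB, Finset.mem_sdiff, Finset.mem_image, Finset.mem_filter]
    constructor
    · rintro ⟨⟨p, hp, rfl⟩, h⟩
      exact ⟨p, ⟨hp, h⟩, rfl⟩
    · rintro ⟨p, ⟨hp, h⟩, rfl⟩
      exact ⟨⟨p, hp, rfl⟩, h⟩
  have sumA : ∑ p ∈ M.filter (fun p => a p ∉ B), S.edgeProduct k p =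
      ∑ p ∈ M, S.edgeProduct k p := by
    refine Finset.sum_filter_of_ne fun p hp hne hc => hne ?_
    obtain ⟨q, hq, hq'⟩ := Finset.mem_image.1 hc
    obtain ⟨rfl, h3⟩ := coll p q hq'.symm
    refine edgeProduct_eq_zero (fun hr => ?_) (Finset.mem_range.1 hp)
    have := (hr.cnt_lt q.lt_succ_self).2.1
    exact absurd h3 this.ne
  have sumB : ∑ p ∈ M.filter (fun p => a p - 1 ∉ A), S.residue k p (a p - 1) =
      ∑ p ∈ M, S.residue k p (a p - 1) := by
    refine Finset.sum_filter_of_ne fun p hp hne hc => hne ?_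
    obtain ⟨q, hq, hq'⟩ := Finset.mem_image.1 hc
    obtain ⟨rfl, h3⟩ := coll q p hq'
    refine residue_eq_zero (fun hl => ?_) (Finset.mem_range.1 hp) hk
    have h1 := hl.2
    have h2 : S.cnt (k + 1) (p + 1) ≤ S.cnt (k + 2) (p + 1) := S.cnt_le_succ (k + 1) (p + 1)
    omega
  rw [setA, setB, Finset.sum_image ia.injOn, Finset.sum_image ib.injOn,
    Finset.sum_congr rfl fun p hp => resA p (Finset.mem_filter.1 hp).1,
    Finset.sum_congr rfl fun p hp => resB p (Finset.mem_filter.1 hp).1,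
    Finset.sum_neg_distrib, sumA, sumB, hA, hB, hC, hD, Finset.sum_image ia.injOn,
    Finset.sum_image ib.injOn, Finset.sum_image ic.injOn, Finset.sum_image id'.injOn] at key
  rw [sub_eq_neg_add, key]
  simp only [ha, node, Finset.sum_sub_distrib]
  ring

theorem prod_mul_eq_prod_mul {R : Finset ℕ} {f g : ℕ → ℚ} {p : ℕ} (hp : p ∈ R)
    (h : ∀ q ∈ R, q ≠ p → g q = f q) : (∏ q ∈ R, g q) * f p = (∏ q ∈ R, f q) * g p := by
  rw [← Finset.mul_prod_erase R g hp, ← Finset.mul_prod_erase R f hp,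
    Finset.prod_congr rfl fun q hq => h q (Finset.mem_of_mem_erase hq) (Finset.ne_of_mem_erase hq)]
  ring

theorem edgeProduct_congr {k p : ℕ} {S T : Tableau r μ}
    (h : ∀ l q, l = k ∨ l = k + 1 ∨ l = k + 2 → S.node l q = T.node l q) :
    S.edgeProduct k p = T.edgeProduct k p := by
  have h0 : ∀ q, S.node k q = T.node k q := fun q => h _ _ (by omega)
  have h1 : ∀ q, S.node (k + 1) q = T.node (k + 1) q := fun q => h _ _ (by omega)
  have h2 : ∀ q, S.node (k + 2) q = T.node (k + 2) q := fun q => h _ _ (by omega)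
  simp only [edgeProduct, residue, h0, h1, h2]

/-- Around a diamond the Gelfand–Tsetlin edge products of opposite sides satisfy a multiplicative
relation: here for two edges of adjacent colors. -/
theorem edgeProduct_diamond_succ {i p q : ℕ} {A S T : Tableau r μ} (hS : Decrement i p A S)
    (hT : Decrement (i + 1) q A T) (ha : A.edgeProduct i p ≠ 0) (hb : A.edgeProduct (i + 1) q ≠ 0) :
    A.edgeProduct i p * A.edgeProduct (i + 1) q = S.edgeProduct (i + 1) q * T.edgeProduct i p := by
  have hp : p ∈ Finset.range (r + 1) := Finset.mem_range.2 (by have := hS.row_le; have := hS.lt; omega)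
  have hq : q ∈ Finset.range (r + 1) := Finset.mem_range.2 (by have := hT.row_le; have := hT.lt; omega)
  set x := A.node (i + 1) p with hx
  set y := A.node (i + 2) q with hy
  have e1 : S.edgeProduct (i + 1) q * (y - x + 1) = A.edgeProduct (i + 1) q * (y - x) := by
    have h1 : ∀ s, S.node (i + 1 + 1) s = A.node (i + 1 + 1) s := fun s => node_of_ne hS (by omega)
    have h2 : ∀ s, S.node (i + 1 + 2) s = A.node (i + 1 + 2) s := fun s => node_of_ne hS (by omega)
    have h3 := prod_mul_eq_prod_mul (f := fun s => y - A.node (i + 1) s + 1)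
      (g := fun s => y - S.node (i + 1) s + 1) hp fun s _ hs => by
        rw [node_of_ne hS (by tauto)]
    simp only [node_self hS] at h3
    rw [← hx, show y - (x + 1) + 1 = y - x by ring] at h3
    simp only [edgeProduct, residue, h1, h2]
    change -(_ * ∏ s ∈ _, (y - S.node (i + 1) s + 1)) / _ * _ =
      -(_ * ∏ s ∈ _, (y - A.node (i + 1) s + 1)) / _ * _
    rw [div_mul_eq_mul_div, div_mul_eq_mul_div, neg_mul, neg_mul, mul_assoc, mul_assoc, h3]
  have e2 : T.edgeProduct i p * (x - y) = A.edgeProduct i p * (x - y - 1) := by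
    have h1 : ∀ s, T.node (i + 1) s = A.node (i + 1) s := fun s => node_of_ne hT (by omega)
    have h2 : ∀ s, T.node i s = A.node i s := fun s => node_of_ne hT (by omega)
    have h3 := prod_mul_eq_prod_mul (f := fun s => x - A.node (i + 2) s)
      (g := fun s => x - T.node (i + 2) s) hq fun s _ hs => by
        rw [node_of_ne hT (by tauto)]
    have h4 : T.node (i + 2) q = y + 1 := node_self hT
    simp only [h4] at h3
    rw [← hy, show x - (y + 1) = x - y - 1 by ring] at h3
    simp only [edgeProduct, residue, h1, h2]
    change -((∏ s ∈ _, (x - T.node (i + 2) s)) * _) / _ * _ =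
      -((∏ s ∈ _, (x - A.node (i + 2) s)) * _) / _ * _
    rw [div_mul_eq_mul_div, div_mul_eq_mul_div, neg_mul, neg_mul, mul_right_comm, h3,
      mul_right_comm]
  have n1 : x - y ≠ 0 := by
    intro h
    refine ha ?_
    rw [edgeProduct, residue, Finset.prod_eq_zero hq h]
    simp
  have n2 : y - x + 1 ≠ 0 := by
    intro h
    refine hb ?_
    rw [edgeProduct, residue, Finset.prod_eq_zero (f := fun s => _ - A.node (i + 1) s + 1) hp h]
    simp
  refine mul_right_cancel₀ (mul_ne_zero n2 n1) ?_
  calc _ = (A.edgeProduct (i + 1) q * (y - x)) * (A.edgeProduct i p * (x - y - 1)) := by ring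
    _ = _ := by rw [← e1, ← e2]; ring

/-- The multiplicative relation between the Gelfand–Tsetlin edge products around a diamond. -/
theorem edgeProduct_diamond {i p j q : ℕ} {A S T : Tableau r μ} (hS : Decrement i p A S)
    (hT : Decrement j q A T) (hne : S ≠ T) (ha : A.edgeProduct i p ≠ 0)
    (hb : A.edgeProduct j q ≠ 0) (hc : S.edgeProduct j q ≠ 0) (hd : T.edgeProduct i p ≠ 0) :
    A.edgeProduct i p * A.edgeProduct j q = S.edgeProduct j q * T.edgeProduct i p := by
  have hp : p ∈ Finset.range (r + 1) := Finset.mem_range.2 (by have := hS.row_le; have := hS.lt; omega)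
  have hq : q ∈ Finset.range (r + 1) := Finset.mem_range.2 (by have := hT.row_le; have := hT.lt; omega)
  by_cases h1 : j = i + 1
  · subst h1
    exact edgeProduct_diamond_succ hS hT ha hb
  by_cases h2 : i = j + 1
  · subst h2
    rw [mul_comm, edgeProduct_diamond_succ hT hS hb ha, mul_comm]
  by_cases h3 : i = j
  · subst h3
    have hpq : p ≠ q := by
      rintro rfl
      exact hne (hS.right_unique hT)
    -- each side of the relation changes by the same factors in the denominators
    have step : ∀ {p q : ℕ} {S : Tableau r μ}, p ∈ Finset.range (r + 1) → p ≠ q →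
        Decrement i p A S → S.edgeProduct i q ≠ 0 → A.edgeProduct i q ≠ 0 →
        S.edgeProduct i q * (A.node (i + 1) q - A.node (i + 1) p - 1) =
          A.edgeProduct i q * (A.node (i + 1) q - A.node (i + 1) p + 1) ∧
        A.node (i + 1) q - A.node (i + 1) p - 1 ≠ 0 := by
      intro p q S hp hpq hS hc hb
      set x := A.node (i + 1) p with hx
      set y := A.node (i + 1) q with hy
      have h1 : ∀ s, S.node (i + 2) s = A.node (i + 2) s := fun s => node_of_ne hS (by omega)
      have h2 : ∀ s, S.node i s = A.node i s := fun s => node_of_ne hS (by omega)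
      have h3 : S.node (i + 1) q = y := node_of_ne hS (by tauto)
      have h4 : S.node (i + 1) p = x + 1 := node_self hS
      have h5 := prod_mul_eq_prod_mul (R := (Finset.range (r + 1)).erase q)
        (f := fun s => (y - A.node (i + 1) s) * (y - A.node (i + 1) s + 1))
        (g := fun s => (y - S.node (i + 1) s) * (y - S.node (i + 1) s + 1))
        (Finset.mem_erase.2 ⟨hpq, hp⟩) fun s _ hs => by rw [node_of_ne hS (by tauto)]
      simp only [h4] at h5
      rw [← hx, show (y - (x + 1)) * (y - (x + 1) + 1) = (y - x - 1) * (y - x) by ring] at h5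
      rw [edgeProduct, residue, h3] at hc ⊢
      rw [edgeProduct, residue, ← hy] at hb ⊢
      simp only [h1, h2] at hc ⊢
      have d1 := (div_ne_zero_iff.1 hc).2
      have d2 := (div_ne_zero_iff.1 hb).2
      have m : p ∈ (Finset.range (r + 1)).erase q := Finset.mem_erase.2 ⟨hpq, hp⟩
      have f1 := Finset.prod_ne_zero_iff.1 d1 p m
      have f2 := Finset.prod_ne_zero_iff.1 d2 p m
      rw [h4] at f1
      have g1 : y - x - 1 ≠ 0 := by
        have := left_ne_zero_of_mul f1
        rwa [show y - (x + 1) = y - x - 1 by ring] at this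
      have g2 : y - x ≠ 0 := left_ne_zero_of_mul f2
      refine ⟨?_, g1⟩
      rw [div_mul_eq_mul_div, div_mul_eq_mul_div, div_eq_div_iff d1 d2]
      refine mul_right_cancel₀ g2 ?_
      linear_combination (norm := ring_nf) (-((∏ q ∈ Finset.range (r + 1), (y - A.node (i + 2) q)) *
        ∏ q ∈ Finset.range (r + 1), (y - A.node i q + 1))) * (-h5)
    obtain ⟨e1, n1⟩ := step hp hpq hS hc hb
    obtain ⟨e2, n2⟩ := step hq hpq.symm hT hd ha
    refine mul_right_cancel₀ (mul_ne_zero n1 n2) ?_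
    set x := A.node (i + 1) p
    set y := A.node (i + 1) q
    calc _ = (A.edgeProduct i q * (y - x + 1)) * (A.edgeProduct i p * (x - y + 1)) := by ring
      _ = _ := by rw [← e1, ← e2]; ring
  · rw [edgeProduct_congr (S := S) (T := A) fun l s hl => node_of_ne hS (by omega),
      edgeProduct_congr (S := T) (T := A) fun l s hl => node_of_ne hT (by omega), mul_comm]

end Tableau

end GelfandTsetlin

/-! ### Weights of the vertices -/

namespace GelfandTsetlin

namespace Tableau

variable {r : ℕ} {μ : YoungDiagram}

theorem rowLen_eq_zero (hμ : μ.colLen 0 ≤ r + 1) {p : ℕ} (hp : r + 1 ≤ p) : μ.rowLen p = 0 := by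
  by_contra h
  have := YoungDiagram.mem_iff_lt_colLen.1 (YoungDiagram.mem_iff_lt_rowLen.2 (Nat.pos_of_ne_zero h))
  omega

theorem Decrement.row_mem {k p : ℕ} {S R : Tableau r μ} (h : Decrement k p S R) :
    p ∈ Finset.range (r + 1) := by
  have := h.row_le
  have := h.lt
  exact Finset.mem_range.2 (by omega)

/-- Within a component of color `k` only level `k + 1` of the pattern varies, and the rank differs
from the sum of this level by a constant. -/
theorem component_spec {k : Fin r} {S T : Tableau r μ} (h : T ∈ (GT r μ).component k S) :
    (∀ l q : ℕ, l ≠ k + 1 → T.cnt l q = S.cnt l q) ∧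
      (GT r μ).rank T - (GT r μ).rank S = ∑ p ∈ Finset.range (r + 1), (T.cnt (k + 1) p : ℤ) -
        ∑ p ∈ Finset.range (r + 1), (S.cnt (k + 1) p : ℤ) := by
  change Relation.EqvGen _ S T at h
  induction h with
  | rel S T h =>
    have hr := (GT r μ).rank_edge h
    obtain ⟨p, hp⟩ := h
    have hd := decrement_iff.1 hp
    refine ⟨fun l q hl => by rw [hd, if_neg (by tauto), add_zero], ?_⟩
    have : ∑ q ∈ Finset.range (r + 1), (T.cnt (k + 1) q : ℤ) =
        ∑ q ∈ Finset.range (r + 1), ((S.cnt (k + 1) q : ℤ) + if q = p then 1 else 0) :=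
      Finset.sum_congr rfl fun q _ => by rw [hd]; push_cast; simp
    rw [this, Finset.sum_add_distrib, Finset.sum_ite_eq', if_pos hp.row_mem, hr]
    ring
  | refl S => simp
  | symm S T _ ih => exact ⟨fun l q hl => (ih.1 l q hl).symm, by linarith [ih.2]⟩
  | trans S T U _ _ ih1 ih2 =>
    exact ⟨fun l q hl => (ih2.1 l q hl).trans (ih1.1 l q hl), by linarith [ih1.2, ih2.2]⟩

/-- The weight `m_k(S)` in terms of the pattern: a component of color `k` is a product of chains, one
for every row of the pattern. -/
theorem m_eq (hμ : μ.colLen 0 ≤ r + 1) (k : Fin r) (S : Tableau r μ) :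
    (GT r μ).m k S = 2 * ∑ p ∈ Finset.range (r + 1), (S.cnt (k + 1) p : ℤ) -
      ∑ p ∈ Finset.range (r + 1), (S.cnt k p : ℤ) -
      ∑ p ∈ Finset.range (r + 1), (S.cnt (k + 2) p : ℤ) := by
  set Z := (GT r μ).rank '' (GT r μ).component k S with hZ
  have hfin : Z.Finite := Set.toFinite _
  have hne : Z.Nonempty := ⟨_, S, Relation.EqvGen.refl S, rfl⟩
  obtain ⟨A, hA, hA'⟩ := Int.csInf_mem hne hfin.bddBelow
  obtain ⟨B, hB, hB'⟩ := Int.csSup_mem hne hfin.bddAbove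
  have lowA : ∀ p, ¬ A.Lowerable k p := by
    intro p h
    obtain ⟨U, hU⟩ := (exists_increment_iff k.2).2 h
    have hU' : (GT r μ).Edge k U A := ⟨p, hU⟩
    have h1 := csInf_le hfin.bddBelow (Set.mem_image_of_mem (GT r μ).rank
      (show U ∈ (GT r μ).component k S from hA.trans _ _ _ ((Relation.EqvGen.rel _ _ hU').symm)))
    have := (GT r μ).rank_edge hU'
    omega
  have highB : ∀ p, ¬ B.Raisable k p := by
    intro p h
    obtain ⟨U, hU⟩ := (exists_decrement_iff k.2).2 h
    have hU' : (GT r μ).Edge k B U := ⟨p, hU⟩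
    have h1 := le_csSup hfin.bddAbove (Set.mem_image_of_mem (GT r μ).rank
      (show U ∈ (GT r μ).component k S from hB.trans _ _ _ (Relation.EqvGen.rel _ _ hU')))
    have := (GT r μ).rank_edge hU'
    omega
  obtain ⟨sA, rA⟩ := component_spec hA
  obtain ⟨sB, rB⟩ := component_spec hB
  have eA : ∀ p, (A.cnt (k + 1) p : ℤ) = max (S.cnt k p : ℤ) (S.cnt (k + 2) (p + 1)) := by
    intro p
    have h1 := sA k p (by omega)
    have h2 := sA (k + 2) (p + 1) (by omega)
    have h3 := A.cnt_le_succ k p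
    have h4 : A.cnt (k + 2) (p + 1) ≤ A.cnt (k + 1) p := A.cnt_succ_succ_le (k + 1) p
    have h5 := lowA p
    simp only [Lowerable] at h5
    omega
  have eB0 : (B.cnt (k + 1) 0 : ℤ) = S.cnt (k + 2) 0 := by
    have h2 := sB (k + 2) 0 (by omega)
    have h3 : B.cnt (k + 1) 0 ≤ B.cnt (k + 2) 0 := B.cnt_le_succ (k + 1) 0
    have h5 := highB 0
    simp only [Raisable] at h5
    by_contra hc
    exact h5 ⟨by omega, fun q hq => by omega⟩
  have eB : ∀ p, (B.cnt (k + 1) (p + 1) : ℤ) = min (S.cnt k p : ℤ) (S.cnt (k + 2) (p + 1)) := by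
    intro p
    have h1 := sB k p (by omega)
    have h2 := sB (k + 2) (p + 1) (by omega)
    have h3 := B.cnt_succ_succ_le k p
    have h4 : B.cnt (k + 1) (p + 1) ≤ B.cnt (k + 2) (p + 1) := B.cnt_le_succ (k + 1) (p + 1)
    have h5 := highB (p + 1)
    by_contra hc
    exact h5 ⟨by omega, fun q hq => by
      obtain rfl : p = q := by omega
      omega⟩
  have last : (S.cnt (k + 2) (r + 1) : ℤ) = 0 := by
    have h1 := S.cnt_le_rowLen (k + 2) (r + 1)
    rw [rowLen_eq_zero hμ le_rfl] at h1
    omega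
  have sumA : ∑ p ∈ Finset.range (r + 1), (A.cnt (k + 1) p : ℤ) +
      ∑ p ∈ Finset.range (r + 1), (B.cnt (k + 1) p : ℤ) =
      ∑ p ∈ Finset.range (r + 1), (S.cnt k p : ℤ) +
        ∑ p ∈ Finset.range (r + 1), (S.cnt (k + 2) p : ℤ) := by
    rw [Finset.sum_range_succ' (fun p => (B.cnt (k + 1) p : ℤ)),
      Finset.sum_range_succ' (fun p => (S.cnt (k + 2) p : ℤ)),
      Finset.sum_range_succ (fun p => (A.cnt (k + 1) p : ℤ)),
      Finset.sum_range_succ (fun p => (S.cnt k p : ℤ)), eB0, eA r, last]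
    simp only [eA, eB]
    have h1 := Finset.sum_add_distrib (s := Finset.range r)
      (f := fun p => max (S.cnt k p : ℤ) (S.cnt (k + 2) (p + 1)))
      (g := fun p => min (S.cnt k p : ℤ) (S.cnt (k + 2) (p + 1)))
    simp only [max_add_min, Finset.sum_add_distrib] at h1
    have h2 : max (S.cnt k r : ℤ) 0 = S.cnt k r := max_eq_left (Int.natCast_nonneg _)
    linarith
  simp only [ColoredPoset.m, ColoredPoset.rho, ColoredPoset.len]
  rw [← hZ, ← hA', ← hB']
  linarith

/-! ### Labels from the Gelfand–Tsetlin edge products -/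

/-- A sum over the tableaux that a relation `D`, one-to-one on both sides, attaches to some row is a sum
over the rows. -/
theorem sum_eq_sum_rows {M : Type*} [AddCommMonoid M] (D : ℕ → Tableau r μ → Prop)
    (hD : ∀ p t, D p t → p ∈ Finset.range (r + 1)) (h1 : ∀ p t t', D p t → D p t' → t = t')
    (h2 : ∀ p p' t, D p t → D p' t → p = p') (f : Tableau r μ → M) (g : ℕ → M)
    (hfg : ∀ p t, D p t → f t = g p) (h0 : ∀ p ∈ Finset.range (r + 1), (¬ ∃ t, D p t) → g p = 0)
    [DecidablePred fun t => ∃ p, D p t] :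
    ∑ t with ∃ p, D p t, f t = ∑ p ∈ Finset.range (r + 1), g p := by
  classical
  rw [← Finset.sum_filter_of_ne (p := fun p => ∃ t, D p t) fun p hp hne => by
    by_contra hc
    exact hne (h0 p hp hc)]
  refine Finset.sum_bij (fun t ht => (Finset.mem_filter.1 ht).2.choose) ?_ ?_ ?_ ?_
  · intro t ht
    have := (Finset.mem_filter.1 ht).2.choose_spec
    exact Finset.mem_filter.2 ⟨hD _ _ this, t, this⟩
  · intro t ht t' ht' he
    have e1 := (Finset.mem_filter.1 ht).2.choose_spec
    have e2 := (Finset.mem_filter.1 ht').2.choose_spec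
    rw [← he] at e2
    exact h1 _ _ _ e1 e2
  · intro p hp
    obtain ⟨t, ht⟩ := (Finset.mem_filter.1 hp).2
    have hm : t ∈ Finset.univ.filter fun t => ∃ p, D p t :=
      Finset.mem_filter.2 ⟨Finset.mem_univ _, p, ht⟩
    exact ⟨t, hm, h2 _ _ _ (Finset.mem_filter.1 hm).2.choose_spec ht⟩
  · intro t ht
    exact hfg _ _ (Finset.mem_filter.1 ht).2.choose_spec

theorem Decrement.edgeProduct_pos {k p : ℕ} {S R : Tableau r μ} (h : Decrement k p S R) :
    0 < S.edgeProduct k p :=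
  Tableau.edgeProduct_pos ((exists_decrement_iff h.lt).1 ⟨R, h⟩) (Finset.mem_range.1 h.row_mem)

open Classical in
/-- Labels for the edges of the Gelfand–Tsetlin lattice: each edge `S → R` carries the square root of
its edge product in both directions. -/
noncomputable def label (S R : Tableau r μ) : ℂ :=
  if h : ∃ x : ℕ × ℕ, Decrement x.1 x.2 S R then
    ((√(S.edgeProduct h.choose.1 h.choose.2 : ℝ) : ℝ) : ℂ) else 0

theorem label_eq {k p : ℕ} {S R : Tableau r μ} (h : Decrement k p S R) :
    label S R = ((√(S.edgeProduct k p : ℝ) : ℝ) : ℂ) := by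
  have hx : ∃ x : ℕ × ℕ, Decrement x.1 x.2 S R := ⟨(k, p), h⟩
  rw [label, dif_pos hx]
  obtain ⟨e1, e2⟩ := hx.choose_spec.label_unique h
  rw [e1, e2]

theorem label_mul_self {k p : ℕ} {S R : Tableau r μ} (h : Decrement k p S R) :
    label S R * label S R = (S.edgeProduct k p : ℂ) := by
  rw [label_eq h, ← Complex.ofReal_mul, Real.mul_self_sqrt]
  · simp
  · exact_mod_cast h.edgeProduct_pos.le

theorem label_ne_zero {k p : ℕ} {S R : Tableau r μ} (h : Decrement k p S R) : label S R ≠ 0 := by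
  intro h0
  have := label_mul_self h
  rw [h0, mul_zero, eq_comm, Rat.cast_eq_zero] at this
  exact h.edgeProduct_pos.ne' this

theorem label_crossing (hμ : μ.colLen 0 ≤ r + 1) :
    (GT r μ).Crossing (fun t s => label s t) (fun s t => label s t) := by
  classical
  intro k S
  have e1 : (∑ U with (GT r μ).Edge k U S, label U S * label U S) =
      ∑ p ∈ Finset.range (r + 1), (S.residue k p (S.node (k + 1) p - 1) : ℂ) := by
    refine sum_eq_sum_rows (fun p U => Decrement k p U S) (fun p t h => h.row_mem)
      (fun p t t' h h' => h.left_unique h') (fun p p' t h h' => (h.label_unique h').2) _ _ ?_ ?_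
    · intro p U h
      rw [label_mul_self h, edgeProduct_of_decrement h]
    · intro p hp h
      rw [residue_eq_zero (mt (exists_increment_iff k.2).2 h) (Finset.mem_range.1 hp) k.2]
      simp
  have e2 : (∑ R with (GT r μ).Edge k S R, label S R * label S R) =
      ∑ p ∈ Finset.range (r + 1), (S.edgeProduct k p : ℂ) := by
    refine sum_eq_sum_rows (fun p R => Decrement k p S R) (fun p t h => h.row_mem)
      (fun p t t' h h' => h.right_unique h') (fun p p' t h h' => (h.label_unique h').2) _ _ ?_ ?_
    · intro p U h
      rw [label_mul_self h]
    · intro p hp h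
      rw [edgeProduct_eq_zero (mt (exists_decrement_iff k.2).2 h) (Finset.mem_range.1 hp)]
      simp
  have key := sum_residue_sub_sum_edgeProduct S k.2
  have key' := congrArg (Rat.cast : ℚ → ℂ) key
  rw [m_eq hμ]
  push_cast at key' ⊢
  rw [← key', ← e1, ← e2]

theorem sum_diamond_below {M : Type*} [AddCommMonoid M] {i j : Fin r} {p q : ℕ}
    {A S T U : Tableau r μ} (hAS : Decrement i p A S) (hAT : Decrement j q A T)
    (hSU : Decrement j q S U) (hTU : Decrement i p T U) (hne : S ≠ T) (f : Tableau r μ → M)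
    [DecidablePred fun u => (GT r μ).Edge j S u ∧ (GT r μ).Edge i T u] :
    ∑ u with (GT r μ).Edge j S u ∧ (GT r μ).Edge i T u, f u = f U := by
  refine Finset.sum_eq_single_of_mem U (Finset.mem_filter.2 ⟨Finset.mem_univ _, ⟨q, hSU⟩, ⟨p, hTU⟩⟩)
    fun u hu hne' => (hne' ?_).elim
  obtain ⟨-, ⟨q', h1⟩, ⟨p', h2⟩⟩ := Finset.mem_filter.1 hu
  obtain ⟨-, rfl⟩ := diamond_labels hne h1 h2 hAS hAT
  exact h1.right_unique hSU

theorem sum_diamond_above {M : Type*} [AddCommMonoid M] {i j : Fin r} {p q : ℕ}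
    {A S T U : Tableau r μ} (hAS : Decrement i p A S) (hAT : Decrement j q A T)
    (hSU : Decrement j q S U) (hTU : Decrement i p T U) (hne : S ≠ T) (f : Tableau r μ → M)
    [DecidablePred fun a => (GT r μ).Edge i a S ∧ (GT r μ).Edge j a T] :
    ∑ a with (GT r μ).Edge i a S ∧ (GT r μ).Edge j a T, f a = f A := by
  refine Finset.sum_eq_single_of_mem A (Finset.mem_filter.2 ⟨Finset.mem_univ _, ⟨p, hAS⟩, ⟨q, hAT⟩⟩)
    fun u hu hne' => (hne' ?_).elim
  obtain ⟨-, ⟨p', h1⟩, ⟨q', h2⟩⟩ := Finset.mem_filter.1 hu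
  obtain ⟨rfl, -⟩ := diamond_labels hne hSU hTU h1 h2
  exact h1.left_unique hAS

/-- In the Gelfand–Tsetlin lattice every diamond relation has at most one term on each side. -/
theorem diamond_mul {c d : Tableau r μ → Tableau r μ → ℂ} (h : (GT r μ).Diamond c d) {i j p q : ℕ}
    {A S T U : Tableau r μ} (hAS : Decrement i p A S) (hAT : Decrement j q A T)
    (hSU : Decrement j q S U) (hTU : Decrement i p T U) (hne : S ≠ T) :
    c U S * d T U = d A S * c T A := by
  have hS : (GT r μ).Edge ⟨i, hAS.lt⟩ A S := ⟨p, hAS⟩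
  have hT : (GT r μ).Edge ⟨j, hAT.lt⟩ A T := ⟨q, hAT⟩
  have := h ⟨i, hAS.lt⟩ ⟨j, hAT.lt⟩ S T hne
    (((GT r μ).rank_edge hS).trans ((GT r μ).rank_edge hT).symm)
  rwa [sum_diamond_below hAS hAT hSU hTU hne, sum_diamond_above hAS hAT hSU hTU hne] at this

theorem label_diamond : (GT r μ).Diamond (fun t s => label s t) (fun s t => label s t) := by
  classical
  intro i j S T hne hrank
  have main : ∀ {p q : ℕ} {A U : Tableau r μ}, Decrement i p A S → Decrement j q A T →
      Decrement j q S U → Decrement i p T U →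
      label S U * label T U = label A S * label A T := by
    intro p q A U hAS hAT hSU hTU
    have key := edgeProduct_diamond hAS hAT hne hAS.edgeProduct_pos.ne' hAT.edgeProduct_pos.ne'
      hSU.edgeProduct_pos.ne' hTU.edgeProduct_pos.ne'
    rw [label_eq hAS, label_eq hAT, label_eq hSU, label_eq hTU, ← Complex.ofReal_mul,
      ← Complex.ofReal_mul, ← Real.sqrt_mul, ← Real.sqrt_mul]
    · congr 2
      exact_mod_cast key.symm
    · exact_mod_cast hAS.edgeProduct_pos.le
    · exact_mod_cast hSU.edgeProduct_pos.le
  by_cases hU : ∃ u, (GT r μ).Edge j S u ∧ (GT r μ).Edge i T u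
  · obtain ⟨U, ⟨q, hSU⟩, ⟨p, hTU⟩⟩ := hU
    obtain ⟨A, hAS, hAT⟩ := exists_diamond_above hSU hTU hne
    rw [sum_diamond_below hAS hAT hSU hTU hne, sum_diamond_above hAS hAT hSU hTU hne]
    exact main hAS hAT hSU hTU
  · by_cases hA : ∃ a, (GT r μ).Edge i a S ∧ (GT r μ).Edge j a T
    · obtain ⟨A, ⟨p, hAS⟩, ⟨q, hAT⟩⟩ := hA
      obtain ⟨U, hSU, hTU⟩ := exists_diamond_below hAS hAT hne
      exact (hU ⟨U, ⟨q, hSU⟩, ⟨p, hTU⟩⟩).elim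
    · rw [Finset.filter_false_of_mem fun u _ hu => hU ⟨u, hu⟩,
        Finset.filter_false_of_mem fun u _ hu => hA ⟨u, hu⟩]
      simp

/-! ### Edge products are determined by crossing and diamond relations -/

theorem leftCol_eq {k p : ℕ} {S R : Tableau r μ} (h : Decrement k p S R) :
    Algorithm.leftCol k p S = S.cnt (k + 1) p := by
  have hr := ((exists_decrement_iff h.lt).1 ⟨R, h⟩).1
  have h1 := S.lt_cnt_iff.1 hr
  have h2 := S.entry_lt_iff (k := k + 1) h1.1
  have hmem : S.cnt (k + 1) p ∈ {j | S p j = k + 1} := by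
    change S p _ = k + 1
    have := h1.2
    omega
  refine le_antisymm (Nat.sInf_le hmem) (le_csInf ⟨_, hmem⟩ fun j hj => ?_)
  change S p j = k + 1 at hj
  by_contra hc
  have := S.lt_cnt_iff.1 (not_le.1 hc)
  omega

/-- The diamond used by the algorithm for a decrementable row `p` of `S` that is not the lowest one:
the entry `i` above the leftmost `k + 1` of a lower decrementable row `p'` is less than `k`, and the
rightmost `i` in row `p' - 1` can be incremented. -/
theorem exists_diamond {k p p' : ℕ} {S R R' : Tableau r μ} (h : Decrement k p S R)
    (h' : Decrement k p' S R') (hp : p < p') :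
    ∃ i, i = S (p' - 1) (Algorithm.leftCol k p' S) ∧ i < k ∧ ∃ U T : Tableau r μ,
      Decrement i (p' - 1) U S ∧ Decrement k p U T ∧ Decrement i (p' - 1) T R := by
  obtain ⟨q, rfl⟩ : ∃ q, p' = q + 1 := ⟨p' - 1, by omega⟩
  rw [leftCol_eq h', Nat.add_sub_cancel]
  have hr' := (exists_decrement_iff h'.lt).1 ⟨R', h'⟩
  have hr := (exists_decrement_iff h.lt).1 ⟨R, h⟩
  have hk := h.lt
  have h1 := hr'.2 q rfl
  have h2 := S.lt_cnt_iff.1 h1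
  set j := S.cnt (k + 1) (q + 1) with hj
  set i := S q j with hi
  have h3 := S.entry_lt_iff (k := i) h2.1
  have h4 := S.entry_lt_iff (k := i + 1) h2.1
  have hik : i < k := h2.2
  have h5 : S.cnt (i + 2) (q + 1) ≤ S.cnt (k + 1) (q + 1) :=
    S.cnt_mono (q + 1) (show i + 2 ≤ k + 1 by omega)
  have hlow : S.Lowerable i q := ⟨by omega, by omega⟩
  obtain ⟨U, hU⟩ := (exists_increment_iff (hik.trans hk)).2 hlow
  have hU' := decrement_iff.1 hU
  have hrU : U.Raisable k p := by
    have e1 := hU' (k + 1) p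
    have e2 := hU' (k + 2) p
    rw [if_neg (by omega)] at e1 e2
    refine ⟨by have := hr.1; omega, fun s hs => ?_⟩
    have e3 := hU' k s
    rw [if_neg (by omega)] at e3
    have := hr.2 s hs
    omega
  obtain ⟨T, hT⟩ := (exists_decrement_iff hk).2 hrU
  refine ⟨i, rfl, hik, U, T, hU, hT, decrement_iff.2 fun l s => ?_⟩
  have e1 := hU' l s
  have e2 := decrement_iff.1 hT l s
  have e3 := decrement_iff.1 h l s
  omega

theorem ne_of_decrement {i k p q : ℕ} {U S T : Tableau r μ} (hS : Decrement i q U S)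
    (hT : Decrement k p U T) (hik : i < k) : S ≠ T := by
  rintro rfl
  exact hik.ne (hS.label_unique hT).1

theorem edgeProduct_eq_div {i k p q : ℕ} {U S T R : Tableau r μ} (hik : i < k)
    (hUS : Decrement i q U S) (hUT : Decrement k p U T) (hSR : Decrement k p S R)
    (hTR : Decrement i q T R) :
    S.edgeProduct k p = U.edgeProduct i q * U.edgeProduct k p / T.edgeProduct i q := by
  rw [eq_div_iff hTR.edgeProduct_pos.ne']
  exact (edgeProduct_diamond hUS hUT (ne_of_decrement hUS hUT hik) hUS.edgeProduct_pos.ne'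
    hUT.edgeProduct_pos.ne' hSR.edgeProduct_pos.ne' hTR.edgeProduct_pos.ne').symm

theorem rank_wellFounded : WellFounded fun A B : Tableau r μ => (GT r μ).rank A < (GT r μ).rank B :=
  haveI : IsTrans (Tableau r μ) fun A B => (GT r μ).rank A < (GT r μ).rank B :=
    ⟨fun _ _ _ => lt_trans⟩
  haveI : Std.Irrefl fun A B : Tableau r μ => (GT r μ).rank A < (GT r μ).rank B :=
    ⟨fun _ => lt_irrefl _⟩
  Finite.wellFounded_of_trans_of_irrefl _

theorem Decrement.rank_lt {k p : ℕ} {S R : Tableau r μ} (h : Decrement k p S R) :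
    (GT r μ).rank S < (GT r μ).rank R := by
  have := (GT r μ).rank_edge (show (GT r μ).Edge ⟨k, h.lt⟩ S R from ⟨p, h⟩)
  omega

/-- The crossing and diamond relations determine the edge products. -/
theorem mul_eq_edgeProduct (hμ : μ.colLen 0 ≤ r + 1) {c d : Tableau r μ → Tableau r μ → ℂ}
    (hc : (GT r μ).Crossing c d) (hd : (GT r μ).Diamond c d) {k p : ℕ} {S R : Tableau r μ}
    (h : Decrement k p S R) : c R S * d S R = (S.edgeProduct k p : ℂ) := by
  classical
  induction k using Nat.strong_induction_on generalizing p S R with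
  | _ k ihk =>
    induction S using rank_wellFounded.induction generalizing p R with
    | _ S ihS =>
      -- all decrementable rows but the lowest one
      have upper : ∀ {p p' : ℕ} {R R' : Tableau r μ}, Decrement k p S R → Decrement k p' S R' →
          p < p' → c R S * d S R = (S.edgeProduct k p : ℂ) := by
        intro p p' R R' h h' hp
        obtain ⟨i, -, hik, U, T, hUS, hUT, hTR⟩ := exists_diamond h h' hp
        have hne := ne_of_decrement hUS hUT hik
        -- the product of the diamond relations for `(S, T)` and `(T, S)` involves only edge products
        have e1 := diamond_mul hd hUS hUT h hTR hne
        have e2 := diamond_mul hd hUT hUS hTR h hne.symm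
        have p1 := ihk i hik hUS
        have p2 := ihS U hUS.rank_lt hUT
        have p3 := ihk i hik hTR
        rw [edgeProduct_eq_div hik hUS hUT h hTR]
        have hz : (T.edgeProduct i (p' - 1) : ℂ) ≠ 0 := by
          exact_mod_cast hTR.edgeProduct_pos.ne'
        push_cast
        rw [eq_div_iff hz, ← p1, ← p2, ← p3]
        linear_combination (c R T * d S R) * e1 + (d U S * c T U) * e2
      by_cases hlow : ∃ p' R', Decrement k p' S R' ∧ p < p'
      · obtain ⟨p', R', h', hp⟩ := hlow
        exact upper h h' hp
      · have other : ∀ R', (GT r μ).Edge ⟨k, h.lt⟩ S R' → R' ≠ R →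
            c R' S * d S R' = label S R' * label S R' := by
          rintro R' ⟨p', h'⟩ hne
          have h' : Decrement k p' S R' := h'
          rw [label_mul_self h']
          refine upper h' h (lt_of_le_of_ne (not_lt.1 fun hlt => hlow ⟨p', R', h', hlt⟩) ?_)
          rintro rfl
          exact hne (h'.right_unique h)
        have c1 := hc ⟨k, h.lt⟩ S
        have c2 := label_crossing hμ ⟨k, h.lt⟩ S
        rw [← c2] at c1
        have inc : ∀ U ∈ Finset.univ.filter fun U => (GT r μ).Edge ⟨k, h.lt⟩ U S,
            c S U * d U S = label U S * label U S := by
          intro U hU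
          obtain ⟨-, q, hq⟩ := Finset.mem_filter.1 hU
          have hq : Decrement k q U S := hq
          rw [label_mul_self hq, ihS U hq.rank_lt hq]
        have hmem : R ∈ Finset.univ.filter fun R => (GT r μ).Edge ⟨k, h.lt⟩ S R :=
          Finset.mem_filter.2 ⟨Finset.mem_univ _, p, h⟩
        rw [Finset.sum_congr rfl inc, sub_right_inj, ← Finset.add_sum_erase _ _ hmem,
          ← Finset.add_sum_erase _ _ hmem, Finset.sum_congr rfl fun R' hR' =>
            other R' (Finset.mem_filter.1 (Finset.mem_of_mem_erase hR')).2
              (Finset.ne_of_mem_erase hR')] at c1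
        rw [add_right_cancel c1, label_mul_self h]

end Tableau

end GelfandTsetlin

/-! ### The algorithm computes the Gelfand–Tsetlin edge products -/

namespace GelfandTsetlin

namespace Algorithm

open Tableau

variable {r : ℕ} {μ : YoungDiagram}

theorem dec_eq {k p : ℕ} {S R : Tableau r μ} (h : Decrement k p S R) : dec k p S = some R := by
  have hx : ∃ R, Decrement k p S R := ⟨R, h⟩
  rw [dec, dif_pos hx, hx.choose_spec.right_unique h]

theorem inc_eq {k p : ℕ} {U S : Tableau r μ} (h : Decrement k p U S) : inc k p S = some U := by
  have hx : ∃ U, Decrement k p U S := ⟨U, h⟩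
  rw [inc, dif_pos hx, hx.choose_spec.left_unique h]

/-- The table `σ` contains the Gelfand–Tsetlin edge products of all edges of color `k` from `A`. -/
def Known (σ : Table r μ) (k : ℕ) (A : Tableau r μ) : Prop :=
  ∀ p R, Decrement k p A R → σ k A p = some (A.edgeProduct k p)

theorem diamondStep_eq {σ : Table r μ} {k : ℕ} {S : Tableau r μ}
    (h1 : ∀ i < k, ∀ A, Known σ i A)
    (h2 : ∀ i q U, Decrement i q U S → Known σ k U) {p : ℕ} {R : Tableau r μ}
    (h : Decrement k p S R) (hlow : ∃ q ∈ decRows k S, p < q) :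
    diamondStep σ k S p = some (S.edgeProduct k p) := by
  classical
  have hmem : sInf {q | q ∈ decRows k S ∧ p < q} ∈ {q | q ∈ decRows k S ∧ p < q} :=
    Nat.sInf_mem hlow
  obtain ⟨⟨R', h'⟩, hp⟩ := hmem
  obtain ⟨i, hi, hik, U, T, hUS, hUT, hTR⟩ := exists_diamond h h' hp
  simp only [diamondStep, ← hi]
  rw [inc_eq hUS, Option.bind_some, dec_eq hUT, Option.bind_some, h1 i hik U _ _ hUS,
    Option.bind_some, h2 i _ U hUS _ _ hUT, Option.bind_some, h1 i hik T _ _ hTR, Option.bind_some,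
    if_neg hTR.edgeProduct_pos.ne', edgeProduct_eq_div hik hUS hUT h hTR]

theorem crossingStep_eq (hμ : μ.colLen 0 ≤ r + 1) {σ : Table r μ} {k : Fin r} {S : Tableau r μ}
    (h2 : ∀ U q, Decrement k q U S → Known σ k U) {p : ℕ} {R : Tableau r μ}
    (h : Decrement k p S R)
    (h3 : ∀ q R', Decrement k q S R' → q ≠ p → σ k S q = some (S.edgeProduct k q)) :
    crossingStep (GT r μ).m σ k S p = some (S.edgeProduct k p) := by
  classical
  have inc' : ∀ q ∈ Finset.range (r + 1), ((inc k q S).elim (some 0) fun Q => σ k Q q) =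
      some (S.residue k q (S.node (k + 1) q - 1)) := by
    intro q hq
    by_cases hx : ∃ U, Decrement k q U S
    · obtain ⟨U, hU⟩ := hx
      rw [inc_eq hU, Option.elim_some, h2 U q hU q S hU, edgeProduct_of_decrement hU]
    · rw [inc, dif_neg hx, Option.elim_none,
        residue_eq_zero (mt (exists_increment_iff k.2).2 hx) (Finset.mem_range.1 hq) k.2]
  have out' : ∀ q ∈ Finset.range (r + 1),
      (if q ∈ decRows k S ∧ q ≠ p then σ k S q else some 0) =
      some (if q = p then 0 else S.edgeProduct k q) := by
    intro q hq
    by_cases hqp : q = p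
    · simp [hqp]
    · by_cases hx : q ∈ decRows k S
      · obtain ⟨R', hR'⟩ := hx
        rw [if_pos ⟨⟨R', hR'⟩, hqp⟩, if_neg hqp, h3 q R' hR' hqp]
      · rw [if_neg fun hc => hx hc.1, if_neg hqp,
          edgeProduct_eq_zero (mt (exists_decrement_iff k.2).2 hx) (Finset.mem_range.1 hq)]
  simp only [crossingStep]
  rw [if_pos fun q hq => ⟨by rw [inc' q hq]; rfl, by rw [out' q hq]; rfl⟩]
  have s1 : ∑ q ∈ Finset.range (r + 1), ((inc k q S).elim (some 0) fun Q => σ k Q q).getD 0 =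
      ∑ q ∈ Finset.range (r + 1), S.residue k q (S.node (k + 1) q - 1) :=
    Finset.sum_congr rfl fun q hq => by rw [inc' q hq, Option.getD_some]
  have s2 : ∑ q ∈ Finset.range (r + 1), (if q ∈ decRows k S ∧ q ≠ p then σ k S q else some 0).getD 0
      = ∑ q ∈ Finset.range (r + 1), (if q = p then 0 else S.edgeProduct k q) :=
    Finset.sum_congr rfl fun q hq => by rw [out' q hq, Option.getD_some]
  have s3 : ∑ q ∈ Finset.range (r + 1), (if q = p then 0 else S.edgeProduct k q) =
      ∑ q ∈ Finset.range (r + 1), S.edgeProduct k q - S.edgeProduct k p := by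
    rw [← Finset.add_sum_erase _ (fun q => S.edgeProduct k q) h.row_mem, add_sub_cancel_left,
      ← Finset.add_sum_erase _ _ h.row_mem, if_pos rfl, zero_add]
    exact Finset.sum_congr rfl fun q hq => if_neg (Finset.ne_of_mem_erase hq)
  have key := sum_residue_sub_sum_edgeProduct S k.2
  have m := m_eq hμ k S
  rw [s1, s2, s3, m]
  push_cast
  rw [← key]
  congr 1
  ring

theorem processVertex_of_ne {m : Fin r → Tableau r μ → ℤ} {k : Fin r} {σ : Table r μ}
    {S A : Tableau r μ} {k' : ℕ} (h : ¬ (k' = k ∧ A = S)) (p : ℕ) :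
    processVertex m k σ S k' A p = σ k' A p := by
  simp only [processVertex]
  rw [if_neg (by tauto), if_neg (by tauto)]

theorem known_processVertex (hμ : μ.colLen 0 ≤ r + 1) {σ : Table r μ} {k : Fin r} {S : Tableau r μ}
    (h1 : ∀ i < (k : ℕ), ∀ A, Known σ i A)
    (h2 : ∀ i q U, Decrement i q U S → Known σ k U) :
    Known (processVertex (GT r μ).m k σ S) k S := by
  classical
  intro p R h
  have hd : p ∈ decRows (k : ℕ) S := ⟨R, h⟩
  simp only [processVertex, true_and]
  by_cases hlow : ∃ q ∈ decRows (k : ℕ) S, p < q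
  · rw [if_neg fun hc => hc.2 hlow, if_pos ⟨hd, hlow⟩]
    exact diamondStep_eq h1 h2 h hlow
  · rw [if_pos ⟨hd, hlow⟩]
    refine crossingStep_eq hμ ?_ h ?_
    · intro U q hU s R' hR'
      dsimp only
      rw [if_neg]
      · exact h2 k q U hU s R' hR'
      · rintro ⟨-, rfl, -⟩
        exact lt_irrefl _ hU.rank_lt
    · intro q R' hR' hqp
      have hq : ∃ s ∈ decRows (k : ℕ) S, q < s := by
        refine ⟨p, hd, lt_of_le_of_ne (not_lt.1 fun hlt => hlow ⟨q, ⟨R', hR'⟩, hlt⟩) hqp⟩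
      simp only [true_and]
      rw [if_pos ⟨⟨R', hR'⟩, hq⟩]
      exact diamondStep_eq h1 h2 hR' hq

/-- The set `D` consists of the vertices already treated for the color `k`. -/
theorem known_foldl_processVertex (hμ : μ.colLen 0 ≤ r + 1) {k : Fin r} (L : List (Tableau r μ))
    (σ : Table r μ) (D : Set (Tableau r μ)) (h1 : ∀ i < (k : ℕ), ∀ A, Known σ i A)
    (hD : ∀ A ∈ D, Known σ k A)
    (hpre : ∀ S ∈ L, ∀ i q U, Decrement i q U S → U ∈ D ∨ U ∈ L)
    (hL : L.Pairwise fun A B => ∀ k, ¬ (GT r μ).Edge k B A) :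
    (∀ i < (k : ℕ), ∀ A, Known (L.foldl (processVertex (GT r μ).m k) σ) i A) ∧
      ∀ A, A ∈ D ∨ A ∈ L → Known (L.foldl (processVertex (GT r μ).m k) σ) k A := by
  induction L generalizing σ D with
  | nil => exact ⟨h1, fun A hA => hD A (by simpa using hA)⟩
  | cons S L ih =>
    rw [List.pairwise_cons] at hL
    have h2 : ∀ i q U, Decrement i q U S → Known σ k U := by
      intro i q U hU
      rcases hpre S List.mem_cons_self i q U hU with h | h
      · exact hD U h
      · rcases List.mem_cons.1 h with rfl | h
        · exact (lt_irrefl _ hU.rank_lt).elim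
        · exact (hL.1 U h ⟨i, hU.lt⟩ ⟨q, hU⟩).elim
    have hnew := known_processVertex hμ h1 h2
    rw [List.foldl_cons]
    have := ih (processVertex (GT r μ).m k σ S) (insert S D) ?_ ?_ ?_ hL.2
    · refine ⟨this.1, fun A hA => this.2 A ?_⟩
      simp only [List.mem_cons, Set.mem_insert_iff] at hA ⊢
      tauto
    · intro i hi A p R h
      rw [processVertex_of_ne fun hc => hi.ne hc.1]
      exact h1 i hi A p R h
    · intro A hA p R h
      by_cases hAS : A = S
      · subst hAS
        exact hnew p R h
      · rw [processVertex_of_ne fun hc => hAS hc.2]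
        exact hD A (hA.resolve_left hAS) p R h
    · intro T hT i q U hU
      have := hpre T (List.mem_cons_of_mem _ hT) i q U hU
      simp only [List.mem_cons, Set.mem_insert_iff] at this ⊢
      tauto

theorem known_run (hμ : μ.colLen 0 ≤ r + 1) {L : List (Tableau r μ)} (hL : IsAdmissibleOrder L)
    {k : ℕ} (hk : k < r) (A : Tableau r μ) : Known (run (GT r μ).m L) k A := by
  have main : ∀ n ≤ r, ∀ i < n, ∀ A,
      Known (((List.finRange r).take n).foldl (processColor (GT r μ).m L) fun _ _ _ => none) i A := by
    intro n
    induction n with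
    | zero => intro _ i hi; omega
    | succ n ih =>
      intro hn i hi A
      have hlen : n < (List.finRange r).length := by rw [List.length_finRange]; omega
      rw [List.take_succ_eq_append_getElem hlen, List.foldl_append, List.foldl_cons, List.foldl_nil]
      have hget : (List.finRange r)[n] = (⟨n, hn⟩ : Fin r) := by simp
      rw [hget]
      have := known_foldl_processVertex (k := ⟨n, hn⟩) hμ L _ ∅ (ih (by omega)) (by simp)
        (fun _ _ _ _ U _ => Or.inr (hL.2.1 U)) hL.2.2
      rcases Nat.lt_succ_iff_lt_or_eq.1 hi with h | rfl
      · exact this.1 i h A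
      · exact this.2 A (Or.inr (hL.2.1 A))
  have := main r le_rfl k hk A
  rwa [List.take_of_length_le (by rw [List.length_finRange])] at this

/-- Sorting the tableaux by rank gives an admissible order. -/
theorem exists_isAdmissibleOrder : ∃ L : List (Tableau r μ), IsAdmissibleOrder L := by
  classical
  let le : Tableau r μ → Tableau r μ → Prop := fun A B => (GT r μ).rank A ≤ (GT r μ).rank B
  have : Std.Total le := ⟨fun A B => le_total _ _⟩
  have : IsTrans _ le := ⟨fun _ _ _ => le_trans⟩
  refine ⟨(Finset.univ.toList).insertionSort le, ?_, fun S => ?_, ?_⟩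
  · exact (List.perm_insertionSort le _).nodup_iff.2 (Finset.nodup_toList _)
  · rw [List.mem_insertionSort]
    simp
  · refine (List.pairwise_insertionSort le _).imp fun {A B} h k hE => ?_
    have := (GT r μ).rank_edge hE
    simp only [le] at h
    omega

end Algorithm

end GelfandTsetlin

/-! ### Chevalley generators and irreducible modules -/

namespace GelfandTsetlin

/-- The entries of the Cartan matrix of `sl_{r+1}`. -/
def cartan (i j : ℕ) : ℤ :=
  2 * (if i = j then 1 else 0) - (if i = j + 1 then 1 else 0) - if i + 1 = j then 1 else 0

section Chevalley

variable {r : ℕ}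

/-- The matrix unit `E_{i,j}`, for `i ≠ j`, as an element of `sl_{r+1}`. -/
noncomputable def unit (i j : Fin (r + 1)) (h : i ≠ j) : SL r :=
  LieAlgebra.SpecialLinear.single i j h (1 : ℂ)

theorem val_unit (i j : Fin (r + 1)) (h : i ≠ j) : (unit i j h).val = Matrix.single i j 1 := rfl

theorem val_H (i : Fin r) :
    (H i).val = Matrix.single i.castSucc i.castSucc 1 - Matrix.single i.succ i.succ 1 := rfl

theorem single_mul_single_eq {n : ℕ} (i j k l : Fin n) :
    (Matrix.single i j (1 : ℂ) * Matrix.single k l (1 : ℂ) : Matrix (Fin n) (Fin n) ℂ) =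
      if j = k then Matrix.single i l 1 else 0 := by
  split_ifs with h
  · subst h
    rw [Matrix.single_mul_single_same, mul_one]
  · rw [Matrix.single_mul_single_of_ne _ _ _ _ h]

theorem lie_unit_unit {i j l : Fin (r + 1)} (hij : i ≠ j) (hjl : j ≠ l) (hil : i ≠ l) :
    ⁅unit i j hij, unit j l hjl⁆ = unit i l hil := by
  apply Subtype.ext
  rw [LieAlgebra.SpecialLinear.sl_bracket]
  simp [val_unit, hil.symm]

theorem lie_unit_unit_symm {i j : Fin (r + 1)} (hij : i ≠ j) :
    ⁅unit i j hij, unit j i hij.symm⁆ = LieAlgebra.SpecialLinear.singleSubSingle i j (1 : ℂ) := by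
  apply Subtype.ext
  rw [LieAlgebra.SpecialLinear.sl_bracket]
  simp [val_unit]

theorem lie_X_Y (i j : Fin r) : ⁅(X i : SL r), Y j⁆ = if i = j then H i else 0 := by
  split_ifs with h
  · subst h
    exact lie_unit_unit_symm (Fin.castSucc_lt_succ (i := i)).ne
  · apply Subtype.ext
    rw [LieAlgebra.SpecialLinear.sl_bracket]
    have h' : ¬ j = i := fun h' => h h'.symm
    change Matrix.single i.castSucc i.succ (1 : ℂ) * Matrix.single j.succ j.castSucc (1 : ℂ) -
      Matrix.single j.succ j.castSucc (1 : ℂ) * Matrix.single i.castSucc i.succ (1 : ℂ) = 0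
    simp [h, h']

theorem lie_H_unit (i : Fin r) {a b : Fin (r + 1)} (hab : a ≠ b) :
    ⁅(H i : SL r), unit a b hab⁆ =
      (((if i.castSucc = a then 1 else 0) - (if i.succ = a then 1 else 0)) -
        ((if b = i.castSucc then 1 else 0) - (if b = i.succ then 1 else 0)) : ℂ) •
          unit a b hab := by
  have h1 : ∀ c : Fin (r + 1), Matrix.single c c (1 : ℂ) * Matrix.single a b (1 : ℂ) =
      (if c = a then 1 else 0 : ℂ) • Matrix.single a b (1 : ℂ) := fun c => by
    rw [single_mul_single_eq]
    split_ifs with h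
    · rw [h, one_smul]
    · rw [zero_smul]
  have h2 : ∀ c : Fin (r + 1), Matrix.single a b (1 : ℂ) * Matrix.single c c (1 : ℂ) =
      (if b = c then 1 else 0 : ℂ) • Matrix.single a b (1 : ℂ) := fun c => by
    rw [single_mul_single_eq]
    split_ifs with h
    · rw [h, one_smul]
    · rw [zero_smul]
  apply Subtype.ext
  rw [LieAlgebra.SpecialLinear.sl_bracket]
  change _ = _ • Matrix.single a b (1 : ℂ)
  rw [val_unit, val_H, sub_mul, mul_sub, h1, h1, h2, h2]
  module

theorem lie_H_X (i j : Fin r) : ⁅(H i : SL r), X j⁆ = (cartan i j : ℂ) • X j := by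
  refine (lie_H_unit i (Fin.castSucc_lt_succ (i := j)).ne).trans ?_
  change _ = _ • unit _ _ _
  congr 1
  simp only [Fin.ext_iff, Fin.val_castSucc, Fin.val_succ, cartan]
  push_cast
  split_ifs <;> first | omega | norm_num

theorem lie_H_Y (i j : Fin r) : ⁅(H i : SL r), Y j⁆ = -(cartan i j : ℂ) • Y j := by
  refine (lie_H_unit i (Fin.castSucc_lt_succ (i := j)).ne').trans ?_
  change _ = _ • unit _ _ _
  congr 1
  simp only [Fin.ext_iff, Fin.val_castSucc, Fin.val_succ, cartan]
  push_cast
  split_ifs <;> first | omega | norm_num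

theorem eq_sum_unit (x : SL r) :
    x = ∑ i, ∑ j, if h : i ≠ j then x.val i j • unit i j h else
      x.val i i • LieAlgebra.SpecialLinear.singleSubSingle i 0 (1 : ℂ) := by
  have htr : ∑ i, x.val i i = 0 := x.2
  apply Subtype.ext
  have h1 : ∀ i j : Fin (r + 1), (if h : i ≠ j then x.val i j • unit i j h else
      x.val i i • LieAlgebra.SpecialLinear.singleSubSingle i 0 (1 : ℂ) : SL r).val =
      Matrix.single i j (x.val i j) - if i = j then x.val i i • Matrix.single 0 0 (1 : ℂ) else 0 := by
    intro i j
    by_cases h : i = j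
    · subst h
      rw [dif_neg (by simp), if_pos rfl]
      change x.val i i • (Matrix.single i i (1 : ℂ) - Matrix.single 0 0 (1 : ℂ)) = _
      rw [smul_sub, Matrix.smul_single, smul_eq_mul, mul_one]
    · rw [dif_pos h, if_neg h, sub_zero]
      change x.val i j • Matrix.single i j (1 : ℂ) = _
      rw [Matrix.smul_single, smul_eq_mul, mul_one]
  have h2 : (∑ i, ∑ j, if h : i ≠ j then x.val i j • unit i j h else
      x.val i i • LieAlgebra.SpecialLinear.singleSubSingle i 0 (1 : ℂ) : SL r).val =
      ∑ i, ∑ j, (if h : i ≠ j then x.val i j • unit i j h else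
      x.val i i • LieAlgebra.SpecialLinear.singleSubSingle i 0 (1 : ℂ) : SL r).val := by
    let ψ : SL r →+ Matrix (Fin (r + 1)) (Fin (r + 1)) ℂ :=
      { toFun := Subtype.val, map_zero' := rfl, map_add' := fun _ _ => rfl }
    refine (map_sum ψ _ _).trans (Finset.sum_congr rfl fun i _ => map_sum ψ _ _)
  rw [h2]
  simp only [h1, Finset.sum_sub_distrib, Finset.sum_ite_eq, Finset.mem_univ, if_true]
  rw [← Finset.sum_smul, htr, zero_smul, sub_zero]
  exact Matrix.matrix_eq_sum_single _

/-- The Chevalley generators `X_k` and `Y_k` generate `sl_{r+1}`. -/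
theorem eq_top_of_generators_mem (L : LieSubalgebra ℂ (SL r)) (hX : ∀ k, X k ∈ L)
    (hY : ∀ k, Y k ∈ L) : L = ⊤ := by
  have base : ∀ (k : Fin r) (i j : Fin (r + 1)) (h : i ≠ j), i = k.castSucc → j = k.succ →
      unit i j h ∈ L ∧ unit j i h.symm ∈ L := by
    rintro k i j h rfl rfl
    exact ⟨hX k, hY k⟩
  have hu : ∀ n (i j : Fin (r + 1)) (h : i ≠ j), (j : ℕ) = i + n + 1 →
      unit i j h ∈ L ∧ unit j i h.symm ∈ L := by
    intro n
    induction n with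
    | zero =>
      intro i j h hj
      exact base ⟨i, by omega⟩ i j h rfl (Fin.ext (by simpa using hj))
    | succ n ih =>
      intro i j hij h
      let l : Fin (r + 1) := ⟨i + n + 1, by omega⟩
      have hl : (l : ℕ) = i + n + 1 := rfl
      have hil : i ≠ l := fun hc => by have := congrArg Fin.val hc; omega
      have hlj : l ≠ j := fun hc => by have := congrArg Fin.val hc; omega
      have h1 := ih i l hil rfl
      have h2 := base ⟨l, by omega⟩ l j hlj rfl (Fin.ext (by simp only [Fin.val_succ]; omega))
      exact ⟨lie_unit_unit hil hlj hij ▸ L.lie_mem h1.1 h2.1,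
        lie_unit_unit hlj.symm hil.symm hij.symm ▸ L.lie_mem h2.2 h1.2⟩
  have hu' : ∀ (i j : Fin (r + 1)) (h : i ≠ j), unit i j h ∈ L := by
    intro i j h
    rcases lt_or_gt_of_ne (fun hc => h (Fin.ext hc) : (i : ℕ) ≠ j) with hlt | hlt
    · exact (hu (j - i - 1) i j h (by omega)).1
    · exact (hu (i - j - 1) j i h.symm (by omega)).2
  refine eq_top_iff.2 fun x _ => ?_
  rw [eq_sum_unit x]
  refine sum_mem fun i _ => sum_mem fun j _ => ?_
  split_ifs with h
  · exact L.smul_mem _ (hu' i j h)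
  · refine L.smul_mem _ ?_
    by_cases hi : i = 0
    · subst hi
      have : (LieAlgebra.SpecialLinear.singleSubSingle 0 0 (1 : ℂ) : SL r) = 0 :=
        Subtype.ext (sub_self _)
      rw [this]
      exact L.zero_mem
    · rw [← lie_unit_unit_symm hi]
      exact L.lie_mem (hu' _ _ _) (hu' _ _ _)

end Chevalley

section Irreducible

variable {r : ℕ} {V : Type*} [AddCommGroup V] [Module ℂ V] [LieRingModule (SL r) V]
  [LieModule ℂ (SL r) V]

/-- A subspace of an irreducible module that is stable under the Chevalley generators is trivial. -/
theorem eq_bot_or_eq_top_of_stable [LieModule.IsIrreducible ℂ (SL r) V] (K : Submodule ℂ V)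
    (hX : ∀ k, ∀ v ∈ K, ⁅(X k : SL r), v⁆ ∈ K) (hY : ∀ k, ∀ v ∈ K, ⁅(Y k : SL r), v⁆ ∈ K) :
    K = ⊥ ∨ K = ⊤ := by
  let L : LieSubalgebra ℂ (SL r) :=
    { carrier := {x | ∀ v ∈ K, ⁅x, v⁆ ∈ K}
      add_mem' := fun {x y} hx hy v hv => by
        rw [add_lie]
        exact K.add_mem (hx v hv) (hy v hv)
      zero_mem' := fun v _ => by
        rw [zero_lie]
        exact K.zero_mem
      smul_mem' := fun a x hx v hv => by
        rw [smul_lie]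
        exact K.smul_mem a (hx v hv)
      lie_mem' := fun {x y} hx hy v hv => by
        rw [lie_lie]
        exact K.sub_mem (hx _ (hy v hv)) (hy _ (hx v hv)) }
  have hL : L = ⊤ := eq_top_of_generators_mem L hX hY
  let N : LieSubmodule ℂ (SL r) V :=
    { K with
      lie_mem := fun {x v} hv => (hL ▸ LieSubalgebra.mem_top x : x ∈ L) v hv }
  rcases eq_bot_or_eq_top N with h | h
  · left
    have := congrArg LieSubmodule.toSubmodule h
    simpa [N] using this
  · right
    have := congrArg LieSubmodule.toSubmodule h
    simpa [N] using this

/-- Schur's lemma, for an operator commuting with the Chevalley generators. -/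
theorem exists_eq_smul_of_commute [FiniteDimensional ℂ V] [LieModule.IsIrreducible ℂ (SL r) V]
    (φ : V →ₗ[ℂ] V) (hX : ∀ k v, φ ⁅(X k : SL r), v⁆ = ⁅(X k : SL r), φ v⁆)
    (hY : ∀ k v, φ ⁅(Y k : SL r), v⁆ = ⁅(Y k : SL r), φ v⁆) : ∃ κ : ℂ, ∀ v, φ v = κ • v := by
  have : Nontrivial V := LieModule.nontrivial_of_isIrreducible ℂ (SL r) V
  obtain ⟨κ, hκ⟩ := Module.End.exists_eigenvalue φ
  refine ⟨κ, fun v => ?_⟩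
  have stable : ∀ z : SL r, (∀ v, φ ⁅z, v⁆ = ⁅z, φ v⁆) → ∀ v ∈ Module.End.eigenspace φ κ,
      ⁅z, v⁆ ∈ Module.End.eigenspace φ κ := by
    intro z hz v hv
    rw [Module.End.mem_eigenspace_iff] at hv ⊢
    rw [hz, hv, lie_smul]
  rcases eq_bot_or_eq_top_of_stable (Module.End.eigenspace φ κ) (fun k => stable _ (hX k))
    (fun k => stable _ (hY k)) with h | h
  · exact (hκ h).elim
  · exact Module.End.mem_eigenspace_iff.1 (h ▸ Submodule.mem_top)

end Irreducible

end GelfandTsetlin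

/-! ### Representation diagrams and their matrices -/

namespace GelfandTsetlin

namespace ColoredPoset

variable {I P : Type*} (G : ColoredPoset I P)

open Classical in
/-- The matrix of the operator `v_s ↦ ∑ c_{t,s} v_t` given by the edges of color `k`. -/
noncomputable def up (c : P → P → ℂ) (k : I) : Matrix P P ℂ :=
  Matrix.of fun t s => if G.Edge k s t then c t s else 0

open Classical in
/-- The matrix of the operator `v_t ↦ ∑ d_{s,t} v_s` given by the edges of color `k`. -/
noncomputable def down (d : P → P → ℂ) (k : I) : Matrix P P ℂ :=
  Matrix.of fun s t => if G.Edge k s t then d s t else 0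

variable [Fintype P]

open Classical in
theorem up_mul_down_apply (c d : P → P → ℂ) (i j : I) (s t : P) :
    (G.up c j * G.down d i) t s = ∑ r with G.Edge i r s ∧ G.Edge j r t, d r s * c t r := by
  rw [Matrix.mul_apply, Finset.sum_filter]
  refine Finset.sum_congr rfl fun r _ => ?_
  simp only [up, down, Matrix.of_apply]
  by_cases h1 : G.Edge i r s <;> by_cases h2 : G.Edge j r t <;> simp [h1, h2, mul_comm]

open Classical in
theorem down_mul_up_apply (c d : P → P → ℂ) (i j : I) (s t : P) :
    (G.down d i * G.up c j) t s = ∑ u with G.Edge j s u ∧ G.Edge i t u, c u s * d t u := by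
  rw [Matrix.mul_apply, Finset.sum_filter]
  refine Finset.sum_congr rfl fun r _ => ?_
  simp only [up, down, Matrix.of_apply]
  by_cases h1 : G.Edge j s r <;> by_cases h2 : G.Edge i t r <;> simp [h1, h2, mul_comm]

/-- The crossing relations, the left-hand sides being compared with arbitrary weights `w`. -/
def CrossingWith (c d : P → P → ℂ) (w : I → P → ℂ) : Prop :=
  ∀ i s, (G.up c i * G.down d i) s s - (G.down d i * G.up c i) s s = w i s

theorem crossing_iff (c d : P → P → ℂ) :
    G.Crossing c d ↔ G.CrossingWith c d fun i s => (G.m i s : ℂ) := by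
  classical
  refine forall₂_congr fun i s => ?_
  rw [up_mul_down_apply, down_mul_up_apply]
  simp only [and_self]
  rw [Finset.sum_congr rfl fun r _ => mul_comm (c s r) (d r s)]

theorem CrossingWith.sum_eq_zero {G : ColoredPoset I P} {c d : P → P → ℂ} {w : I → P → ℂ}
    (h : G.CrossingWith c d w) (i : I) : ∑ s, w i s = 0 := by
  have h1 : Matrix.trace (G.up c i * G.down d i - G.down d i * G.up c i) = 0 := by
    rw [Matrix.trace_sub, Matrix.trace_mul_comm, sub_self]
  rw [← h1]
  exact Finset.sum_congr rfl fun s _ => (h i s).symm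

variable [DecidableEq P] [DecidableEq I]

/-- Crossing and diamond relations express the commutators of the operators attached to the edges. -/
theorem commutator_iff (c d : P → P → ℂ) (w : I → P → ℂ) :
    (∀ i j, G.up c j * G.down d i - G.down d i * G.up c j =
      if i = j then Matrix.diagonal (w i) else 0) ↔
    G.CrossingWith c d w ∧ G.Diamond c d := by
  classical
  constructor
  · intro h
    refine ⟨fun i s => ?_, fun i j s t hne _ => ?_⟩
    · have := congrFun (congrFun (h i i) s) s
      rwa [if_pos rfl, Matrix.diagonal_apply_eq, Matrix.sub_apply] at this
    · have := congrFun (congrFun (h i j) t) s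
      rw [Matrix.sub_apply, up_mul_down_apply, down_mul_up_apply] at this
      have h0 : (if i = j then Matrix.diagonal (w i) else 0 : Matrix P P ℂ) t s = 0 := by
        split_ifs
        · exact Matrix.diagonal_apply_ne _ hne.symm
        · rfl
      rw [h0] at this
      convert (sub_eq_zero.1 this).symm
  · rintro ⟨hc, hd⟩ i j
    ext t s
    by_cases hst : s = t
    · subst hst
      by_cases hij : i = j
      · subst hij
        rw [if_pos rfl, Matrix.diagonal_apply_eq, Matrix.sub_apply]
        exact hc i s
      · rw [if_neg hij, Matrix.sub_apply, up_mul_down_apply, down_mul_up_apply,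
          Finset.filter_false_of_mem fun r _ h => hij (G.color_unique h.1 h.2),
          Finset.filter_false_of_mem fun r _ h => hij (G.color_unique h.1 h.2).symm]
        simp
    · have h0 : (if i = j then Matrix.diagonal (w i) else 0 : Matrix P P ℂ) t s = 0 := by
        split_ifs
        · exact Matrix.diagonal_apply_ne _ (Ne.symm hst)
        · rfl
      rw [h0, Matrix.sub_apply, up_mul_down_apply, down_mul_up_apply, sub_eq_zero]
      by_cases hr : G.rank s = G.rank t
      · convert (hd i j s t hst hr).symm
      · -- vertices that form a diamond have equal rank
        rw [Finset.filter_false_of_mem fun r _ h => hr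
            ((G.rank_edge h.1).trans (G.rank_edge h.2).symm),
          Finset.filter_false_of_mem fun r _ h => hr (by
            have h1 := G.rank_edge h.1
            have h2 := G.rank_edge h.2
            omega)]
        simp

end ColoredPoset

section Diagram

variable {r : ℕ} {P : Type*} [Fintype P] {V : Type*} [AddCommGroup V] [Module ℂ V]
  [LieRingModule (SL r) V] [LieModule ℂ (SL r) V]

open Classical in
/-- In a basis on which the generators act along the edges of `G`, with weights `w`, the labels satisfy
the crossing relations for `w` and the diamond relations. -/
theorem crossingWith_and_diamond {G : ColoredPoset (Fin r) P} {c d : P → P → ℂ}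
    {w : Fin r → P → ℂ} {b : Module.Basis P ℂ V}
    (hX : ∀ k s, ⁅X k, b s⁆ = ∑ t with G.Edge k s t, c t s • b t)
    (hY : ∀ k t, ⁅Y k, b t⁆ = ∑ s with G.Edge k s t, d s t • b s)
    (hH : ∀ k s, ⁅H k, b s⁆ = w k s • b s) : G.CrossingWith c d w ∧ G.Diamond c d := by
  rw [← G.commutator_iff]
  have eX : ∀ k, LinearMap.toMatrix b b (LieModule.toEnd ℂ (SL r) V (X k)) = G.up c k := by
    intro k
    ext t s
    rw [LinearMap.toMatrix_apply, LieModule.toEnd_apply_apply, hX, map_sum, Finset.sum_filter,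
      Finsupp.finsetSum_apply, Finset.sum_eq_single t]
    · simp only [ColoredPoset.up, Matrix.of_apply]
      split_ifs <;> simp
    · intro u _ hu
      split_ifs <;> simp [hu]
    · simp
  have eY : ∀ k, LinearMap.toMatrix b b (LieModule.toEnd ℂ (SL r) V (Y k)) = G.down d k := by
    intro k
    ext t s
    rw [LinearMap.toMatrix_apply, LieModule.toEnd_apply_apply, hY, map_sum, Finset.sum_filter,
      Finsupp.finsetSum_apply, Finset.sum_eq_single t]
    · simp only [ColoredPoset.down, Matrix.of_apply]
      split_ifs <;> simp
    · intro u _ hu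
      split_ifs <;> simp [hu]
    · simp
  have eH : ∀ k, LinearMap.toMatrix b b (LieModule.toEnd ℂ (SL r) V (H k)) =
      Matrix.diagonal (w k) := by
    intro k
    ext t s
    rw [LinearMap.toMatrix_apply, LieModule.toEnd_apply_apply, hH, Matrix.diagonal_apply]
    by_cases h : t = s
    · simp [h]
    · simp [h]
  intro i j
  have hlie : LieModule.toEnd ℂ (SL r) V (X j) * LieModule.toEnd ℂ (SL r) V (Y i) -
      LieModule.toEnd ℂ (SL r) V (Y i) * LieModule.toEnd ℂ (SL r) V (X j) =
      LieModule.toEnd ℂ (SL r) V ⁅(X j : SL r), Y i⁆ :=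
    LinearMap.ext fun v => (lie_lie (X j) (Y i) v).symm
  rw [← eX, ← eY, ← LinearMap.toMatrix_mul, ← LinearMap.toMatrix_mul, ← map_sub, hlie, lie_X_Y]
  by_cases h : i = j
  · subst h
    rw [if_pos rfl, if_pos rfl, eH]
  · rw [if_neg h, if_neg fun hc => h hc.symm, map_zero, map_zero]

theorem IsRepresentationDiagram.crossing_and_diamond {G : ColoredPoset (Fin r) P}
    {c d : P → P → ℂ} {b : Module.Basis P ℂ V} (h : IsRepresentationDiagram G c d b) :
    G.Crossing c d ∧ G.Diamond c d := by
  have := crossingWith_and_diamond h.2.1 h.2.2.1 h.2.2.2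
  exact ⟨(G.crossing_iff c d).2 this.1, this.2⟩

theorem IsSupportingGraph.of_diagonallyEquivalent {G : ColoredPoset (Fin r) P}
    {b b' : Module.Basis P ℂ V} (h : IsSupportingGraph G b) (hb : DiagonallyEquivalent b b') :
    IsSupportingGraph G b' := by
  classical
  obtain ⟨c, d, hne, hX, hY, hH⟩ := h
  obtain ⟨a, ha⟩ := hb
  have ha0 : ∀ s, a s ≠ 0 := fun s h0 => b'.ne_zero s (by rw [ha, h0, zero_smul])
  refine ⟨fun t s => c t s * a s / a t, fun s t => d s t * a t / a s, ?_, ?_, ?_, ?_⟩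
  · intro k s t hst
    refine (hne k s t hst).imp (fun h => ?_) fun h => ?_
    · exact div_ne_zero (mul_ne_zero h (ha0 s)) (ha0 t)
    · exact div_ne_zero (mul_ne_zero h (ha0 t)) (ha0 s)
  · intro k s
    rw [ha, lie_smul, hX, Finset.smul_sum]
    refine Finset.sum_congr rfl fun t _ => ?_
    rw [ha, smul_smul, smul_smul, div_mul_cancel₀ _ (ha0 t), mul_comm]
  · intro k t
    rw [ha, lie_smul, hY, Finset.smul_sum]
    refine Finset.sum_congr rfl fun s _ => ?_
    rw [ha, smul_smul, smul_smul, div_mul_cancel₀ _ (ha0 s), mul_comm]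
  · intro k s
    rw [ha, lie_smul, hH, smul_comm]

end Diagram

/-! ### Bases with the same supporting graph -/

section Solitary

open Tableau

variable {r : ℕ} {μ : YoungDiagram}

/-- A function on the edges that is multiplicative around all diamonds is the coboundary of a function
on the vertices, since any two edges starting at the same vertex complete to a diamond. -/
theorem exists_potential (g : Tableau r μ → Tableau r μ → ℂ)
    (hne : ∀ k p S T, Decrement k p S T → g S T ≠ 0)
    (hg : ∀ i p j q A S T U, S ≠ T → Decrement i p A S → Decrement j q A T → Decrement j q S U →
      Decrement i p T U → g A S * g S U = g A T * g T U) :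
    ∃ a : Tableau r μ → ℂ, (∀ S, a S ≠ 0) ∧
      ∀ k p S T, Decrement k p S T → a S = g S T * a T := by
  classical
  have wf : WellFounded fun A B : Tableau r μ => (GT r μ).rank B < (GT r μ).rank A :=
    haveI : IsTrans (Tableau r μ) fun A B => (GT r μ).rank B < (GT r μ).rank A :=
      ⟨fun _ _ _ h1 h2 => lt_trans h2 h1⟩
    haveI : Std.Irrefl fun A B : Tableau r μ => (GT r μ).rank B < (GT r μ).rank A :=
      ⟨fun _ => lt_irrefl _⟩
    Finite.wellFounded_of_trans_of_irrefl _
  let F : ∀ S : Tableau r μ, (∀ T, (GT r μ).rank S < (GT r μ).rank T → ℂ) → ℂ := fun S a =>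
    if h : ∃ T k p, Decrement k p S T then
      g S h.choose * a h.choose h.choose_spec.choose_spec.choose_spec.rank_lt else 1
  let a : Tableau r μ → ℂ := wf.fix F
  have ha : ∀ S, a S = F S fun T _ => a T := fun S => wf.fix_eq F S
  have main : ∀ S, ∀ k p T, Decrement k p S T → a S = g S T * a T := by
    intro S
    induction S using wf.induction with
    | _ S ih =>
      intro k p T hT
      have hx : ∃ T k p, Decrement k p S T := ⟨T, k, p, hT⟩
      rw [ha]
      simp only [F]
      rw [dif_pos hx]
      obtain ⟨k', p', hT'⟩ := hx.choose_spec
      set T' := hx.choose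
      by_cases hTT : T' = T
      · rw [hTT]
      · obtain ⟨U, h1, h2⟩ := exists_diamond_below hT' hT hTT
        rw [ih T' hT'.rank_lt _ _ U h1, ih T hT.rank_lt _ _ U h2, ← mul_assoc, ← mul_assoc,
          hg _ _ _ _ S T' T U hTT hT' hT h1 h2]
  refine ⟨a, fun S => ?_, fun k p S T => main S k p T⟩
  induction S using wf.induction with
  | _ S ih =>
    by_cases hx : ∃ T k p, Decrement k p S T
    · obtain ⟨T, k, p, hT⟩ := hx
      rw [main S k p T hT]
      exact mul_ne_zero (hne _ _ _ _ hT) (ih T hT.rank_lt)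
    · rw [ha]
      simp only [F]
      rw [dif_neg hx]
      exact one_ne_zero

/-- The ratio of the labels of two bases is a coboundary; rescaling by the potential gives an
intertwining operator, which is a scalar. -/
theorem isSolitary (hμ : μ.colLen 0 ≤ r + 1) (V : Type*) [AddCommGroup V] [Module ℂ V]
    [LieRingModule (SL r) V] [LieModule ℂ (SL r) V] [FiniteDimensional ℂ V]
    [LieModule.IsIrreducible ℂ (SL r) V] : IsSolitary (GT r μ) V := by
  classical
  refine fun b hb b' => ⟨fun hb' => ?_, fun h => hb.of_diagonallyEquivalent h⟩
  obtain ⟨c, d, h⟩ := hb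
  obtain ⟨c', d', h'⟩ := hb'
  obtain ⟨hc, hd⟩ := h.crossing_and_diamond
  obtain ⟨hc', hd'⟩ := h'.crossing_and_diamond
  have e : ∀ {k p S R}, Decrement k p S R → c R S * d S R = (S.edgeProduct k p : ℂ) :=
    fun h => mul_eq_edgeProduct hμ hc hd h
  have e' : ∀ {k p S R}, Decrement k p S R → c' R S * d' S R = (S.edgeProduct k p : ℂ) :=
    fun h => mul_eq_edgeProduct hμ hc' hd' h
  have e0 : ∀ {k p} {S R : Tableau r μ}, Decrement k p S R → (S.edgeProduct k p : ℂ) ≠ 0 :=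
    fun h => by exact_mod_cast h.edgeProduct_pos.ne'
  have c0 : ∀ {k p S R}, Decrement k p S R → c R S ≠ 0 :=
    fun h => left_ne_zero_of_mul (e h ▸ e0 h)
  have c0' : ∀ {k p S R}, Decrement k p S R → c' R S ≠ 0 :=
    fun h => left_ne_zero_of_mul (e' h ▸ e0 h)
  obtain ⟨a, ha0, ha⟩ := exists_potential (fun S T => c T S / c' T S)
    (fun k p S T h => div_ne_zero (c0 h) (c0' h)) (by
      intro i p j q A S T U hne hAS hAT hSU hTU
      have r1 := diamond_mul hd hAS hAT hSU hTU hne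
      have r2 := diamond_mul hd' hAS hAT hSU hTU hne
      have s1 : (T.edgeProduct i p : ℂ) * (c U S * c S A) = A.edgeProduct i p * (c T A * c U T) := by
        rw [← e hTU, ← e hAS]
        linear_combination (c U T * c S A) * r1
      have s2 : (T.edgeProduct i p : ℂ) * (c' U S * c' S A) =
          A.edgeProduct i p * (c' T A * c' U T) := by
        rw [← e' hTU, ← e' hAS]
        linear_combination (c' U T * c' S A) * r2
      rw [div_mul_div_comm, div_mul_div_comm, div_eq_div_iff
        (mul_ne_zero (c0' hAS) (c0' hSU)) (mul_ne_zero (c0' hAT) (c0' hTU))]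
      refine mul_left_cancel₀ (mul_ne_zero (e0 hTU) (e0 hAS)) ?_
      linear_combination (A.edgeProduct i p : ℂ) * (c' T A * c' U T) * s1 -
        A.edgeProduct i p * (c T A * c U T) * s2)
  -- after rescaling by `a`, the two bases have equal labels
  let φ : V →ₗ[ℂ] V := b.constr ℂ fun S => a S • b' S
  have hφ : ∀ S, φ (b S) = a S • b' S := fun S => b.constr_basis ℂ _ S
  have ext : ∀ z : SL r, (∀ S, φ ⁅z, b S⁆ = ⁅z, φ (b S)⁆) → ∀ v, φ ⁅z, v⁆ = ⁅z, φ v⁆ := by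
    intro z hz v
    have : φ ∘ₗ LieModule.toEnd ℂ (SL r) V z = LieModule.toEnd ℂ (SL r) V z ∘ₗ φ :=
      b.ext fun S => hz S
    exact LinearMap.congr_fun this v
  obtain ⟨κ, hκ⟩ := exists_eq_smul_of_commute φ
    (fun k => ext _ fun S => by
      rw [h.2.1, hφ, lie_smul, h'.2.1, map_sum, Finset.smul_sum]
      refine Finset.sum_congr rfl fun T hT => ?_
      obtain ⟨-, p, hp⟩ := Finset.mem_filter.1 hT
      rw [map_smul, hφ, smul_smul, smul_smul, ha _ _ _ _ hp, div_mul_eq_mul_div,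
        div_mul_cancel₀ _ (c0' hp)])
    (fun k => ext _ fun T => by
      rw [h.2.2.1, hφ, lie_smul, h'.2.2.1, map_sum, Finset.smul_sum]
      refine Finset.sum_congr rfl fun S hS => ?_
      obtain ⟨-, p, hp⟩ := Finset.mem_filter.1 hS
      rw [map_smul, hφ, smul_smul, smul_smul, ha _ _ _ _ hp]
      congr 1
      have h1 := (e hp).trans (e' hp).symm
      have h2 := c0' hp
      field_simp
      linear_combination a T * h1)
  refine ⟨fun S => κ / a S, fun S => ?_⟩
  have := (hφ S).symm.trans (hκ (b S))
  change b' S = (κ / a S) • b S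
  rw [div_eq_inv_mul, mul_smul, ← this, smul_smul, inv_mul_cancel₀ (ha0 S), one_smul]

end Solitary

end GelfandTsetlin

/-! ### The module spanned by the tableaux -/

namespace GelfandTsetlin

namespace Tableau

variable {r : ℕ} {μ : YoungDiagram}

/-- The tableau with all entries of row `p` equal to `p`; it is the vertex of the highest weight. -/
def top (hμ : μ.colLen 0 ≤ r + 1) : Tableau r μ :=
  ⟨SemistandardYoungTableau.highestWeight μ, fun i j => by
    rw [SemistandardYoungTableau.highestWeight_apply]
    split_ifs with h
    · have h1 := YoungDiagram.mem_iff_lt_colLen.1 h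
      have h2 := μ.colLen_anti 0 j (Nat.zero_le j)
      omega
    · exact Nat.zero_le r⟩

theorem cnt_top (hμ : μ.colLen 0 ≤ r + 1) (k p : ℕ) :
    (top hμ).cnt k p = if p < k then μ.rowLen p else 0 := by
  have key : ∀ j, j < (top hμ).cnt k p ↔ j < μ.rowLen p ∧ p < k := by
    intro j
    rw [lt_cnt_iff]
    refine and_congr_right fun hj => ?_
    change SemistandardYoungTableau.highestWeight μ p j < k ↔ _
    rw [SemistandardYoungTableau.highestWeight_apply, if_pos (YoungDiagram.mem_iff_lt_rowLen.2 hj)]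
  have h0 := key 0
  have h1 := key ((top hμ).cnt k p)
  have h2 := key (μ.rowLen p)
  have h3 := (top hμ).cnt_le_rowLen k p
  split_ifs with h <;> omega

theorem m_top (hμ : μ.colLen 0 ≤ r + 1) (k : Fin r) :
    (GT r μ).m k (top hμ) = (μ.rowLen k : ℤ) - μ.rowLen (k + 1) := by
  have key : ∀ l ≤ r + 1, ∑ p ∈ Finset.range (r + 1), ((top hμ).cnt l p : ℤ) =
      ∑ p ∈ Finset.range l, (μ.rowLen p : ℤ) := by
    intro l hl
    rw [← Finset.sum_subset (Finset.range_subset_range.2 hl) fun p _ hp => by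
      rw [cnt_top, if_neg (by simpa using hp), Nat.cast_zero]]
    exact Finset.sum_congr rfl fun p hp => by rw [cnt_top, if_pos (Finset.mem_range.1 hp)]
  have hk := k.2
  rw [m_eq hμ, key _ (by omega), key _ (by omega), key _ (by omega), Finset.sum_range_succ,
    Finset.sum_range_succ, Finset.sum_range_succ]
  ring

theorem m_of_decrement (hμ : μ.colLen 0 ≤ r + 1) (i : Fin r) {j p : ℕ} {S R : Tableau r μ}
    (h : Decrement j p S R) : (GT r μ).m i R = (GT r μ).m i S + cartan i j := by
  have key : ∀ l, ∑ q ∈ Finset.range (r + 1), (R.cnt l q : ℤ) =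
      ∑ q ∈ Finset.range (r + 1), (S.cnt l q : ℤ) + if l = j + 1 then 1 else 0 := by
    intro l
    have : ∀ q ∈ Finset.range (r + 1), (R.cnt l q : ℤ) =
        S.cnt l q + if q = p then (if l = j + 1 then 1 else 0) else 0 := fun q _ => by
      rw [decrement_iff.1 h]
      push_cast
      congr 1
      split_ifs <;> first | rfl | (exfalso; tauto)
    rw [Finset.sum_congr rfl this, Finset.sum_add_distrib, Finset.sum_ite_eq', if_pos h.row_mem]
  rw [m_eq hμ, m_eq hμ, key, key, key, cartan]
  split_ifs <;> omega

/-- If no entry `1, …, k` can be decremented, the first `k` levels of the pattern are as large as the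
next level allows. -/
theorem cnt_eq_cnt_succ {S : Tableau r μ} {k : ℕ} (h : ∀ i < k, ∀ p, ¬ S.Raisable i p) :
    ∀ i < k, ∀ p ≤ i, S.cnt (i + 1) p = S.cnt (i + 2) p := by
  intro i
  induction i with
  | zero =>
    intro hi p hp
    obtain rfl : p = 0 := by omega
    have h1 : S.cnt (0 + 1) 0 ≤ S.cnt (0 + 2) 0 := S.cnt_le_succ 1 0
    by_contra hc
    exact h 0 hi 0 ⟨by omega, fun q hq => by omega⟩
  | succ i ih =>
    intro hi p hp
    have h1 : S.cnt (i + 1 + 1) p ≤ S.cnt (i + 1 + 2) p := S.cnt_le_succ (i + 2) p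
    by_contra hc
    refine h (i + 1) hi p ⟨by omega, ?_⟩
    rintro q rfl
    have h2 : S.cnt (i + 1) q = S.cnt (i + 1 + 1) q := ih (by omega) q (by omega)
    have h3 : S.cnt (i + 1 + 2) (q + 1) ≤ S.cnt (i + 1 + 1) q := S.cnt_succ_succ_le (i + 2) q
    omega

/-- Only the tableau of the highest weight has no edge leaving it. -/
theorem eq_top_of_not_decrement (hμ : μ.colLen 0 ≤ r + 1) {S : Tableau r μ}
    (h : ∀ i p R, ¬ Decrement i p S R) : S = top hμ := by
  have h' : ∀ i < r, ∀ p, ¬ S.Raisable i p := fun i hi p hr =>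
    let ⟨R, hR⟩ := (exists_decrement_iff hi).2 hr
    h i p R hR
  have flat := cnt_eq_cnt_succ h'
  have key : ∀ n l p, l + n = r + 1 → p < l → S.cnt l p = μ.rowLen p := by
    intro n
    induction n with
    | zero => intro l p hl _; exact S.cnt_eq_rowLen (by omega) p
    | succ n ih =>
      intro l p hl hp
      obtain ⟨i, rfl⟩ : ∃ i, l = i + 1 := ⟨l - 1, by omega⟩
      rw [flat i (by omega) p (by omega)]
      exact ih (i + 2) p (by omega) (by omega)
  refine ext_cnt fun l p => ?_
  rw [cnt_top]
  split_ifs with hp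
  · rcases le_total l (r + 1) with hl | hl
    · exact key (r + 1 - l) l p (by omega) hp
    · exact S.cnt_eq_rowLen hl p
  · exact S.cnt_eq_zero (by omega)

theorem not_decrement_top (hμ : μ.colLen 0 ≤ r + 1) {i p : ℕ} {R : Tableau r μ} :
    ¬ Decrement i p (top hμ) R := by
  intro h
  have h1 := decrement_iff.1 h (i + 1) p
  have h2 := h.row_le
  have h3 := R.cnt_le_rowLen (i + 1) p
  rw [cnt_top, if_pos (by omega)] at h1
  simp at h1
  omega

/-- If no entry below `k + 1` can be decremented in `S` or in `S'`, then at most one of them has an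
edge of color `k` to a given tableau. -/
theorem eq_of_decrement_of_not_raisable {k p p' : ℕ} {S S' T : Tableau r μ}
    (hS : ∀ i < k, ∀ q, ¬ S.Raisable i q) (hS' : ∀ i < k, ∀ q, ¬ S'.Raisable i q)
    (h : Decrement k p S T) (h' : Decrement k p' S' T) : S = S' := by
  have hpp : p = p' := by
    by_contra hne
    have aux : ∀ {q : ℕ}, q < k → q = p ∨ q = p' → False := by
      intro q hq hor
      obtain ⟨i, rfl⟩ : ∃ i, k = i + 1 := ⟨k - 1, by omega⟩
      have f1 := cnt_eq_cnt_succ hS i (by omega) q (by omega)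
      have f2 := cnt_eq_cnt_succ hS' i (by omega) q (by omega)
      have d1 := decrement_iff.1 h (i + 1) q
      have d2 := decrement_iff.1 h' (i + 1) q
      have d3 : T.cnt (i + 2) q = S.cnt (i + 2) q + if i + 2 = i + 1 + 1 ∧ q = p then 1 else 0 :=
        decrement_iff.1 h (i + 2) q
      have d4 : T.cnt (i + 2) q = S'.cnt (i + 2) q + if i + 2 = i + 1 + 1 ∧ q = p' then 1 else 0 :=
        decrement_iff.1 h' (i + 2) q
      rw [if_neg (by omega)] at d1 d2
      split_ifs at d3 d4 <;> omega
    have := h.row_le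
    have := h'.row_le
    rcases lt_or_gt_of_ne hne with hlt | hlt
    · exact aux (q := p) (by omega) (Or.inl rfl)
    · exact aux (q := p') (by omega) (Or.inr rfl)
  subst hpp
  exact h.left_unique h'

/-- The operator `X_k` in the Gelfand–Tsetlin module spanned by the tableaux. -/
noncomputable def opX (r : ℕ) (μ : YoungDiagram) (k : Fin r) :
    (Tableau r μ → ℂ) →ₗ[ℂ] (Tableau r μ → ℂ) :=
  ((GT r μ).up (fun t s => label s t) k).mulVecLin

/-- The operator `Y_k` in the Gelfand–Tsetlin module spanned by the tableaux. -/
noncomputable def opY (r : ℕ) (μ : YoungDiagram) (k : Fin r) :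
    (Tableau r μ → ℂ) →ₗ[ℂ] (Tableau r μ → ℂ) :=
  ((GT r μ).down (fun s t => label s t) k).mulVecLin

open Classical in
/-- The operator `H_k` in the Gelfand–Tsetlin module spanned by the tableaux. -/
noncomputable def opH (r : ℕ) (μ : YoungDiagram) (k : Fin r) :
    (Tableau r μ → ℂ) →ₗ[ℂ] (Tableau r μ → ℂ) :=
  (Matrix.diagonal fun s => ((GT r μ).m k s : ℂ)).mulVecLin

open Classical in
theorem opX_apply (k : Fin r) (x : Tableau r μ → ℂ) (t : Tableau r μ) :
    opX r μ k x t = ∑ s with (GT r μ).Edge k s t, label s t * x s := by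
  rw [Finset.sum_filter]
  refine Finset.sum_congr rfl fun s _ => ?_
  simp only [ColoredPoset.up, Matrix.of_apply]
  split_ifs <;> simp

open Classical in
theorem opY_apply (k : Fin r) (x : Tableau r μ → ℂ) (s : Tableau r μ) :
    opY r μ k x s = ∑ t with (GT r μ).Edge k s t, label s t * x t := by
  rw [Finset.sum_filter]
  refine Finset.sum_congr rfl fun s _ => ?_
  simp only [ColoredPoset.down, Matrix.of_apply]
  split_ifs <;> simp

theorem opH_apply (k : Fin r) (x : Tableau r μ → ℂ) (s : Tableau r μ) :
    opH r μ k x s = (GT r μ).m k s * x s := by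
  classical
  simp [opH, Matrix.mulVec_diagonal]

theorem opX_opY (hμ : μ.colLen 0 ≤ r + 1) (i j : Fin r) (x : Tableau r μ → ℂ) :
    opX r μ i (opY r μ j x) = opY r μ j (opX r μ i x) + if i = j then opH r μ i x else 0 := by
  classical
  have h := ((GT r μ).commutator_iff _ _ _).2
    ⟨((GT r μ).crossing_iff _ _).1 (label_crossing hμ), label_diamond⟩ j i
  rw [sub_eq_iff_eq_add'] at h
  simp only [opX, opY, Matrix.mulVecLin_apply, Matrix.mulVec_mulVec]
  rw [h, Matrix.add_mulVec]
  congr 1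
  by_cases hij : i = j
  · subst hij
    simp [opH]
  · simp [hij, Ne.symm hij]

theorem opH_opY (hμ : μ.colLen 0 ≤ r + 1) (i j : Fin r) (x : Tableau r μ → ℂ) :
    opH r μ i (opY r μ j x) = opY r μ j (opH r μ i x) - (cartan i j : ℂ) • opY r μ j x := by
  classical
  ext s
  rw [Pi.sub_apply, Pi.smul_apply, opH_apply, opY_apply, opY_apply, smul_eq_mul, Finset.mul_sum,
    Finset.mul_sum, ← Finset.sum_sub_distrib]
  refine Finset.sum_congr rfl fun t ht => ?_
  obtain ⟨-, p, hp⟩ := Finset.mem_filter.1 ht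
  rw [opH_apply, m_of_decrement hμ i hp]
  push_cast
  ring

theorem opY_dotProduct (k : Fin r) (x y : Tableau r μ → ℂ) :
    opY r μ k x ⬝ᵥ y = x ⬝ᵥ opX r μ k y := by
  classical
  have h : ((GT r μ).up (fun t s => label s t) k).transpose =
      (GT r μ).down (fun s t => label s t) k := rfl
  simp only [opX, opY, Matrix.mulVecLin_apply]
  rw [← h, Matrix.mulVec_transpose, Matrix.dotProduct_mulVec]

/-- A vector killed by all `X_k` is a multiple of the highest weight vector: by induction on the color
`k`, no edge of color `k` starts at a vertex `S` in its support. For if `S → R` were such an edge, it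
would be the only one of color `k` from the support to `R`, so nothing could cancel the contribution of
`S` to the coordinate `R` of the image under `X_k`. -/
theorem eq_zero_of_opX_eq_zero (hμ : μ.colLen 0 ≤ r + 1) {x : Tableau r μ → ℂ}
    (hx : ∀ k, opX r μ k x = 0) {S : Tableau r μ} (hS : S ≠ top hμ) : x S = 0 := by
  classical
  have main : ∀ k, ∀ S, x S ≠ 0 → ∀ i < k, ∀ p R, ¬ Decrement i p S R := by
    intro k
    induction k with
    | zero => intro S _ i hi; omega
    | succ k ih =>
      intro S hS i hi p R hR
      rcases Nat.lt_succ_iff_lt_or_eq.1 hi with hik | rfl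
      · exact ih S hS i hik p R hR
      have noraise : ∀ {S}, x S ≠ 0 → ∀ l < i, ∀ q, ¬ S.Raisable l q := by
        intro S hS l hl q hq
        obtain ⟨R', hR'⟩ := (exists_decrement_iff (hl.trans hR.lt)).2 hq
        exact ih S hS l hl q R' hR'
      have h0 := congrFun (hx ⟨i, hR.lt⟩) R
      rw [opX_apply, Finset.sum_eq_single_of_mem S
        (Finset.mem_filter.2 ⟨Finset.mem_univ _, p, hR⟩)] at h0
      · exact mul_ne_zero (label_ne_zero hR) hS h0
      · intro S' hS' hne
        obtain ⟨-, p', hp'⟩ := Finset.mem_filter.1 hS'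
        by_contra hc
        have hx' : x S' ≠ 0 := right_ne_zero_of_mul hc
        exact hne (eq_of_decrement_of_not_raisable (noraise hx') (noraise hS) hp' hR)
  by_contra hne
  exact hS (eq_top_of_not_decrement hμ fun i p R hR => main r S hne i hR.lt p R hR)

open Classical in
/-- A nonzero subspace that is stable under all `X_k` contains the highest weight vector. -/
theorem single_top_mem (hμ : μ.colLen 0 ≤ r + 1) (M : Submodule ℂ (Tableau r μ → ℂ))
    (hM : ∀ k, ∀ x ∈ M, opX r μ k x ∈ M) (hne : M ≠ ⊥) : Pi.single (top hμ) 1 ∈ M := by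
  have hkill : ∃ x ∈ M, x ≠ 0 ∧ ∀ k, opX r μ k x = 0 := by
    by_contra hc
    push Not at hc
    obtain ⟨B, hB⟩ := (Set.finite_range (GT r μ).rank).bddBelow
    obtain ⟨A, hA⟩ := (Set.finite_range (GT r μ).rank).bddAbove
    -- applying operators `X_k` over and over again raises the rank without bound
    have main : ∀ n : ℕ, ∃ x ∈ M, x ≠ 0 ∧ ∀ S, x S ≠ 0 → B + n ≤ (GT r μ).rank S := by
      intro n
      induction n with
      | zero =>
        obtain ⟨x, hx, hx0⟩ := (Submodule.ne_bot_iff M).1 hne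
        exact ⟨x, hx, hx0, fun S _ => by simpa using hB ⟨S, rfl⟩⟩
      | succ n ih =>
        obtain ⟨x, hx, hx0, h⟩ := ih
        obtain ⟨k, hk⟩ := hc x hx hx0
        refine ⟨_, hM k x hx, hk, fun T hT => ?_⟩
        rw [opX_apply] at hT
        obtain ⟨S, hS, hS0⟩ := Finset.exists_ne_zero_of_sum_ne_zero hT
        have h1 := (GT r μ).rank_edge (Finset.mem_filter.1 hS).2
        have h2 := h S (right_ne_zero_of_mul hS0)
        push_cast
        omega
    obtain ⟨x, -, hx0, hx⟩ := main (A - B + 1).toNat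
    obtain ⟨S, hS⟩ := Function.ne_iff.1 hx0
    have h1 := hx S hS
    have h2 := hA ⟨S, rfl⟩
    have h3 := hB ⟨S, rfl⟩
    omega
  obtain ⟨x, hx, hx0, hk⟩ := hkill
  have hsingle : x = x (top hμ) • Pi.single (top hμ) 1 := by
    ext S
    by_cases hS : S = top hμ
    · subst hS
      simp
    · simp [hS, eq_zero_of_opX_eq_zero hμ hk hS]
  have h0 : x (top hμ) ≠ 0 := fun h0 => hx0 (by rw [hsingle, h0, zero_smul])
  have := M.smul_mem (x (top hμ))⁻¹ hx
  rwa [hsingle, smul_smul, Pi.smul_apply, Pi.single_eq_same, smul_eq_mul, mul_one,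
    inv_mul_cancel₀ h0, one_smul] at this

/-- The Gelfand–Tsetlin module is irreducible: the orthogonal complement of a stable subspace is
stable, and both would contain the highest weight vector. -/
theorem eq_top_of_stable (hμ : μ.colLen 0 ≤ r + 1) (M : Submodule ℂ (Tableau r μ → ℂ))
    (hX : ∀ k, ∀ x ∈ M, opX r μ k x ∈ M) (hY : ∀ k, ∀ x ∈ M, opY r μ k x ∈ M) (hne : M ≠ ⊥) :
    M = ⊤ := by
  classical
  by_contra htop
  let N : Submodule ℂ (Tableau r μ → ℂ) :=
    { carrier := {y | ∀ x ∈ M, x ⬝ᵥ y = 0}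
      add_mem' := fun {a b} ha hb x hx => by rw [dotProduct_add, ha x hx, hb x hx, add_zero]
      zero_mem' := fun x _ => dotProduct_zero x
      smul_mem' := fun a y hy x hx => by rw [dotProduct_smul, hy x hx, smul_zero] }
  have hN : N ≠ ⊥ := by
    obtain ⟨f, hf, hfM⟩ := Submodule.exists_le_ker_of_lt_top M (lt_top_iff_ne_top.2 htop)
    have hrep : ∀ x : Tableau r μ → ℂ, f x = x ⬝ᵥ fun s => f (Pi.single s 1) := by
      intro x
      conv_lhs => rw [pi_eq_sum_univ' x]
      rw [map_sum]
      refine Finset.sum_congr rfl fun s _ => ?_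
      rw [map_smul, smul_eq_mul]
    refine (Submodule.ne_bot_iff N).2 ⟨fun s => f (Pi.single s 1), fun x hx => ?_, fun h0 => hf ?_⟩
    · rw [← hrep]
      exact hfM hx
    · refine LinearMap.ext fun x => ?_
      rw [hrep, h0, dotProduct_zero, LinearMap.zero_apply]
  have h1 := single_top_mem hμ M hX hne
  have h2 := single_top_mem hμ N (fun k y hy x hx => by
    rw [← opY_dotProduct]
    exact hy _ (hY k x hx)) hN
  have := h2 _ h1
  simp at this

theorem opX_single_top (hμ : μ.colLen 0 ≤ r + 1) [DecidableEq (Tableau r μ)] (k : Fin r) :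
    opX r μ k (Pi.single (top hμ) 1) = 0 := by
  classical
  ext t
  rw [opX_apply]
  refine Finset.sum_eq_zero fun s hs => ?_
  obtain ⟨-, p, hp⟩ := Finset.mem_filter.1 hs
  have : s ≠ top hμ := fun h => not_decrement_top hμ (h ▸ hp)
  rw [Pi.single_eq_of_ne this, mul_zero]

theorem opY_apply_top (hμ : μ.colLen 0 ≤ r + 1) (k : Fin r) (x : Tableau r μ → ℂ) :
    opY r μ k x (top hμ) = 0 := by
  classical
  rw [opY_apply]
  refine Finset.sum_eq_zero fun t ht => ?_
  obtain ⟨-, p, hp⟩ := Finset.mem_filter.1 ht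
  exact (not_decrement_top hμ hp).elim

theorem opH_single (k : Fin r) [DecidableEq (Tableau r μ)] (S : Tableau r μ) :
    opH r μ k (Pi.single S 1) = ((GT r μ).m k S : ℂ) • Pi.single S 1 := by
  ext t
  rw [opH_apply, Pi.smul_apply, smul_eq_mul]
  by_cases h : t = S
  · rw [h]
  · rw [Pi.single_eq_of_ne h, mul_zero, mul_zero]

open Classical in
theorem opX_single (k : Fin r) (S : Tableau r μ) :
    opX r μ k (Pi.single S 1) =
      ∑ t with (GT r μ).Edge k S t, label S t • (Pi.single t 1 : Tableau r μ → ℂ) := by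
  ext t
  rw [opX_apply, Finset.sum_filter, Finset.sum_filter, Finset.sum_apply,
    Finset.sum_eq_single S, Finset.sum_eq_single t]
  · split_ifs <;> simp
  · intro u _ hu
    split_ifs <;> simp [Ne.symm hu]
  · simp
  · intro u _ hu
    split_ifs <;> simp [hu]
  · simp

open Classical in
theorem opY_single (k : Fin r) (T : Tableau r μ) :
    opY r μ k (Pi.single T 1) =
      ∑ s with (GT r μ).Edge k s T, label s T • (Pi.single s 1 : Tableau r μ → ℂ) := by
  ext s
  rw [opY_apply, Finset.sum_filter, Finset.sum_filter, Finset.sum_apply,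
    Finset.sum_eq_single T, Finset.sum_eq_single s]
  · split_ifs <;> simp
  · intro u _ hu
    split_ifs <;> simp [Ne.symm hu]
  · simp
  · intro u _ hu
    split_ifs <;> simp [hu]
  · simp

end Tableau

end GelfandTsetlin

/-! ### Realisation in an irreducible module -/

namespace GelfandTsetlin

/-- The coefficients of half the sum of the positive coroots of `sl_{r+1}` in terms of the `H_k`. Every
simple root takes the value one on it. -/
theorem sum_mul_cartan (r : ℕ) (j : Fin r) :
    ∑ k : Fin r, (((k : ℕ) + 1) * ((r : ℂ) - (k : ℕ)) / 2) * (cartan k j : ℂ) = 1 := by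
  rw [Fin.sum_univ_eq_sum_range
    (fun k => (((k : ℕ) + 1) * ((r : ℂ) - (k : ℕ)) / 2) * (cartan k j : ℂ)) r]
  have hj := j.2
  generalize (j : ℕ) = j at hj
  set h : ℕ → ℂ := fun k => ((k : ℕ) + 1) * ((r : ℂ) - (k : ℕ)) / 2 with hh
  have e : ∀ k ∈ Finset.range r, h k * (cartan k j : ℂ) =
      (if k = j then 2 * h k else 0) - (if k = j + 1 then h k else 0) -
        (if k + 1 = j then h k else 0) := by
    intro k _
    rw [cartan]
    push_cast
    split_ifs <;> ring
  rw [Finset.sum_congr rfl e, Finset.sum_sub_distrib, Finset.sum_sub_distrib, Finset.sum_ite_eq',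
    Finset.sum_ite_eq', if_pos (Finset.mem_range.2 hj)]
  have e1 : (if j + 1 ∈ Finset.range r then h (j + 1) else 0) = h (j + 1) := by
    split_ifs with h1
    · rfl
    · have : r = j + 1 := by
        rw [Finset.mem_range] at h1
        omega
      simp [hh, this]
  have e2 : (∑ k ∈ Finset.range r, if k + 1 = j then h k else 0) = (j : ℂ) * (r - j + 1) / 2 := by
    rcases j with _ | j
    · simp
    · simp only [Nat.add_right_cancel_iff]
      rw [Finset.sum_ite_eq', if_pos (Finset.mem_range.2 (by omega))]
      simp only [hh]
      push_cast
      ring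
  rw [e1, e2]
  simp only [hh]
  push_cast
  ring

section Cyclic

variable {ι E : Type*} [AddCommGroup E] [Module ℂ E]

/-- The smallest subspace that contains `e` and is stable under all operators `Y k`. -/
def cyclic (Y : ι → E →ₗ[ℂ] E) (e : E) : Submodule ℂ E :=
  sInf {K | e ∈ K ∧ ∀ k, ∀ z ∈ K, Y k z ∈ K}

theorem mem_cyclic_self (Y : ι → E →ₗ[ℂ] E) (e : E) : e ∈ cyclic Y e :=
  (Submodule.mem_sInf).2 fun _ hK => hK.1

theorem map_mem_cyclic {Y : ι → E →ₗ[ℂ] E} {e z : E} (k : ι) (hz : z ∈ cyclic Y e) :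
    Y k z ∈ cyclic Y e :=
  (Submodule.mem_sInf).2 fun K hK => hK.2 k z (Submodule.mem_sInf.1 hz K hK)

theorem cyclic_le {Y : ι → E →ₗ[ℂ] E} {e : E} {K : Submodule ℂ E} (he : e ∈ K)
    (hK : ∀ k, ∀ z ∈ K, Y k z ∈ K) : cyclic Y e ≤ K :=
  sInf_le ⟨he, hK⟩

/-- The subspace generated from a highest weight vector by the operators `Y k` is also stable under
the operators `H k` and `X k`; the Serre relations are not needed for this. -/
theorem cyclic_stable [DecidableEq ι] {X Y H : ι → E →ₗ[ℂ] E} {e : E} (a : ι → ι → ℂ) (χ : ι → ℂ)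
    (hXY : ∀ i j z, X i (Y j z) = Y j (X i z) + if i = j then H i z else 0)
    (hHY : ∀ i j z, H i (Y j z) = Y j (H i z) - a i j • Y j z)
    (hX : ∀ i, X i e = 0) (hH : ∀ i, H i e = χ i • e) {z : E} (hz : z ∈ cyclic Y e) (i : ι) :
    X i z ∈ cyclic Y e ∧ H i z ∈ cyclic Y e := by
  have h1 : cyclic Y e ≤ cyclic Y e ⊓ ⨅ i, (cyclic Y e).comap (H i) := by
    refine cyclic_le ⟨mem_cyclic_self Y e, ?_⟩ fun k z hz => ⟨map_mem_cyclic k hz.1, ?_⟩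
    · refine (Submodule.mem_iInf _).2 fun i => ?_
      rw [Submodule.mem_comap, hH]
      exact Submodule.smul_mem _ _ (mem_cyclic_self Y e)
    · refine (Submodule.mem_iInf _).2 fun i => ?_
      have := (Submodule.mem_iInf _).1 hz.2 i
      rw [Submodule.mem_comap] at this ⊢
      rw [hHY]
      exact Submodule.sub_mem _ (map_mem_cyclic k this)
        (Submodule.smul_mem _ _ (map_mem_cyclic k hz.1))
  have hHz : ∀ z ∈ cyclic Y e, ∀ i, H i z ∈ cyclic Y e := fun z hz i =>
    (Submodule.mem_iInf _).1 (h1 hz).2 i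
  have h2 : cyclic Y e ≤ cyclic Y e ⊓ ⨅ i, (cyclic Y e).comap (X i) := by
    refine cyclic_le ⟨mem_cyclic_self Y e, ?_⟩ fun k z hz => ⟨map_mem_cyclic k hz.1, ?_⟩
    · refine (Submodule.mem_iInf _).2 fun i => ?_
      rw [Submodule.mem_comap, hX]
      exact Submodule.zero_mem _
    · refine (Submodule.mem_iInf _).2 fun i => ?_
      have := (Submodule.mem_iInf _).1 hz.2 i
      rw [Submodule.mem_comap] at this ⊢
      rw [hXY]
      refine Submodule.add_mem _ (map_mem_cyclic k this) ?_
      split_ifs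
      · exact hHz z hz.1 i
      · exact Submodule.zero_mem _
  exact ⟨(Submodule.mem_iInf _).1 (h2 hz).2 i, hHz z hz i⟩

end Cyclic

open Tableau

section Existence

variable {r : ℕ} {μ : YoungDiagram} {V : Type*} [AddCommGroup V] [Module ℂ V]
  [LieRingModule (SL r) V] [LieModule ℂ (SL r) V]

/-- A highest weight vector does not occur among the lower weights: there is a subspace that is stable
under the `Y_k`, contains all `Y_k v`, but not `v`. -/
theorem exists_lower (v : V) (hv : v ≠ 0) (χ : Fin r → ℂ) (hH : ∀ k, ⁅(H k : SL r), v⁆ = χ k • v) :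
    ∃ K : Submodule ℂ V, v ∉ K ∧ (∀ k, ⁅(Y k : SL r), v⁆ ∈ K) ∧
      ∀ k, ∀ z ∈ K, ⁅(Y k : SL r), z⁆ ∈ K := by
  -- the half sum of the positive coroots is a grading element: it lowers degrees by one along `Y_k`
  let h : Fin r → ℂ := fun k => ((k : ℕ) + 1) * ((r : ℂ) - (k : ℕ)) / 2
  let D : Module.End ℂ V := ∑ k, h k • LieModule.toEnd ℂ (SL r) V (H k)
  have hD : ∀ z, D z = ∑ k, h k • ⁅(H k : SL r), z⁆ := fun z => by
    simp [D, LinearMap.sum_apply]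
  have hDY : ∀ j z, D ⁅(Y j : SL r), z⁆ = ⁅(Y j : SL r), D z⁆ - ⁅(Y j : SL r), z⁆ := by
    intro j z
    have e : ∀ k, h k • ⁅(H k : SL r), ⁅(Y j : SL r), z⁆⁆ =
        ⁅(Y j : SL r), h k • ⁅(H k : SL r), z⁆⁆ - (h k * (cartan k j : ℂ)) • ⁅(Y j : SL r), z⁆ := by
      intro k
      rw [leibniz_lie, lie_H_Y, smul_lie, lie_smul]
      module
    rw [hD, hD, Finset.sum_congr rfl fun k _ => e k, Finset.sum_sub_distrib, ← Finset.sum_smul,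
      sum_mul_cartan, one_smul, lie_sum]
  set θ : ℂ := ∑ k, h k * χ k with hθ
  have hDv : D v = θ • v := by
    rw [hD, hθ, Finset.sum_smul]
    exact Finset.sum_congr rfl fun k _ => by rw [hH, smul_smul]
  have shift : ∀ {ξ : ℂ} {z : V} (j : Fin r), z ∈ Module.End.eigenspace D ξ →
      ⁅(Y j : SL r), z⁆ ∈ Module.End.eigenspace D (ξ - 1) := by
    intro ξ z j hz
    rw [Module.End.mem_eigenspace_iff] at hz ⊢
    rw [hDY, hz, lie_smul, sub_smul, one_smul]
  refine ⟨⨆ n : ℕ, Module.End.eigenspace D (θ - (n + 1)), fun hmem => hv ?_, fun k => ?_,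
    fun k z hz => ?_⟩
  · have hind := Module.End.eigenspaces_iSupIndep D θ
    refine Submodule.disjoint_def.1 hind v (Module.End.mem_eigenspace_iff.2 hDv) ?_
    refine (iSup_le fun n => ?_ : (⨆ n : ℕ, Module.End.eigenspace D (θ - (n + 1))) ≤ _) hmem
    have hne : θ - ((n : ℂ) + 1) ≠ θ := by
      intro hc
      have : (n : ℂ) + 1 = 0 := by linear_combination -hc
      exact Nat.cast_add_one_ne_zero n this
    exact le_iSup₂_of_le (θ - ((n : ℂ) + 1)) hne le_rfl
  · refine Submodule.mem_iSup_of_mem 0 ?_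
    have := shift k (Module.End.mem_eigenspace_iff.2 hDv)
    simpa using this
  · induction hz using Submodule.iSup_induction' with
    | mem n z hz =>
      refine Submodule.mem_iSup_of_mem (n + 1) ?_
      have := shift k hz
      push_cast
      rwa [sub_sub] at this
    | zero => rw [lie_zero]; exact Submodule.zero_mem _
    | add z w _ _ hz hw => rw [lie_add]; exact Submodule.add_mem _ hz hw

/-- The irreducible module with highest weight `μ` is isomorphic to the Gelfand–Tsetlin module. The
isomorphism has as graph the subspace of the product generated from the pair of highest weight
vectors. -/
theorem exists_equiv (hμ : μ.colLen 0 ≤ r + 1) [LieModule.IsIrreducible ℂ (SL r) V] (v : V)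
    (hv : v ≠ 0) (hXv : ∀ k, ⁅(X k : SL r), v⁆ = 0)
    (hHv : ∀ k, ⁅(H k : SL r), v⁆ = ((GT r μ).m k (top hμ) : ℂ) • v) :
    ∃ e : (Tableau r μ → ℂ) ≃ₗ[ℂ] V, ∀ k x, ⁅(X k : SL r), e x⁆ = e (opX r μ k x) ∧
      ⁅(Y k : SL r), e x⁆ = e (opY r μ k x) ∧ ⁅(H k : SL r), e x⁆ = e (opH r μ k x) := by
  classical
  let W := Tableau r μ → ℂ
  let w : W := Pi.single (top hμ) 1
  have hw0 : w ≠ 0 := fun h =>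
    one_ne_zero ((Pi.single_eq_same (M := fun _ => ℂ) (top hμ) 1).symm.trans (congrFun h (top hμ)))
  let eX : Fin r → (V × W) →ₗ[ℂ] (V × W) := fun k =>
    (LieModule.toEnd ℂ (SL r) V (X k)).prodMap (opX r μ k)
  let eY : Fin r → (V × W) →ₗ[ℂ] (V × W) := fun k =>
    (LieModule.toEnd ℂ (SL r) V (Y k)).prodMap (opY r μ k)
  let eH : Fin r → (V × W) →ₗ[ℂ] (V × W) := fun k =>
    (LieModule.toEnd ℂ (SL r) V (H k)).prodMap (opH r μ k)
  let N := cyclic eY (v, w)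
  have hN : (v, w) ∈ N := mem_cyclic_self eY (v, w)
  have hNY : ∀ k {x y}, (x, y) ∈ N → (⁅(Y k : SL r), x⁆, opY r μ k y) ∈ N := fun k x y h =>
    map_mem_cyclic k h
  have stable := fun {z : V × W} (hz : z ∈ N) (i : Fin r) =>
    cyclic_stable (X := eX) (Y := eY) (H := eH) (e := (v, w)) (fun i j => (cartan i j : ℂ))
      (fun i => ((GT r μ).m i (top hμ) : ℂ))
      (fun i j z => by
        refine Prod.ext ?_ ?_
        · change ⁅(X i : SL r), ⁅(Y j : SL r), z.1⁆⁆ = _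
          rw [leibniz_lie, lie_X_Y, add_comm]
          by_cases hij : i = j
          · simp [hij, eX, eY, eH]
          · simp [hij, eX, eY]
        · change opX r μ i (opY r μ j z.2) = _
          rw [opX_opY hμ]
          by_cases hij : i = j
          · simp [hij, eX, eY, eH]
          · simp [hij, eX, eY])
      (fun i j z => by
        refine Prod.ext ?_ ?_
        · change ⁅(H i : SL r), ⁅(Y j : SL r), z.1⁆⁆ = ⁅(Y j : SL r), ⁅(H i : SL r), z.1⁆⁆ -
            (cartan i j : ℂ) • ⁅(Y j : SL r), z.1⁆
          rw [leibniz_lie, lie_H_Y, smul_lie, neg_smul, neg_add_eq_sub]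
        · exact opH_opY hμ i j z.2)
      (fun i => Prod.ext (hXv i) (opX_single_top hμ i))
      (fun i => Prod.ext (hHv i) (opH_single i (top hμ))) hz i
  have hNX : ∀ k {x y}, (x, y) ∈ N → (⁅(X k : SL r), x⁆, opX r μ k y) ∈ N := fun k x y h =>
    (stable h k).1
  have hNH : ∀ k {x y}, (x, y) ∈ N → (⁅(H k : SL r), x⁆, opH r μ k y) ∈ N := fun k x y h =>
    (stable h k).2
  -- modulo lower weights, every element of `N` is a multiple of `(v, w)`
  have hnot : ((0 : V), w) ∉ N := by
    obtain ⟨K, hK, hYv, hYK⟩ := exists_lower v hv _ hHv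
    let T : Submodule ℂ (V × W) := K.comap (LinearMap.fst ℂ V W -
      (LinearMap.toSpanSingleton ℂ V v ∘ₗ LinearMap.proj (top hμ)) ∘ₗ LinearMap.snd ℂ V W)
    have hT : ∀ x y, (x, y) ∈ T ↔ x - y (top hμ) • v ∈ K := fun x y => Iff.rfl
    have hle : N ≤ T := by
      refine cyclic_le ((hT _ _).2 (by simp [w])) ?_
      rintro k ⟨x, y⟩ hxy
      rw [hT] at hxy
      refine (hT ⁅(Y k : SL r), x⁆ (opY r μ k y)).2 ?_
      rw [opY_apply_top hμ, zero_smul, sub_zero]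
      have h1 := hYK k _ hxy
      rw [lie_sub, lie_smul] at h1
      have := K.add_mem h1 (K.smul_mem (y (top hμ)) (hYv k))
      rwa [sub_add_cancel] at this
    intro h0
    have := (hT _ _).1 (hle h0)
    simp only [w, Pi.single_eq_same, one_smul, zero_sub, neg_mem_iff] at this
    exact hK this
  have hker1 : ∀ y, ((0 : V), y) ∈ N → y = 0 := by
    let M : Submodule ℂ W := N.comap (LinearMap.inr ℂ V W)
    have hM : ∀ y, y ∈ M ↔ ((0 : V), y) ∈ N := fun y => Iff.rfl
    have : M = ⊥ := by
      by_contra hne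
      refine hnot ((hM w).1 (single_top_mem hμ M (fun k y hy => ?_) hne))
      have := hNX k ((hM y).1 hy)
      rw [lie_zero] at this
      exact this
    intro y hy
    have hy' : y ∈ M := hy
    rw [this] at hy'
    exact (Submodule.mem_bot ℂ).1 hy'
  have hker2 : ∀ x, (x, (0 : W)) ∈ N → x = 0 := by
    let M : Submodule ℂ V := N.comap (LinearMap.inl ℂ V W)
    have hM : ∀ x, x ∈ M ↔ (x, (0 : W)) ∈ N := fun y => Iff.rfl
    rcases eq_bot_or_eq_top_of_stable M
      (fun k x hx => by
        have := hNX k ((hM x).1 hx)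
        rw [map_zero] at this
        exact this)
      (fun k x hx => by
        have := hNY k ((hM x).1 hx)
        rw [map_zero] at this
        exact this) with h | h
    · intro x hx
      have hx' : x ∈ M := hx
      rw [h] at hx'
      exact (Submodule.mem_bot ℂ).1 hx'
    · refine (hnot ?_).elim
      have hvM : (v, (0 : W)) ∈ N := (hM v).1 (h ▸ Submodule.mem_top)
      simpa using N.sub_mem hN hvM
  have hsurj1 : ∀ x, ∃ y, (x, y) ∈ N := by
    let M : Submodule ℂ V := N.map (LinearMap.fst ℂ V W)
    have hM : ∀ x, x ∈ M ↔ ∃ y, (x, y) ∈ N := fun x => by simp [M]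
    rcases eq_bot_or_eq_top_of_stable M
      (fun k x hx => by
        obtain ⟨y, hy⟩ := (hM x).1 hx
        exact (hM _).2 ⟨_, hNX k hy⟩)
      (fun k x hx => by
        obtain ⟨y, hy⟩ := (hM x).1 hx
        exact (hM _).2 ⟨_, hNY k hy⟩) with h | h
    · have : v ∈ M := (hM v).2 ⟨w, hN⟩
      rw [h] at this
      exact (hv ((Submodule.mem_bot ℂ).1 this)).elim
    · exact fun x => (hM x).1 (h ▸ Submodule.mem_top)
  have hsurj2 : ∀ y, ∃ x, (x, y) ∈ N := by
    let M : Submodule ℂ W := N.map (LinearMap.snd ℂ V W)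
    have hM : ∀ y, y ∈ M ↔ ∃ x, (x, y) ∈ N := fun x => by simp [M]
    have : M = ⊤ := by
      refine eq_top_of_stable hμ M (fun k y hy => ?_) (fun k y hy => ?_) ?_
      · obtain ⟨x, hx⟩ := (hM y).1 hy
        exact (hM _).2 ⟨_, hNX k hx⟩
      · obtain ⟨x, hx⟩ := (hM y).1 hy
        exact (hM _).2 ⟨_, hNY k hx⟩
      · exact (Submodule.ne_bot_iff M).2 ⟨w, (hM w).2 ⟨v, hN⟩, hw0⟩
    exact fun y => (hM y).1 (this ▸ Submodule.mem_top)
  have bij1 : Function.Bijective (LinearMap.fst ℂ V W ∘ₗ N.subtype) := by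
    refine ⟨(injective_iff_map_eq_zero _).2 ?_, fun x => ?_⟩
    · rintro ⟨⟨x, y⟩, hxy⟩ h0
      obtain rfl : x = 0 := h0
      obtain rfl := hker1 y hxy
      rfl
    · obtain ⟨y, hy⟩ := hsurj1 x
      exact ⟨⟨_, hy⟩, rfl⟩
  have bij2 : Function.Bijective (LinearMap.snd ℂ V W ∘ₗ N.subtype) := by
    refine ⟨(injective_iff_map_eq_zero _).2 ?_, fun y => ?_⟩
    · rintro ⟨⟨x, y⟩, hxy⟩ h0
      obtain rfl : y = 0 := h0
      obtain rfl := hker2 x hxy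
      rfl
    · obtain ⟨x, hx⟩ := hsurj2 y
      exact ⟨⟨_, hx⟩, rfl⟩
  let e1 := LinearEquiv.ofBijective _ bij1
  let e2 := LinearEquiv.ofBijective _ bij2
  have graph : ∀ {x y}, (x, y) ∈ N → (e2.symm.trans e1) y = x := by
    intro x y h
    have : e2 ⟨(x, y), h⟩ = y := rfl
    rw [LinearEquiv.trans_apply, ← this, LinearEquiv.symm_apply_apply]
    rfl
  have hmem : ∀ y, ((e2.symm.trans e1) y, y) ∈ N := by
    intro y
    obtain ⟨x, hx⟩ := hsurj2 y
    rw [graph hx]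
    exact hx
  exact ⟨e2.symm.trans e1, fun k y => ⟨(graph (hNX k (hmem y))).symm,
    (graph (hNY k (hmem y))).symm, (graph (hNH k (hmem y))).symm⟩⟩

theorem exists_isSupportingGraph (hμ : μ.colLen 0 ≤ r + 1) [LieModule.IsIrreducible ℂ (SL r) V]
    (v : V) (hv : v ≠ 0) (hXv : ∀ k, ⁅(X k : SL r), v⁆ = 0)
    (hHv : ∀ k, ⁅(H k : SL r), v⁆ = ((GT r μ).m k (top hμ) : ℂ) • v) :
    ∃ b : Module.Basis (Tableau r μ) ℂ V, IsSupportingGraph (GT r μ) b := by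
  classical
  obtain ⟨e, he⟩ := exists_equiv hμ v hv hXv hHv
  have hb : ∀ S, (Pi.basisFun ℂ (Tableau r μ)).map e S = e (Pi.single S 1) := fun S => by
    rw [Module.Basis.map_apply, Pi.basisFun_apply]
  refine ⟨(Pi.basisFun ℂ (Tableau r μ)).map e, fun t s => label s t, fun s t => label s t,
    ?_, ?_, ?_, ?_⟩
  · rintro k S T ⟨p, hp⟩
    exact Or.inl (label_ne_zero hp)
  · intro k S
    rw [hb, (he k _).1, opX_single, map_sum]
    exact Finset.sum_congr rfl fun T _ => by rw [map_smul, hb]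
  · intro k T
    rw [hb, (he k _).2.1, opY_single, map_sum]
    exact Finset.sum_congr rfl fun T _ => by rw [map_smul, hb]
  · intro k S
    rw [hb, (he k _).2.2, opH_single, map_smul]

/-- A proper subgraph cannot support a basis: it has all the vertices by dimension, its weights are
those of the whole graph by Schur's lemma and since traces vanish, and by the uniqueness of edge
products no edge can be missing. -/
theorem isEdgeMinimal (hμ : μ.colLen 0 ≤ r + 1) [FiniteDimensional ℂ V]
    [LieModule.IsIrreducible ℂ (SL r) V]
    (hex : ∃ b : Module.Basis (Tableau r μ) ℂ V, IsSupportingGraph (GT r μ) b) :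
    IsEdgeMinimal (GT r μ) V := by
  classical
  rintro Q G' hsub ⟨b, hb⟩
  obtain ⟨b₀, -⟩ := hex
  have hQ : Q = Set.univ := by
    refine Set.eq_of_subset_of_ncard_le (Set.subset_univ Q) ?_
    have h1 := Module.finrank_eq_nat_card_basis b
    have h2 := Module.finrank_eq_nat_card_basis b₀
    rw [Set.ncard_univ, ← h2, h1]
    rfl
  refine ⟨hQ, ?_⟩
  subst hQ
  obtain ⟨c, d, -, hX, hY, hH⟩ := hb
  let f : Tableau r μ ≃ (Set.univ : Set (Tableau r μ)) := (Equiv.Set.univ _).symm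
  let b' : Module.Basis (Tableau r μ) ℂ V := b.reindex f.symm
  have hb' : ∀ S, b' S = b (f S) := fun S => by simp [b']
  -- the labels of the subgraph, continued by zero
  let c' : Tableau r μ → Tableau r μ → ℂ := fun T S =>
    if ∃ k, G'.Edge k (f S) (f T) then c (f T) (f S) else 0
  let d' : Tableau r μ → Tableau r μ → ℂ := fun S T =>
    if ∃ k, G'.Edge k (f S) (f T) then d (f S) (f T) else 0
  have edge : ∀ {k S T}, (GT r μ).Edge k S T → ∀ {k'}, G'.Edge k' (f S) (f T) →
      G'.Edge k (f S) (f T) := by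
    intro k S T h k' h'
    rwa [(GT r μ).color_unique h (hsub k' (f S) (f T) h')]
  have hX' : ∀ k S, ⁅(X k : SL r), b' S⁆ = ∑ T with (GT r μ).Edge k S T, c' T S • b' T := by
    intro k S
    rw [hb', hX, Finset.sum_filter, Finset.sum_filter]
    refine (Finset.sum_equiv f (fun _ => by simp only [Finset.mem_univ]) fun T _ => Eq.symm ?_).symm
    by_cases h : G'.Edge k (f S) (f T)
    · have h' : (GT r μ).Edge k S T := hsub k (f S) (f T) h
      rw [if_pos h, if_pos h', hb']
      simp only [c']
      rw [if_pos ⟨k, h⟩]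
    · rw [if_neg h]
      split_ifs with h1
      · simp only [c']
        rw [if_neg fun ⟨k', hk'⟩ => h (edge h1 hk'), zero_smul]
      · rfl
  have hY' : ∀ k T, ⁅(Y k : SL r), b' T⁆ = ∑ S with (GT r μ).Edge k S T, d' S T • b' S := by
    intro k T
    rw [hb', hY, Finset.sum_filter, Finset.sum_filter]
    refine (Finset.sum_equiv f (fun _ => by simp only [Finset.mem_univ]) fun S _ => Eq.symm ?_).symm
    by_cases h : G'.Edge k (f S) (f T)
    · have h' : (GT r μ).Edge k S T := hsub k (f S) (f T) h
      rw [if_pos h, if_pos h', hb']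
      simp only [d']
      rw [if_pos ⟨k, h⟩]
    · rw [if_neg h]
      split_ifs with h1
      · simp only [d']
        rw [if_neg fun ⟨k', hk'⟩ => h (edge h1 hk'), zero_smul]
      · rfl
  have hH' : ∀ k S, ⁅(H k : SL r), b' S⁆ = (G'.m k (f S) : ℂ) • b' S := by
    intro k S
    rw [hb', hH]
  obtain ⟨hcross, hdia⟩ := crossingWith_and_diamond (w := fun k S => (G'.m k (f S) : ℂ)) hX' hY' hH'
  -- the weights of the subgraph differ from those of the whole graph by constants, which vanish
  have hm : ∀ k S, (G'.m k (f S) : ℂ) = (GT r μ).m k S := by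
    intro k
    let φ : V →ₗ[ℂ] V := LieModule.toEnd ℂ (SL r) V (H k) -
      b'.constr ℂ fun S => ((GT r μ).m k S : ℂ) • b' S
    have hφ : ∀ S, φ (b' S) = ((G'.m k (f S) : ℂ) - (GT r μ).m k S) • b' S := by
      intro S
      rw [LinearMap.sub_apply, LieModule.toEnd_apply_apply, hH', b'.constr_basis, sub_smul]
    have hM : ∀ S, (b'.constr ℂ fun S => ((GT r μ).m k S : ℂ) • b' S) (b' S) =
        ((GT r μ).m k S : ℂ) • b' S := fun S => b'.constr_basis ℂ _ S
    have ext : ∀ z : SL r, (∀ S, φ ⁅z, b' S⁆ = ⁅z, φ (b' S)⁆) → ∀ v, φ ⁅z, v⁆ = ⁅z, φ v⁆ := by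
      intro z hz v
      have : φ ∘ₗ LieModule.toEnd ℂ (SL r) V z = LieModule.toEnd ℂ (SL r) V z ∘ₗ φ :=
        b'.ext fun S => hz S
      exact LinearMap.congr_fun this v
    obtain ⟨κ, hκ⟩ := exists_eq_smul_of_commute φ
      (fun j => ext _ fun S => by
        have h1 : (b'.constr ℂ fun S => ((GT r μ).m k S : ℂ) • b' S) ⁅(X j : SL r), b' S⁆ =
            (((GT r μ).m k S : ℂ) + cartan k j) • ⁅(X j : SL r), b' S⁆ := by
          rw [hX', map_sum, Finset.smul_sum]
          refine Finset.sum_congr rfl fun T hT => ?_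
          obtain ⟨-, p, hp⟩ := Finset.mem_filter.1 hT
          rw [map_smul, hM, smul_comm, m_of_decrement hμ k hp]
          push_cast
          rfl
        rw [hφ, LinearMap.sub_apply, h1, LieModule.toEnd_apply_apply, leibniz_lie, lie_H_X, hH',
          smul_lie, lie_smul, lie_smul]
        module)
      (fun j => ext _ fun T => by
        have h1 : (b'.constr ℂ fun S => ((GT r μ).m k S : ℂ) • b' S) ⁅(Y j : SL r), b' T⁆ =
            (((GT r μ).m k T : ℂ) - cartan k j) • ⁅(Y j : SL r), b' T⁆ := by
          rw [hY', map_sum, Finset.smul_sum]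
          refine Finset.sum_congr rfl fun S hS => ?_
          obtain ⟨-, p, hp⟩ := Finset.mem_filter.1 hS
          rw [map_smul, hM, smul_comm, m_of_decrement hμ k hp]
          push_cast
          rw [add_sub_cancel_right]
        rw [hφ, LinearMap.sub_apply, h1, LieModule.toEnd_apply_apply, leibniz_lie, lie_H_Y, hH',
          smul_lie, lie_smul, lie_smul]
        module)
    have hdiff : ∀ S, (G'.m k (f S) : ℂ) - (GT r μ).m k S = κ := fun S => by
      have h1 := (hφ S).symm.trans (hκ (b' S))
      exact smul_left_injective ℂ (b'.ne_zero S) h1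
    have s1 := hcross.sum_eq_zero k
    have s2 := (((GT r μ).crossing_iff _ _).1 (label_crossing hμ)).sum_eq_zero k
    have s3 : ∑ S : Tableau r μ, κ = 0 := by
      rw [← Finset.sum_congr rfl fun S _ => hdiff S, Finset.sum_sub_distrib, s1, s2, sub_zero]
    rw [Finset.sum_const, Finset.card_univ, nsmul_eq_mul] at s3
    have hcard : (Fintype.card (Tableau r μ) : ℂ) ≠ 0 := by
      have : Nonempty (Tableau r μ) := ⟨top hμ⟩
      exact_mod_cast Fintype.card_ne_zero
    have hκ0 := (mul_eq_zero.1 s3).resolve_left hcard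
    exact fun S => sub_eq_zero.1 ((hdiff S).trans hκ0)
  have hcross' : (GT r μ).Crossing c' d' := by
    refine ((GT r μ).crossing_iff c' d').2 fun k S => ?_
    rw [hcross k S]
    exact hm k S
  rintro k S T ⟨p, hp⟩
  have h1 := mul_eq_edgeProduct hμ hcross' hdia hp
  have h2 : c' T S ≠ 0 := by
    refine left_ne_zero_of_mul (b := d' S T) ?_
    rw [h1]
    exact_mod_cast hp.edgeProduct_pos.ne'
  simp only [c'] at h2
  obtain ⟨k', hk'⟩ : ∃ k', G'.Edge k' (f S) (f T) := by
    by_contra hc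
    exact h2 (if_neg hc)
  exact edge (show (GT r μ).Edge k S T from ⟨p, hp⟩) hk'

end Existence

end GelfandTsetlin

open GelfandTsetlin in
theorem theorem5p1 (r : ℕ) (μ : YoungDiagram) (hμ : μ.colLen 0 ≤ r + 1) :
    -- the algorithm determines all edge products from the vertex weights
    (∃ L : List (Tableau r μ), Algorithm.IsAdmissibleOrder L) ∧
    (∀ L : List (Tableau r μ), Algorithm.IsAdmissibleOrder L →
      ∀ (k : Fin r) (p : ℕ) (S R : Tableau r μ), Tableau.Decrement k p S R →
        ∃ π : ℚ, Algorithm.run (GT r μ).m L k S p = some π ∧ π ≠ 0 ∧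
          ∀ c d : Tableau r μ → Tableau r μ → ℂ, (GT r μ).Crossing c d → (GT r μ).Diamond c d →
            c R S * d S R = (π : ℂ)) ∧
    -- the irreducible representation with highest weight `μ` has `GT r μ` as a supporting graph,
    -- which is solitary and edge-minimal
    (∀ (V : Type*) [AddCommGroup V] [Module ℂ V] [LieRingModule (SL r) V] [LieModule ℂ (SL r) V]
      [FiniteDimensional ℂ V] [LieModule.IsIrreducible ℂ (SL r) V],
      (∃ v : V, v ≠ 0 ∧ ∀ k : Fin r, ⁅X k, v⁆ = 0 ∧
        ⁅H k, v⁆ = ((μ.rowLen k : ℂ) - (μ.rowLen (k + 1) : ℂ)) • v) →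
      (∃ b : Module.Basis (Tableau r μ) ℂ V, IsSupportingGraph (GT r μ) b) ∧
      IsSolitary (GT r μ) V ∧ IsEdgeMinimal (GT r μ) V) := by
  refine ⟨Algorithm.exists_isAdmissibleOrder, fun L hL k p S R h => ?_, ?_⟩
  · exact ⟨S.edgeProduct k p, Algorithm.known_run hμ hL k.2 S p R h, h.edgeProduct_pos.ne',
      fun c d hc hd => Tableau.mul_eq_edgeProduct hμ hc hd h⟩
  · rintro V _ _ _ _ _ _ ⟨v, hv, hvk⟩
    have hex := exists_isSupportingGraph hμ v hv (fun k => (hvk k).1) fun k => by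
      rw [(hvk k).2, Tableau.m_top hμ]
      push_cast
      rfl
    exact ⟨hex, isSolitary hμ V, isEdgeMinimal hμ hex⟩
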